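/- **Setting.** Let $n\ge 1$ agents have objectives $f_i(z)=\mathbb E[f_i(z;\xi_{f,i})]$ and $g_i(z)=\mathbb E[g_i(z;\xi_{g,i})]$, $z=(x,y)\in\mathbb R^{d_x}\times\mathbb R^{d_y}$. Put $F=\frac1n\sum_i f_i$, $G=\frac1n\sum_i g_i$, and for $\gamma>0$, $\mu>0$ $$V_\gamma(x,y)=\min_{\theta}\Big\{G(x,\theta)+\tfrac1{2\gamma}\|\theta-y\|^2\Big\},\qquad \Psi_\mu=\mu F+G-V_\gamma ,$$ and let $\theta^*_\gamma(x,y)$ be the minimizer in $V_\gamma(x,y)$. Assume: 1. $F\ge\underline F$; every $f_i$ (resp. $g_i$) is continuously differentiable with $L_1$-Lipschitz (resp. $L_2$-Lipschitz) gradient, $L_1,L_2>0$. 2. $\nabla f_i(z;\xi_{f,i})$ and $\nabla g_i(z;\xi_{g,i})$ are unbiased estimators of $\nabla f_i(z)$, $\nabla g_i(z)$ with variances at most $\delta_f^2$, $\delta_g^2$; the samples $(\xi_{f,i}^k,\xi_{g,i}^k)$ have the prescribed laws and are independent over all agents $i$ and iterations $k$. 3. The weight matrix $\mathbf W=(w_{ij})\in\mathbb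 R^{n\times n}$ is non-negative, symmetric and doubly stochastic, with eigenvalues $1=\lambda_1\ge\lambda_2\ge\dots\ge\lambda_n$ and $\rho:=\max\{|\lambda_2|,|\lambda_n|\}<1$ ($\rho=0$ if $n=1$). 4. $\frac1n\sum_i\|\nabla f_i(z)-\nabla F(z)\|^2\le\sigma_f^2$ and $\frac1n\sum_i\|\nabla g_i(z)-\nabla G(z)\|^2\le\sigma_g^2$ for all $z$. **Algorithm (SUN-DSBO-SE).** From arbitrary deterministic $\theta_i^0,x_i^0,y_i^0$, for $k=0,1,\dots,K-1$, $$(\theta_i^{k+1},x_i^{k+1},y_i^{k+1})=\sum_{j=1}^n w_{ij}\big(\theta_j^k-\lambda_\theta\hat D_{\theta,j}^k,\;x_j^k-\lambda_x\hat D_{x,j}^k,\;y_j^k-\lambda_y\hat D_{y,j}^k\big),$$ where $$\begin{aligned}\hat D_{\theta,i}^k&=\nabla_y g_i(x_i^k,\theta_i^k;\xi_{g,i}^k)+\tfrac1\gamma(\theta_i^k-y_i^k),\\ \hat D_{x,i}^k&=\mu_k\nabla_x f_i(x_i^k,y_i^k;\xi_{f,i}^k)+\nabla_x g_i(x_i^k,y_i^k;\xi_{g,i}^k)-\nabla_x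 g_i(x_i^k,\theta_i^k;\xi_{g,i}^k),\\ \hat D_{y,i}^k&=\mu_k\nabla_y f_i(x_i^k,y_i^k;\xi_{f,i}^k)+\nabla_y g_i(x_i^k,y_i^k;\xi_{g,i}^k)-\tfrac1\gamma(y_i^k-\theta_i^k).\end{aligned}$$ Bars denote averages over the agents, and $\Delta^k=\frac1n\sum_i\mathbb E\big(\|x_i^k-\bar x^k\|^2+\|y_i^k-\bar y^k\|^2+\|\theta_i^k-\bar\theta^k\|^2\big)=:\Delta_x^k+\Delta_y^k+\Delta_\theta^k$. **Parameters.** Let $\mu_k=\mu_0(k+1)^{-p}$ with $\mu_0>0$, $p\in(0,\frac14)$; $\gamma\in(0,\frac1{2L_2})$; $\lambda_\theta=c_\theta\sqrt{n/K}$, $\lambda_x=\lambda_y=c_\lambda\lambda_\theta$ with $c_\theta,c_\lambda>0$. Put $\eta=\frac1\gamma-L_2$, $s=\sqrt{L_2^2+\gamma^{-2}}$, fix any $L_\theta\ge s/\eta$ (a Lipschitz constant of $\theta^*_\gamma$), and let $a_1=\frac{s}{2L_\theta}$, $L_{\Phi_0}=\mu_0L_1+L_2+\max\{L_2,\frac1\gamma\}$,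 $L_{\Phi_\infty}=L_2+\min\{L_2,\frac1\gamma\}$, $M_1=4a_1+6\big(\tfrac{L_{\Phi_0}}2+4a_1L_\theta^2\big)c_\lambda^2$, $$\begin{aligned} \tau_2&=2\,\frac{3(\mu_0L_1^2+2L_2^2)c_\lambda+4(\mu_0L_1^2+L_2^2)c_\lambda+\frac{12a_1}{\eta}L_2^2}{c_\lambda(1-\rho)},\\ \tau_3&=2\,\frac{3(\mu_0L_1^2+L_2^2)c_\lambda+4(\mu_0L_1^2+L_2^2+\gamma^{-2})c_\lambda+\frac{12a_1}{\eta}\gamma^{-2}}{c_\lambda(1-\rho)},\\ \tau_4&=2\,\frac{3L_2^2c_\lambda+4\gamma^{-2}c_\lambda+\frac{12a_1}{\eta}(\gamma^{-2}+L_2^2)}{c_\lambda(1-\rho)}.\end{aligned}$$ Assume $c_\lambda\le\frac{\eta}{32a_1L_\theta^2}$ and $$\lambda_\theta\le\min\Big\{\frac4{3\eta},\;\frac{4a_1L_\theta^2}{\eta L_{\Phi_\infty}},\;\frac{\tau_2c_\lambda(1-\rho)^2}{192a_1L_2^2},\;\frac{\tau_3c_\lambda(1-\rho)^2}{192a_1\gamma^{-2}},\;\frac{\tau_4c_\lambda(1-\rho)^2}{192a_1(L_2^2+\gamma^{-2})}\Big\}.$$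 **Theorem.** There is a constant $C$ depending only on $L_1,L_2,\gamma,\mu_0,p,c_\theta,c_\lambda,L_\theta$ (and not on $n$, $K$, $\rho$, the dimensions, $\delta_f,\delta_g,\sigma_f,\sigma_g$, $\underline F$, the functions, or the initial points) such that under these assumptions, for every $K\ge1$: the minimum defining $V_\gamma$ is attained, $\Psi_{\mu_k}$ is differentiable, the expectations below are finite, and $$\frac1K\sum_{k=0}^{K-1}\mathbb E\|\nabla\Psi_{\mu_k}(\bar x^k,\bar y^k)\|^2\le C\Big(\frac{\mathcal C_1}{\sqrt{nK}}+\frac{n(\delta_f^2+\delta_g^2)}{(1-\rho)^2K}+\frac{n(\sigma_f^2+\sigma_g^2)}{(1-\rho)^2K}\Big),$$ $$\frac1K\sum_{k=0}^{K-1}\Delta^k\le C\Big(\frac{\mathcal C_1}{\sqrt K}+\frac{n^{3/2}(\delta_f^2+\delta_g^2)}{(1-\rho)^2K}+\frac{n^{3/2}(\sigma_f^2+\sigma_g^2)}{(1-\rho)^2K}\Big),$$ where, with $R:=\mu_0(F-\underline F)(\bar x^0,\bar y^0)+(G-V_\gamma)(\bar x^0,\bar y^0)$, $$\mathcal C_1=R+a_1\|\bar\theta^0-\theta^*_\gamma(\bar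 x^0,\bar y^0)\|^2+\tau_2\lambda_x\Delta_x^0+\tau_3\lambda_y\Delta_y^0+\tau_4\lambda_\theta\Delta_\theta^0+M_1(\mu_0\delta_f^2+2\delta_g^2).$$ Moreover $\mathcal C_1$ is bounded independently of $n$ and $1-\rho$: $\mathcal C_1\le C\big(R+\|\bar\theta^0-\theta^*_\gamma(\bar x^0,\bar y^0)\|^2+\Delta^0+\delta_f^2+\delta_g^2\big)$. -/

import Mathlib

open MeasureTheory ProbabilityTheory

universe u v w

noncomputable section

namespace SunDSBO

/-- The Euclidean space of dimension `d`. -/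
abbrev Vec (d : ℕ) := EuclideanSpace ℝ (Fin d)

/-- The joint space of pairs `(x, y)` with the Euclidean norm `‖(x, y)‖² = ‖x‖² + ‖y‖²`. -/
abbrev Joint (dx dy : ℕ) := WithLp 2 (Vec dx × Vec dy)

/-- The point `(x, y)` of the joint space. -/
def pair {dx dy : ℕ} (x : Vec dx) (y : Vec dy) : Joint dx dy := WithLp.toLp 2 (x, y)

/-- The `x`-component of the gradient of `h` at `(x, y)`. -/
def gradX {dx dy : ℕ} (h : Joint dx dy → ℝ) (x : Vec dx) (y : Vec dy) : Vec dx :=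
  (gradient h (pair x y)).fst

/-- The `y`-component of the gradient of `h` at `(x, y)`. -/
def gradY {dx dy : ℕ} (h : Joint dx dy → ℝ) (x : Vec dx) (y : Vec dy) : Vec dy :=
  (gradient h (pair x y)).snd

/-- The average over the agents. -/
def avg {n d : ℕ} (v : Fin n → Vec d) : Vec d := (n : ℝ)⁻¹ • ∑ i, v i

/-! ### The bilevel problem -/

/-- The data of a decentralized stochastic bilevel problem with `n` agents: the sample losses
`f_i(·; ξ)` and `g_i(·; ξ)` and the laws of the samples `ξ_{f,i}` and `ξ_{g,i}`. -/
structure Problem (n dx dy : ℕ) (Ξf : Type u) (Ξg : Type v)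
    [MeasurableSpace Ξf] [MeasurableSpace Ξg] where
  fSample : Fin n → Ξf → Joint dx dy → ℝ
  gSample : Fin n → Ξg → Joint dx dy → ℝ
  lawF : Fin n → Measure Ξf
  lawG : Fin n → Measure Ξg

section

variable {n dx dy : ℕ} {Ξf : Type u} {Ξg : Type v} [MeasurableSpace Ξf] [MeasurableSpace Ξg]

/-- The local upper-level objective `f_i(z) = E[f_i(z; ξ_{f,i})]`. -/
def Problem.f (P : Problem n dx dy Ξf Ξg) (i : Fin n) (z : Joint dx dy) : ℝ :=
  ∫ ξ, P.fSample i ξ z ∂(P.lawF i)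

/-- The local lower-level objective `g_i(z) = E[g_i(z; ξ_{g,i})]`. -/
def Problem.g (P : Problem n dx dy Ξf Ξg) (i : Fin n) (z : Joint dx dy) : ℝ :=
  ∫ ξ, P.gSample i ξ z ∂(P.lawG i)

/-- The upper-level objective `F`. -/
def Problem.F (P : Problem n dx dy Ξf Ξg) (z : Joint dx dy) : ℝ :=
  (n : ℝ)⁻¹ * ∑ i, P.f i z

/-- The lower-level objective `G`. -/
def Problem.G (P : Problem n dx dy Ξf Ξg) (z : Joint dx dy) : ℝ :=
  (n : ℝ)⁻¹ * ∑ i, P.g i z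

/-- The proximal objective `θ ↦ G(x, θ) + ‖θ - y‖² / (2γ)` attached to `z = (x, y)`. -/
def Problem.proxObj (P : Problem n dx dy Ξf Ξg) (γ : ℝ) (z : Joint dx dy) (θ : Vec dy) : ℝ :=
  P.G (pair z.fst θ) + 1 / (2 * γ) * ‖θ - z.snd‖ ^ 2

/-- The Moreau envelope `V_γ` of the lower-level objective. -/
def Problem.V (P : Problem n dx dy Ξf Ξg) (γ : ℝ) (z : Joint dx dy) : ℝ :=
  ⨅ θ : Vec dy, P.proxObj γ z θ

/-- The minimizer `θ*_γ(x, y)` of the proximal objective. -/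
def Problem.prox (P : Problem n dx dy Ξf Ξg) (γ : ℝ) (z : Joint dx dy) : Vec dy :=
  Classical.epsilon fun θ => IsMinOn (P.proxObj γ z) Set.univ θ

/-- The penalized objective `Ψ_μ = μ F + G - V_γ`. -/
def Problem.Psi (P : Problem n dx dy Ξf Ξg) (γ μ : ℝ) (z : Joint dx dy) : ℝ :=
  μ * P.F z + P.G z - P.V γ z

/-- The shifted penalized objective `Φ_μ = μ (F - F_low) + G - V_γ`. -/
def Problem.Phi (P : Problem n dx dy Ξf Ξg) (γ Flow μ : ℝ) (z : Joint dx dy) : ℝ :=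
  μ * (P.F z - Flow) + P.G z - P.V γ z

/-! ### Assumptions -/

/-- `h` is continuously differentiable with `L`-Lipschitz gradient. -/
structure IsSmooth {dx dy : ℕ} (h : Joint dx dy → ℝ) (L : ℝ) : Prop where
  contDiff : ContDiff ℝ 1 h
  lipschitz : ∀ z z', ‖gradient h z - gradient h z'‖ ≤ L * ‖z - z'‖

/-- The gradients `∇h(z; ξ)`, `ξ ∼ law`, of the sample loss are unbiased estimators of the gradient
of `z ↦ E[h(z; ξ)]` with variance at most `δ²`. The first four fields say that all the
objects involved are meaningful. -/
structure StochasticOracle {dx dy : ℕ} {Ξ : Type u} [MeasurableSpace Ξ]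
    (h : Ξ → Joint dx dy → ℝ) (law : Measure Ξ) (δ : ℝ) : Prop where
  prob : IsProbabilityMeasure law
  integrable : ∀ z, Integrable (fun ξ => h ξ z) law
  differentiable : ∀ ξ, Differentiable ℝ (h ξ)
  measurable : Measurable (Function.uncurry fun ξ z => gradient (h ξ) z)
  grad_integrable : ∀ z, Integrable (fun ξ => gradient (h ξ) z) law
  unbiased : ∀ z, ∫ ξ, gradient (h ξ) z ∂law = gradient (fun z' => ∫ ξ, h ξ z' ∂law) z
  sq_integrable : ∀ z, Integrable
    (fun ξ => ‖gradient (fun z' => ∫ ξ', h ξ' z' ∂law) z - gradient (h ξ) z‖ ^ 2) law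
  variance : ∀ z,
    ∫ ξ, ‖gradient (fun z' => ∫ ξ', h ξ' z' ∂law) z - gradient (h ξ) z‖ ^ 2 ∂law ≤ δ ^ 2

/-- The weight matrix `W` is non-negative, symmetric and doubly stochastic; with its eigenvalues
`λ₁ ≥ λ₂ ≥ ⋯ ≥ λₙ`, listed with multiplicity, `ρ = max (|λ₂|, |λₙ|)`, that is, the largest modulus of
all the eigenvalues but the first (`0` for a single agent), and `ρ < 1`. -/
structure NetworkMatrix {n : ℕ} (W : Matrix (Fin n) (Fin n) ℝ) (ρ : ℝ) : Prop where
  doublyStochastic : W ∈ doublyStochastic ℝ (Fin n)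
  symm : W.IsHermitian
  rho_eq : ρ = ⨆ i : {i : Fin (Fintype.card (Fin n)) // (i : ℕ) ≠ 0}, |symm.eigenvalues₀ i|
  rho_lt_one : ρ < 1

/-- Gradient dissimilarity: `n⁻¹ ∑ᵢ ‖∇hᵢ(z) - ∇H(z)‖² ≤ σ²` for all `z`. -/
def BoundedDissimilarity {n dx dy : ℕ} (h : Fin n → Joint dx dy → ℝ) (H : Joint dx dy → ℝ)
    (σ : ℝ) : Prop :=
  ∀ z, (n : ℝ)⁻¹ * ∑ i, ‖gradient (h i) z - gradient H z‖ ^ 2 ≤ σ ^ 2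

/-- All the assumptions on the problem and on the network. -/
structure Assumptions (P : Problem n dx dy Ξf Ξg) (W : Matrix (Fin n) (Fin n) ℝ)
    (L₁ L₂ ρ δf δg σf σg Flow : ℝ) : Prop where
  lower_bound : ∀ z, Flow ≤ P.F z
  smooth_f : ∀ i, IsSmooth (P.f i) L₁
  smooth_g : ∀ i, IsSmooth (P.g i) L₂
  oracle_f : ∀ i, StochasticOracle (P.fSample i) (P.lawF i) δf
  oracle_g : ∀ i, StochasticOracle (P.gSample i) (P.lawG i) δg
  network : NetworkMatrix W ρ
  dissimilar_f : BoundedDissimilarity P.f P.F σf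
  dissimilar_g : BoundedDissimilarity P.g P.G σg

/-- `ξf k i` and `ξg k i` are the samples drawn by agent `i` at iteration `k`: they have the right
laws, and the pairs `(ξf k i, ξg k i)` are independent over all `k` and `i`. -/
structure Sampling {Ω : Type w} [MeasurableSpace Ω] (P : Problem n dx dy Ξf Ξg) (Pr : Measure Ω)
    (ξf : ℕ → Fin n → Ω → Ξf) (ξg : ℕ → Fin n → Ω → Ξg) : Prop where
  measurable_f : ∀ k i, Measurable (ξf k i)
  measurable_g : ∀ k i, Measurable (ξg k i)
  law_f : ∀ k i, Pr.map (ξf k i) = P.lawF i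
  law_g : ∀ k i, Pr.map (ξg k i) = P.lawG i
  indep : iIndepFun (fun (a : ℕ × Fin n) ω => (ξf a.1 a.2 ω, ξg a.1 a.2 ω)) Pr

/-! ### The algorithm SUN-DSBO-SE -/

/-- The local variables `θ_i, x_i, y_i` of all the agents. -/
structure State (n dx dy : ℕ) where
  θ : Fin n → Vec dy
  x : Fin n → Vec dx
  y : Fin n → Vec dy

/-- The stochastic direction for `θ_i`. -/
def dirTheta (P : Problem n dx dy Ξf Ξg) (γ : ℝ) (s : State n dx dy) (ξg : Fin n → Ξg)
    (i : Fin n) : Vec dy :=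
  gradY (P.gSample i (ξg i)) (s.x i) (s.θ i) + (1 / γ) • (s.θ i - s.y i)

/-- The stochastic direction for `x_i`. -/
def dirX (P : Problem n dx dy Ξf Ξg) (μ : ℝ) (s : State n dx dy) (ξf : Fin n → Ξf)
    (ξg : Fin n → Ξg) (i : Fin n) : Vec dx :=
  μ • gradX (P.fSample i (ξf i)) (s.x i) (s.y i) + gradX (P.gSample i (ξg i)) (s.x i) (s.y i)
    - gradX (P.gSample i (ξg i)) (s.x i) (s.θ i)

/-- The stochastic direction for `y_i`. -/
def dirY (P : Problem n dx dy Ξf Ξg) (γ μ : ℝ) (s : State n dx dy) (ξf : Fin n → Ξf)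
    (ξg : Fin n → Ξg) (i : Fin n) : Vec dy :=
  μ • gradY (P.fSample i (ξf i)) (s.x i) (s.y i) + gradY (P.gSample i (ξg i)) (s.x i) (s.y i)
    - (1 / γ) • (s.y i - s.θ i)

/-- One iteration, with penalty parameter `μ`, learning rates `lθ, lx, ly`, and samples `ξf, ξg`. -/
def step (P : Problem n dx dy Ξf Ξg) (W : Matrix (Fin n) (Fin n) ℝ) (γ μ lθ lx ly : ℝ)
    (ξf : Fin n → Ξf) (ξg : Fin n → Ξg) (s : State n dx dy) : State n dx dy where
  θ i := ∑ j, W i j • (s.θ j - lθ • dirTheta P γ s ξg j)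
  x i := ∑ j, W i j • (s.x j - lx • dirX P μ s ξf ξg j)
  y i := ∑ j, W i j • (s.y j - ly • dirY P γ μ s ξf ξg j)

/-- The iterates of SUN-DSBO-SE started at the (deterministic) state `s₀`, for the sequence `μ` of
penalty parameters and the sequences `lθ, lx, ly` of learning rates. -/
def iterates {Ω : Type w} (P : Problem n dx dy Ξf Ξg) (W : Matrix (Fin n) (Fin n) ℝ) (γ : ℝ)
    (μ lθ lx ly : ℕ → ℝ) (ξf : ℕ → Fin n → Ω → Ξf) (ξg : ℕ → Fin n → Ω → Ξg)
    (s₀ : State n dx dy) : ℕ → Ω → State n dx dy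
  | 0, _ => s₀
  | k + 1, ω => step P W γ (μ k) (lθ k) (lx k) (ly k) (fun i => ξf k i ω) (fun i => ξg k i ω)
      (iterates P W γ μ lθ lx ly ξf ξg s₀ k ω)

/-- The averaged iterate `(x̄, ȳ)`. -/
def State.mean (s : State n dx dy) : Joint dx dy := pair (avg s.x) (avg s.y)

/-- `n⁻¹ ∑ᵢ ‖x_i - x̄‖²`. -/
def State.devX (s : State n dx dy) : ℝ := (n : ℝ)⁻¹ * ∑ i, ‖s.x i - avg s.x‖ ^ 2

/-- `n⁻¹ ∑ᵢ ‖y_i - ȳ‖²`. -/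
def State.devY (s : State n dx dy) : ℝ := (n : ℝ)⁻¹ * ∑ i, ‖s.y i - avg s.y‖ ^ 2

/-- `n⁻¹ ∑ᵢ ‖θ_i - θ̄‖²`. -/
def State.devTheta (s : State n dx dy) : ℝ := (n : ℝ)⁻¹ * ∑ i, ‖s.θ i - avg s.θ‖ ^ 2

/-- The consensus error `n⁻¹ ∑ᵢ (‖x_i - x̄‖² + ‖y_i - ȳ‖² + ‖θ_i - θ̄‖²)` of a state. -/
def State.consensusError (s : State n dx dy) : ℝ := s.devX + s.devY + s.devTheta

end

/-! ### Parameters and step-size conditions -/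

/-- The smoothness constants `L₁, L₂`, the parameter `γ` of the Moreau envelope, the parameters
`μ₀, p` of the penalty sequence, the step-size constants `c_θ, c_λ`, and a Lipschitz constant `L_θ`
of the map `θ*_γ`. -/
structure Params where
  L₁ : ℝ
  L₂ : ℝ
  γ : ℝ
  μ₀ : ℝ
  p : ℝ
  cθ : ℝ
  cLam : ℝ
  Lθ : ℝ

namespace Params

variable (c : Params)

/-- The modulus of strong convexity `η = 1/γ - L₂` of the proximal objective. -/
def eta : ℝ := 1 / c.γ - c.L₂

/-- The coefficient `a₁`. -/
def a₁ : ℝ := 1 / (2 * c.Lθ) * √(c.L₂ ^ 2 + 1 / c.γ ^ 2)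

/-- The smoothness constant `L_{Φ_0}` of `Φ_{μ_0}`. -/
def LPhi₀ : ℝ := c.μ₀ * c.L₁ + c.L₂ + max c.L₂ (1 / c.γ)

/-- The constant `L_{Φ_∞}`. -/
def LPhiInf : ℝ := c.L₂ + min c.L₂ (1 / c.γ)

/-- The coefficient `τ₂`. -/
def tau₂ (ρ : ℝ) : ℝ :=
  2 * ((3 * (c.μ₀ * c.L₁ ^ 2 + 2 * c.L₂ ^ 2) * c.cLam
      + 4 * (c.μ₀ * c.L₁ ^ 2 + c.L₂ ^ 2) * c.cLam)
      + 2 * c.a₁ * (6 / c.eta) * c.L₂ ^ 2) / (c.cLam * (1 - ρ))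

/-- The coefficient `τ₃`. -/
def tau₃ (ρ : ℝ) : ℝ :=
  2 * ((3 * (c.μ₀ * c.L₁ ^ 2 + c.L₂ ^ 2) * c.cLam
      + 4 * (c.μ₀ * c.L₁ ^ 2 + c.L₂ ^ 2 + 1 / c.γ ^ 2) * c.cLam)
      + 2 * c.a₁ * (6 / c.eta) * (1 / c.γ ^ 2)) / (c.cLam * (1 - ρ))

/-- The coefficient `τ₄`. -/
def tau₄ (ρ : ℝ) : ℝ :=
  2 * ((3 * c.L₂ ^ 2 * c.cLam + 4 / c.γ ^ 2 * c.cLam)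
      + 2 * c.a₁ * (6 / c.eta) * (1 / c.γ ^ 2 + c.L₂ ^ 2)) / (c.cLam * (1 - ρ))

/-- The coefficient `M₁`. -/
def M₁ : ℝ := 4 * c.a₁ + 6 * (c.LPhi₀ / 2 + 4 * c.a₁ * c.Lθ ^ 2) * c.cLam ^ 2

/-- The penalty parameters `μ_k = μ₀ (k + 1)^{-p}`. -/
def mu (k : ℕ) : ℝ := c.μ₀ * ((k : ℝ) + 1) ^ (-c.p)

/-- The constant learning rate `c_θ √(n / K)`. -/
def rateTheta (n K : ℕ) : ℝ := c.cθ * √((n : ℝ) / (K : ℝ))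

/-- The conditions on the parameters that involve neither the network nor the horizon. The last
lower bound on `Lθ` is the Lipschitz constant of `θ*_γ` which the `η`-strong convexity of the
proximal objective gives for every `L₂`-smooth lower-level objective. -/
structure Admissible : Prop where
  L₁_pos : 0 < c.L₁
  L₂_pos : 0 < c.L₂
  γ_pos : 0 < c.γ
  γ_lt : c.γ < 1 / (2 * c.L₂)
  μ₀_pos : 0 < c.μ₀
  p_pos : 0 < c.p
  p_lt : c.p < 1 / 4
  cθ_pos : 0 < c.cθ
  cLam_pos : 0 < c.cLam
  Lθ_ge : √(c.L₂ ^ 2 + 1 / c.γ ^ 2) / c.eta ≤ c.Lθ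
  cLam_le : c.cLam ≤ c.eta / (32 * c.a₁ * c.Lθ ^ 2)

/-- The smallness conditions on the learning rate `l` for `θ`. -/
structure StepCondition (ρ l : ℝ) : Prop where
  le₁ : l ≤ 4 / (3 * c.eta)
  le₂ : l ≤ 4 * c.a₁ * c.Lθ ^ 2 / (c.eta * c.LPhiInf)
  le₃ : l ≤ c.tau₂ ρ * c.cLam * (1 - ρ) / (96 * c.L₂ ^ 2 * (2 * c.a₁) * (1 / (1 - ρ)))
  le₄ : l ≤ c.tau₃ ρ * c.cLam * (1 - ρ) / (96 * (1 / c.γ ^ 2) * (2 * c.a₁) * (1 / (1 - ρ)))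
  le₅ : l ≤ c.tau₄ ρ * c.cLam * (1 - ρ) /
    (96 * (c.L₂ ^ 2 + 1 / c.γ ^ 2) * (2 * c.a₁) * (1 / (1 - ρ)))

section

variable {n dx dy : ℕ} {Ξf : Type u} {Ξg : Type v} [MeasurableSpace Ξf] [MeasurableSpace Ξg]

/-- The iterates of SUN-DSBO-SE for the horizon `K`, with `μ_k = μ₀ (k + 1)^{-p}`,
`λ_θ^k = c_θ √(n / K)` and `λ_x^k = λ_y^k = c_λ λ_θ^k`. -/
def run {Ω : Type w} (P : Problem n dx dy Ξf Ξg) (W : Matrix (Fin n) (Fin n) ℝ) (K : ℕ)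
    (ξf : ℕ → Fin n → Ω → Ξf) (ξg : ℕ → Fin n → Ω → Ξg) (s₀ : State n dx dy) :
    ℕ → Ω → State n dx dy :=
  iterates P W c.γ c.mu (fun _ => c.rateTheta n K) (fun _ => c.cLam * c.rateTheta n K)
    (fun _ => c.cLam * c.rateTheta n K) ξf ξg s₀

/-- The initial value of the Lyapunov function, for the learning rate `l` of `θ`. -/
def lyapunov₀ (P : Problem n dx dy Ξf Ξg) (Flow ρ l : ℝ) (s₀ : State n dx dy) : ℝ :=
  P.Phi c.γ Flow (c.mu 0) s₀.mean + c.a₁ * ‖avg s₀.θ - P.prox c.γ s₀.mean‖ ^ 2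
    + c.tau₂ ρ * (c.cLam * l) * s₀.devX + c.tau₃ ρ * (c.cLam * l) * s₀.devY
    + c.tau₄ ρ * l * s₀.devTheta

/-- The constant `C₁` of the convergence rate. -/
def C₁ (P : Problem n dx dy Ξf Ξg) (Flow ρ l δf δg : ℝ) (s₀ : State n dx dy) : ℝ :=
  c.lyapunov₀ P Flow ρ l s₀ + c.M₁ * (c.μ₀ * δf ^ 2 + 2 * δg ^ 2)

end

end Params

end SunDSBO

end

noncomputable section

set_option linter.unusedSectionVars false

/-! The map `θ*_γ` is only known to be Lipschitz, and this shapes the argument. Write `z̄ = (x̄, ȳ)`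
and `l = λ_θ`. Along `z̄`, the function `Φ_μ` decreases as in inexact gradient descent, because the
averaged mean direction differs from `∇Ψ_μ` only through the consensus error and the tracking error
of `θ̄`. If the latter were measured against `θ*_γ(z̄)`, the noise of the step would move the
target. Without smoothness of `θ*_γ` the cross term has no reason to vanish in expectation, and
Young's inequality would leave a variance term of order `l` where only `l²` is affordable.

The remedy is a filtered noise `q`, started at `0` and updated by `q ↦ (1 - lη) q + c_λ l ·
(averaged noise)`. The noise cancels in `z̄ + q`, so the next target `θ*_γ(z̄ + q)` is known before
the samples are drawn. The noise then enters the tracking error only linearly, through `θ̄`, and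
contributes a variance `l² δ_g² / n`. In return `‖q‖²` has to be controlled, but it contracts at the
rate of the tracking error and also receives only `l²` times a variance over `n`. This leads to the
Lyapunov function `lyap`, namely `Φ_μ(z̄) + η ‖θ̄ - θ*_γ(z̄ + q)‖² + kq ‖q‖² + (kd l / (1 - ρ)) Δ`,
and to its one-step estimate `lyap_one_step`.

The consensus error contracts because `W` acts with norm at most `ρ` on vectors of zero sum. Young's
inequality makes the dissimilarity of the mean directions cost `l² / (1 - ρ)`, while the centred
noise costs only `l²`. With the weight `l / (1 - ρ)` the errors become `l³ σ² / (1 - ρ)²` and `l³ δ²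
/ (1 - ρ)`.

The parameter conditions are used through `c_λ lip² ≤ 1/16` and `l / γ ≤ 25 (1 - ρ) / 96`. They
absorb everything except residual terms caused by the smoothness constant `μ L₁`. These are
nonpositive once `μ L₁ ≤ 1/γ`, which holds from some index `k₀` on because `μ_k → 0`, and `k₀`
depends on the parameters only. Before `k₀` the residual is at most a constant multiple of the
Lyapunov function (`residual_le_growthAt_mul`), so the discrete Gronwall argument
`sum_le_of_recursion` loses only the factor `(1 + growth)^k₀`. Decreasing `μ_k` is free, as `Φ_μ` is
nondecreasing in `μ`.

Since the samples of iteration `k` are independent of the past, the one-step estimate, proved for a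
fixed state, can be integrated and summed. Dividing by `l K` with `l = c_θ √(n/K)` turns the initial
value into `1/√(nK)`, the averaged noise into `δ²/√(nK)`, which `𝒞₁` dominates, and the consensus
errors into `n/K`. -/

namespace SunDSBO

/-! ### Averages over the agents -/

section Averages

variable {n : ℕ} {E : Type*} [NormedAddCommGroup E] [InnerProductSpace ℝ E]

/-- The average of a finite family in a real vector space. -/
def amean {E : Type*} [AddCommGroup E] [Module ℝ E] (v : Fin n → E) : E := (n : ℝ)⁻¹ • ∑ i, v i

/-- The mean square deviation from the average. -/
def dev (v : Fin n → E) : ℝ := amean fun i => ‖v i - amean v‖ ^ 2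

lemma amean_add (u v : Fin n → E) : amean (fun i => u i + v i) = amean u + amean v := by
  simp [amean, Finset.sum_add_distrib]

lemma amean_sub (u v : Fin n → E) : amean (fun i => u i - v i) = amean u - amean v := by
  simp [amean, Finset.sum_sub_distrib, smul_sub]

lemma amean_smul (c : ℝ) (v : Fin n → E) : amean (fun i => c • v i) = c • amean v := by
  simp only [amean, ← Finset.smul_sum]; rw [smul_comm]

lemma amean_mul (c : ℝ) (v : Fin n → ℝ) : amean (fun i => c * v i) = c * amean v :=
  amean_smul c v

lemma amean_const (hn : 0 < n) (v : E) : amean (fun _ : Fin n => v) = v := by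
  have : (n : ℝ) ≠ 0 := by positivity
  simp [amean, ← Nat.cast_smul_eq_nsmul ℝ, smul_smul, this]

lemma amean_mono {a b : Fin n → ℝ} (h : ∀ i, a i ≤ b i) : amean a ≤ amean b :=
  mul_le_mul_of_nonneg_left (Finset.sum_le_sum fun i _ => h i) (by positivity)

lemma amean_nonneg {a : Fin n → ℝ} (h : ∀ i, 0 ≤ a i) : 0 ≤ amean a :=
  mul_nonneg (by positivity) (Finset.sum_nonneg fun i _ => h i)

lemma map_amean {F : Type*} [NormedAddCommGroup F] [InnerProductSpace ℝ F] (T : E →L[ℝ] F)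
    (v : Fin n → E) : T (amean v) = amean fun i => T (v i) := by
  simp [amean]

lemma dev_nonneg (v : Fin n → E) : 0 ≤ dev v := amean_nonneg fun _ => by positivity

lemma amean_inner_sub_amean (hn : 0 < n) (v : Fin n → E) (r : E) :
    amean (fun i => inner ℝ (v i - amean v) r) = 0 := by
  have h := map_amean (innerSL ℝ r) fun i => v i - amean v
  rw [amean_sub, amean_const hn, sub_self, map_zero] at h
  simp only [innerSL_apply_apply] at h
  simpa only [real_inner_comm] using h.symm

/-- Bias-variance decomposition: the cross term vanishes because deviations from the average sum to
zero. -/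
lemma amean_norm_sq_sub (hn : 0 < n) (v : Fin n → E) (r : E) :
    amean (fun i => ‖v i - r‖ ^ 2) = dev v + ‖amean v - r‖ ^ 2 := by
  have h : ∀ i, ‖v i - r‖ ^ 2 = ‖v i - amean v‖ ^ 2
      + 2 * inner ℝ (v i - amean v) (amean v - r) + ‖amean v - r‖ ^ 2 := fun i => by
    rw [← norm_add_sq_real, sub_add_sub_cancel]
  simp only [h]
  rw [amean_add, amean_add, amean_mul, amean_inner_sub_amean hn, amean_const hn, dev]
  ring

/-- The average is the best centre, so a deviation may be estimated with whatever centre is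
convenient. -/
lemma dev_le (hn : 0 < n) (v : Fin n → E) (r : E) : dev v ≤ amean fun i => ‖v i - r‖ ^ 2 := by
  rw [amean_norm_sq_sub hn]; nlinarith [sq_nonneg ‖amean v - r‖]

lemma norm_amean_sq_le (hn : 0 < n) (v : Fin n → E) :
    ‖amean v‖ ^ 2 ≤ amean fun i => ‖v i‖ ^ 2 := by
  have h := amean_norm_sq_sub hn v 0
  simp only [sub_zero] at h
  rw [h]; linarith [dev_nonneg v]

lemma amean_pair {dx dy : ℕ} (x : Fin n → Vec dx) (y : Fin n → Vec dy) :
    amean (fun i => pair (x i) (y i)) = pair (amean x) (amean y) := by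
  apply WithLp.ofLp_injective
  refine Prod.ext ?_ ?_
  · exact map_amean (WithLp.fstL 2 ℝ (Vec dx) (Vec dy)) fun i => pair (x i) (y i)
  · exact map_amean (WithLp.sndL 2 ℝ (Vec dx) (Vec dy)) fun i => pair (x i) (y i)

lemma dev_pair {dx dy : ℕ} (x : Fin n → Vec dx) (y : Fin n → Vec dy) :
    dev (fun i => pair (x i) (y i)) = dev x + dev y := by
  unfold dev
  rw [amean_pair, ← amean_add]
  congr 1; ext i
  rw [WithLp.prod_norm_sq_eq_of_L2]
  rfl

end Averages

/-! ### Contraction of the consensus error -/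

section Gossip

variable {n : ℕ} {W : Matrix (Fin n) (Fin n) ℝ} {ρ : ℝ}

lemma NetworkMatrix.rho_nonneg (hW : NetworkMatrix W ρ) : 0 ≤ ρ := by
  rw [hW.rho_eq]; exact Real.iSup_nonneg fun _ => abs_nonneg _

lemma NetworkMatrix.abs_eigenvalues₀_le (hW : NetworkMatrix W ρ)
    (i : Fin (Fintype.card (Fin n))) (hi : (i : ℕ) ≠ 0) : |hW.symm.eigenvalues₀ i| ≤ ρ := by
  refine le_of_le_of_eq ?_ hW.rho_eq.symm
  exact le_ciSup (f := fun i : {i : Fin (Fintype.card (Fin n)) // (i : ℕ) ≠ 0} =>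
    |hW.symm.eigenvalues₀ i|) (Set.finite_range _).bddAbove ⟨i, hi⟩

/-- `eigenvalues` is `eigenvalues₀` re-indexed along the equivalence `e`, so the exceptional index
is the image of the first one. -/
lemma NetworkMatrix.exists_eigenvalues_le (hW : NetworkMatrix W ρ) (hn : 0 < n) :
    ∃ i₀, ∀ i, i ≠ i₀ → |hW.symm.eigenvalues i| ≤ ρ := by
  have h0 : 0 < Fintype.card (Fin n) := by simpa using hn
  let e : Fin (Fintype.card (Fin n)) ≃ Fin n := Fintype.equivOfCardEq (Fintype.card_fin _)
  refine ⟨e ⟨0, h0⟩, fun i hi => hW.abs_eigenvalues₀_le (e.symm i) fun h => hi ?_⟩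
  rw [← e.symm_apply_eq]
  exact Fin.ext h

/-- Every eigenvector except one has an eigenvalue less than `1`, hence is orthogonal to the
constant vector, which `W` fixes. The remaining eigenvector is therefore parallel to the constants,
and a vector of zero sum has no component along it. On the other components `W` acts by factors of
modulus at most `ρ`. -/
lemma NetworkMatrix.sum_mulVec_sq_le (hW : NetworkMatrix W ρ) (hn : 0 < n) (v : Fin n → ℝ)
    (hv : ∑ i, v i = 0) : ∑ i, (∑ j, W i j * v j) ^ 2 ≤ ρ ^ 2 * ∑ i, v i ^ 2 := by
  obtain ⟨i₀, hi₀⟩ := hW.exists_eigenvalues_le hn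
  set b := hW.symm.eigenvectorBasis with hb
  have key : ∀ (u : Fin n → ℝ) (i : Fin n), inner ℝ (b i) (WithLp.toLp 2 (W.mulVec u))
      = hW.symm.eigenvalues i * inner ℝ (b i) (WithLp.toLp 2 u) := by
    intro u i
    have h1 : ∀ w : Fin n → ℝ, inner ℝ (b i) (WithLp.toLp 2 w) = (b i).ofLp ⬝ᵥ w := by
      intro w
      simp [PiLp.inner_apply, dotProduct, mul_comm]
    have h2 := hW.symm.mulVec_eigenvectorBasis i
    have hT : W.transpose = W := by
      have : W.IsSymm := by simpa using hW.symm
      exact this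
    rw [h1, h1, Matrix.dotProduct_mulVec, ← Matrix.mulVec_transpose, hT, h2, smul_dotProduct,
      smul_eq_mul]
  have hone : ∀ i, i ≠ i₀ → inner ℝ (b i) (WithLp.toLp 2 (1 : Fin n → ℝ)) = 0 := by
    intro i hi
    have h := key 1 i
    rw [mulVec_one_of_mem_doublyStochastic hW.doublyStochastic] at h
    have h1 := hi₀ i hi
    have h2 := hW.rho_lt_one
    have h3 : hW.symm.eigenvalues i < 1 := lt_of_le_of_lt (le_trans (le_abs_self _) h1) h2
    have h4 : (1 - hW.symm.eigenvalues i) * inner ℝ (b i) (WithLp.toLp 2 (1 : Fin n → ℝ)) = 0 := by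
      linarith
    rcases mul_eq_zero.1 h4 with h5 | h5
    · linarith
    · exact h5
  have hv0 : inner ℝ (b i₀) (WithLp.toLp 2 v) = 0 := by
    have hexp := b.sum_repr' (WithLp.toLp 2 (1 : Fin n → ℝ))
    rw [Finset.sum_eq_single i₀ (fun i _ hi => by rw [hone i hi, zero_smul]) (by simp)] at hexp
    have hv' : inner ℝ (WithLp.toLp 2 (1 : Fin n → ℝ)) (WithLp.toLp 2 v) = 0 := by
      simp [PiLp.inner_apply, hv]
    rw [← hexp, real_inner_smul_left] at hv'
    rcases mul_eq_zero.1 hv' with h5 | h5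
    -- If this coefficient vanished, the all-ones vector would be zero; its first entry, which
    -- exists as `0 < n`, refutes this.
    · rw [h5, zero_smul] at hexp
      have := congrArg (fun w : EuclideanSpace ℝ (Fin n) => w ⟨0, hn⟩) hexp
      simp at this
    · exact h5
  have e1 : ∑ i, (∑ j, W i j * v j) ^ 2 = ‖(WithLp.toLp 2 (W.mulVec v) : EuclideanSpace ℝ _)‖ ^ 2 := by
    simp [EuclideanSpace.norm_sq_eq, Matrix.mulVec, dotProduct]
  have e2 : ∑ i, v i ^ 2 = ‖(WithLp.toLp 2 v : EuclideanSpace ℝ _)‖ ^ 2 := by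
    simp [EuclideanSpace.norm_sq_eq]
  rw [e1, e2, ← b.sum_sq_norm_inner_right, ← b.sum_sq_norm_inner_right, Finset.mul_sum]
  refine Finset.sum_le_sum fun i _ => ?_
  rw [key, norm_mul, mul_pow]
  by_cases hi : i = i₀
  · subst hi; simp [hv0]
  · exact mul_le_mul_of_nonneg_right (pow_le_pow_left₀ (norm_nonneg _) (hi₀ i hi) 2) (sq_nonneg _)

variable {E : Type*} [NormedAddCommGroup E] [InnerProductSpace ℝ E]

lemma NetworkMatrix.amean_gossip (hW : NetworkMatrix W ρ) (v : Fin n → E) :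
    amean (fun i => ∑ j, W i j • v j) = amean v := by
  unfold amean
  rw [Finset.sum_comm]
  simp_rw [← Finset.sum_smul, sum_col_of_mem_doublyStochastic hW.doublyStochastic, one_smul]

/-- As the rows of `W` sum to one, the average can be subtracted inside the sum; the scalar
contraction then applies to each coordinate in an orthonormal basis of `E`. -/
lemma NetworkMatrix.dev_gossip_le [FiniteDimensional ℝ E] (hW : NetworkMatrix W ρ) (hn : 0 < n)
    (v : Fin n → E) : dev (fun i => ∑ j, W i j • v j) ≤ ρ ^ 2 * dev v := by
  have hn' : (n : ℝ) ≠ 0 := by positivity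
  unfold dev
  rw [hW.amean_gossip]
  have h1 : ∀ i, (∑ j, W i j • v j) - amean v = ∑ j, W i j • (v j - amean v) := fun i => by
    simp_rw [smul_sub, Finset.sum_sub_distrib, ← Finset.sum_smul,
      sum_row_of_mem_doublyStochastic hW.doublyStochastic, one_smul]
  have hsum : ∑ i, (v i - amean v) = 0 := by
    simp [Finset.sum_sub_distrib, amean, ← Nat.cast_smul_eq_nsmul ℝ, smul_smul, hn']
  simp_rw [h1]
  set b := stdOrthonormalBasis ℝ E
  rw [← amean_mul]
  refine mul_le_mul_of_nonneg_left ?_ (by positivity)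
  rw [← Finset.mul_sum]
  simp_rw [← b.sum_sq_norm_inner_right, Real.norm_eq_abs, sq_abs]
  rw [Finset.sum_comm, Finset.sum_comm (s := Finset.univ (α := Fin n)), Finset.mul_sum]
  refine Finset.sum_le_sum fun k _ => ?_
  have h2 := hW.sum_mulVec_sq_le hn (fun i => inner ℝ (b k) (v i - amean v)) (by
    rw [← inner_sum, hsum, inner_zero_right])
  simpa [inner_sum, real_inner_smul_right] using h2

end Gossip

/-! ### Smooth functions -/

section Smooth

variable {n dx dy : ℕ}

lemma IsSmooth.hasGradientAt {h : Joint dx dy → ℝ} {L : ℝ} (hs : IsSmooth h L) (z) :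
    HasGradientAt h (gradient h z) z :=
  (hs.contDiff.differentiable (by norm_num)).differentiableAt.hasGradientAt

/-- The mean value inequality on the segment, applied to `h` minus its linearization. It gives the
constant `L` instead of `L / 2`, which is harmless here. -/
lemma IsSmooth.abs_sub_sub_inner_le {h : Joint dx dy → ℝ} {L : ℝ} (hL : 0 ≤ L) (hs : IsSmooth h L)
    (z z' : Joint dx dy) : |h z' - h z - inner ℝ (gradient h z) (z' - z)| ≤ L * ‖z' - z‖ ^ 2 := by
  have hd : Differentiable ℝ h := hs.contDiff.differentiable (by norm_num)
  have h1 := Convex.norm_image_sub_le_of_norm_fderiv_le' (𝕜 := ℝ) (f := h) (C := L * ‖z' - z‖)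
    (s := segment ℝ z z') (x := z) (y := z') (φ := fderiv ℝ h z) (fun x _ => hd x) (fun x hx => ?_)
    (convex_segment z z') (left_mem_segment ℝ z z') (right_mem_segment ℝ z z')
  · rw [← (hs.hasGradientAt z).fderiv_apply]
    simpa [pow_two, mul_assoc] using h1
  · rw [← toDual_gradient, ← toDual_gradient, ← map_sub, LinearIsometryEquiv.norm_map]
    refine (hs.lipschitz x z).trans (mul_le_mul_of_nonneg_left ?_ hL)
    rw [segment_eq_image'] at hx
    obtain ⟨t, ht, rfl⟩ := hx
    simp only [add_sub_cancel_left, norm_smul, Real.norm_eq_abs, abs_of_nonneg ht.1]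
    nlinarith [norm_nonneg (z' - z), ht.2]

lemma IsSmooth.continuous_gradient {h : Joint dx dy → ℝ} {L : ℝ} (hs : IsSmooth h L) :
    Continuous (gradient h) :=
  (LipschitzWith.of_dist_le_mul (K := L.toNNReal) fun z z' => by
    rw [dist_eq_norm, dist_eq_norm]
    refine (hs.lipschitz z z').trans (mul_le_mul_of_nonneg_right ?_ (norm_nonneg _))
    exact Real.le_coe_toNNReal L).continuous

lemma hasGradientAt_amean {h : Fin n → Joint dx dy → ℝ} {g : Fin n → Joint dx dy}
    {z : Joint dx dy} (hg : ∀ i, HasGradientAt (h i) (g i) z) :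
    HasGradientAt (fun z => (n : ℝ)⁻¹ * ∑ i, h i z) (amean g) z := by
  rw [hasGradientAt_iff_hasFDerivAt]
  have h1 := (HasFDerivAt.fun_sum (u := Finset.univ)
    fun i _ => (hg i).hasFDerivAt).const_mul (n : ℝ)⁻¹
  simpa [amean] using h1

lemma isSmooth_amean (hn : 0 < n) {h : Fin n → Joint dx dy → ℝ} {L : ℝ}
    (hs : ∀ i, IsSmooth (h i) L) : IsSmooth (fun z => (n : ℝ)⁻¹ * ∑ i, h i z) L := by
  refine ⟨contDiff_const.mul (ContDiff.sum fun i _ => (hs i).contDiff), fun z z' => ?_⟩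
  rw [(hasGradientAt_amean fun i => (hs i).hasGradientAt z).gradient,
    (hasGradientAt_amean fun i => (hs i).hasGradientAt z').gradient, ← amean_sub]
  have hn' : (0 : ℝ) < n := by positivity
  unfold amean
  rw [norm_smul, norm_inv, Real.norm_natCast, inv_mul_le_iff₀ hn']
  refine (norm_sum_le _ _).trans ((Finset.sum_le_sum fun i _ => (hs i).lipschitz z z').trans ?_)
  simp

end Smooth

/-! ### Pairs -/

section Pairs

variable {dx dy : ℕ}

@[simp] lemma pair_fst (x : Vec dx) (y : Vec dy) : (pair x y).fst = x := rfl

@[simp] lemma pair_snd (x : Vec dx) (y : Vec dy) : (pair x y).snd = y := rfl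

lemma pair_sub (x x' : Vec dx) (y y' : Vec dy) :
    pair x y - pair x' y' = pair (x - x') (y - y') := rfl

lemma pair_add (x x' : Vec dx) (y y' : Vec dy) :
    pair x y + pair x' y' = pair (x + x') (y + y') := rfl

lemma pair_eta (z : Joint dx dy) : pair z.fst z.snd = z := rfl

lemma norm_pair_sq (x : Vec dx) (y : Vec dy) : ‖pair x y‖ ^ 2 = ‖x‖ ^ 2 + ‖y‖ ^ 2 :=
  WithLp.prod_norm_sq_eq_of_L2 _

lemma norm_sq_eq_fst_snd (z : Joint dx dy) : ‖z‖ ^ 2 = ‖z.fst‖ ^ 2 + ‖z.snd‖ ^ 2 :=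
  WithLp.prod_norm_sq_eq_of_L2 _

lemma inner_eq_fst_snd (z z' : Joint dx dy) :
    inner ℝ z z' = inner ℝ z.fst z'.fst + inner ℝ z.snd z'.snd :=
  WithLp.prod_inner_apply _ _

lemma norm_fst_le (z : Joint dx dy) : ‖z.fst‖ ≤ ‖z‖ := WithLp.norm_fst_le _ z

lemma norm_snd_le (z : Joint dx dy) : ‖z.snd‖ ≤ ‖z‖ := by
  refine le_of_sq_le_sq ?_ (norm_nonneg _)
  rw [norm_sq_eq_fst_snd z]; nlinarith [sq_nonneg ‖z.fst‖]

lemma norm_pair_zero_left (y : Vec dy) : ‖pair (0 : Vec dx) y‖ = ‖y‖ := by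
  refine (sq_eq_sq₀ (norm_nonneg _) (norm_nonneg _)).1 ?_
  rw [norm_pair_sq]; simp

lemma norm_pair_zero_right (x : Vec dx) : ‖pair x (0 : Vec dy)‖ = ‖x‖ := by
  refine (sq_eq_sq₀ (norm_nonneg _) (norm_nonneg _)).1 ?_
  rw [norm_pair_sq]; simp

lemma continuous_pair : Continuous fun p : Vec dx × Vec dy => pair p.1 p.2 :=
  WithLp.prod_continuous_toLp 2 _ _

lemma continuous_fst_joint : Continuous fun z : Joint dx dy => z.fst :=
  (WithLp.fstL 2 ℝ (Vec dx) (Vec dy)).continuous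

lemma continuous_snd_joint : Continuous fun z : Joint dx dy => z.snd :=
  (WithLp.sndL 2 ℝ (Vec dx) (Vec dy)).continuous

end Pairs

/-- A two-sided quadratic bound makes the remainder `o(‖z' - z‖)`. The differentiability of `Ψ_μ`
comes from here, without differentiating `θ*_γ`. -/
lemma hasGradientAt_of_abs_le_sq {E : Type*} [NormedAddCommGroup E] [InnerProductSpace ℝ E]
    [CompleteSpace E] {h : E → ℝ} {p z : E} {C : ℝ}
    (hb : ∀ z', |h z' - h z - inner ℝ p (z' - z)| ≤ C * ‖z' - z‖ ^ 2) : HasGradientAt h p z := by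
  rw [hasGradientAt_iff_isLittleO]
  have h1 : (fun z' => h z' - h z - inner ℝ p (z' - z)) =O[nhds z] fun z' => ‖z' - z‖ ^ 2 :=
    Asymptotics.IsBigO.of_bound C (Filter.Eventually.of_forall fun z' => by
      simpa using hb z')
  refine h1.trans_isLittleO ?_
  have h2 := Asymptotics.isLittleO_norm_pow_id (E' := E) (one_lt_two)
  have h3 : Filter.Tendsto (fun z' => z' - z) (nhds z) (nhds 0) := by
    have h : Continuous fun z' : E => z' - z := by fun_prop
    simpa using h.tendsto z
  exact h2.comp_tendsto h3

/-! ### Elementary consequences of the conditions on the parameters -/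

namespace Params

variable {c : Params}

/-- The norm bound `√(L₂² + γ⁻²)` of the partial derivatives of the proximal gradient. -/
def slope (c : Params) : ℝ := √(c.L₂ ^ 2 + 1 / c.γ ^ 2)

/-- The Lipschitz constant `√(L₂² + γ⁻²) / η` of `θ*_γ`. -/
def lip (c : Params) : ℝ := c.slope / c.eta

lemma Admissible.inv_γ_pos (hc : c.Admissible) : 0 < 1 / c.γ := one_div_pos.2 hc.γ_pos

lemma Admissible.two_L₂_lt (hc : c.Admissible) : 2 * c.L₂ < 1 / c.γ := by
  have := hc.L₂_pos
  rw [lt_one_div (by positivity) hc.γ_pos]; exact hc.γ_lt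

lemma Admissible.eta_pos (hc : c.Admissible) : 0 < c.eta := by
  have := hc.two_L₂_lt; have := hc.L₂_pos; unfold eta; linarith

lemma Admissible.inv_γ_lt (hc : c.Admissible) : 1 / c.γ < 2 * c.eta := by
  have := hc.two_L₂_lt; unfold eta; linarith

lemma Admissible.eta_lt (hc : c.Admissible) : c.eta < 1 / c.γ := by
  have := hc.L₂_pos; unfold eta; linarith

lemma slope_sq (c : Params) : c.slope ^ 2 = c.L₂ ^ 2 + (1 / c.γ) ^ 2 := by
  unfold slope; rw [Real.sq_sqrt (by positivity), one_div_pow]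

lemma Admissible.slope_pos (hc : c.Admissible) : 0 < c.slope := by
  have := hc.L₂_pos; unfold slope; positivity

lemma Admissible.inv_γ_le_slope (hc : c.Admissible) : 1 / c.γ ≤ c.slope := by
  refine le_of_sq_le_sq ?_ hc.slope_pos.le
  rw [slope_sq]; nlinarith [sq_nonneg c.L₂]

lemma Admissible.lip_mul_eta (hc : c.Admissible) : c.lip * c.eta = c.slope :=
  div_mul_cancel₀ _ hc.eta_pos.ne'

lemma Admissible.one_le_lip (hc : c.Admissible) : 1 ≤ c.lip :=
  (one_le_div hc.eta_pos).2 (hc.eta_lt.le.trans hc.inv_γ_le_slope)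

end Params

/-! ### The proximal map and the Moreau envelope -/

section Prox

variable {n dx dy : ℕ} {Ξf : Type u} {Ξg : Type v} [MeasurableSpace Ξf] [MeasurableSpace Ξg]
  {P : Problem n dx dy Ξf Ξg} {c : Params}

lemma IsSmooth.norm_gradY_sub_le {h : Joint dx dy → ℝ} {L : ℝ} (hs : IsSmooth h L) (x x' : Vec dx)
    (y y' : Vec dy) : ‖gradY h x y - gradY h x' y'‖ ≤ L * ‖pair (x - x') (y - y')‖ :=
  (norm_snd_le (gradient h (pair x y) - gradient h (pair x' y'))).trans (hs.lipschitz _ _)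

lemma IsSmooth.norm_gradX_sub_le {h : Joint dx dy → ℝ} {L : ℝ} (hs : IsSmooth h L) (x x' : Vec dx)
    (y y' : Vec dy) : ‖gradX h x y - gradX h x' y'‖ ≤ L * ‖pair (x - x') (y - y')‖ :=
  (norm_fst_le (gradient h (pair x y) - gradient h (pair x' y'))).trans (hs.lipschitz _ _)

/-- The stationarity equation of the proximal objective is the fixed-point equation of a map with
Lipschitz constant `γ L₂ < 1`. -/
lemma exists_prox_fixedPoint (hc : c.Admissible) (hG : IsSmooth P.G c.L₂) (x : Vec dx)
    (y : Vec dy) : ∃ θ, θ = y - c.γ • gradY P.G x θ := by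
  have hL := hc.L₂_pos
  have hγ := hc.γ_pos
  have h1 : c.γ * c.L₂ < 1 := by
    have := hc.two_L₂_lt
    rw [lt_div_iff₀ hγ] at this; nlinarith
  have hT : ContractingWith (c.γ * c.L₂).toNNReal fun θ : Vec dy => y - c.γ • gradY P.G x θ := by
    refine ⟨by simpa using h1, LipschitzWith.of_dist_le_mul fun θ θ' => ?_⟩
    rw [dist_eq_norm, dist_eq_norm, sub_sub_sub_cancel_left, ← smul_sub, norm_smul, Real.norm_eq_abs,
      abs_of_pos hγ, Real.coe_toNNReal _ (by positivity), mul_assoc]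
    refine mul_le_mul_of_nonneg_left ((hG.norm_gradY_sub_le x x θ' θ).trans ?_) hγ.le
    rw [sub_self, norm_pair_zero_left, norm_sub_rev]
  exact ⟨_, hT.fixedPoint_isFixedPt.symm⟩

/-- Quadratic growth around a stationary point: the linear parts of `G` and of the quadratic cancel
by `hθ`, and `G` loses at most `L₂ ‖θ' - θ‖²`. The bound on `γ` is what makes the modulus positive;
convexity of `G` plays no role. -/
lemma proxObj_add_le (hc : c.Admissible) (hG : IsSmooth P.G c.L₂) (z : Joint dx dy) {θ : Vec dy}
    (hθ : θ = z.snd - c.γ • gradY P.G z.fst θ) (θ' : Vec dy) :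
    P.proxObj c.γ z θ + (1 / (2 * c.γ) - c.L₂) * ‖θ' - θ‖ ^ 2 ≤ P.proxObj c.γ z θ' := by
  have hγ := hc.γ_pos
  have h1 := (abs_le.1 (hG.abs_sub_sub_inner_le hc.L₂_pos.le (pair z.fst θ) (pair z.fst θ'))).1
  rw [pair_sub, sub_self, norm_pair_zero_left, inner_eq_fst_snd] at h1
  simp only [pair_fst, pair_snd, inner_zero_right, zero_add] at h1
  have h2 : ‖θ' - z.snd‖ ^ 2 = ‖θ - z.snd‖ ^ 2 + 2 * inner ℝ (θ - z.snd) (θ' - θ) + ‖θ' - θ‖ ^ 2 := by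
    rw [← norm_add_sq_real]; congr 2; abel
  have h3 : θ - z.snd = -(c.γ • gradY P.G z.fst θ) := by
    nth_rewrite 1 [hθ]; abel
  have h4 : inner ℝ (θ - z.snd) (θ' - θ) = -(c.γ * inner ℝ (gradY P.G z.fst θ) (θ' - θ)) := by
    rw [h3, inner_neg_left, real_inner_smul_left]
  have h5 : 1 / (2 * c.γ) * (2 * (c.γ * inner ℝ (gradY P.G z.fst θ) (θ' - θ)))
      = inner ℝ (gradY P.G z.fst θ) (θ' - θ) := by
    field_simp
  unfold Problem.proxObj
  rw [h2, h4]
  unfold gradY at h5 ⊢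
  linarith

lemma prox_modulus_pos (hc : c.Admissible) : 0 < 1 / (2 * c.γ) - c.L₂ := by
  have h1 := hc.two_L₂_lt
  have h2 : 1 / (2 * c.γ) = 1 / c.γ / 2 := by ring
  rw [h2]; linarith

lemma isMinOn_prox (hc : c.Admissible) (hG : IsSmooth P.G c.L₂) (z : Joint dx dy) :
    IsMinOn (P.proxObj c.γ z) Set.univ (P.prox c.γ z) := by
  obtain ⟨θ, hθ⟩ := exists_prox_fixedPoint hc hG z.fst z.snd
  refine Classical.epsilon_spec (p := fun θ => IsMinOn (P.proxObj c.γ z) Set.univ θ)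
    ⟨θ, fun θ' _ => ?_⟩
  have h1 := proxObj_add_le hc hG z hθ θ'
  have := mul_nonneg (prox_modulus_pos hc).le (sq_nonneg ‖θ' - θ‖)
  exact (by linarith : P.proxObj c.γ z θ ≤ P.proxObj c.γ z θ')

/-- Quadratic growth makes the minimizer unique, so the chosen minimizer is the fixed point. -/
lemma prox_eq (hc : c.Admissible) (hG : IsSmooth P.G c.L₂) (z : Joint dx dy) :
    P.prox c.γ z = z.snd - c.γ • gradY P.G z.fst (P.prox c.γ z) := by
  obtain ⟨θ, hθ⟩ := exists_prox_fixedPoint hc hG z.fst z.snd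
  have h1 := proxObj_add_le hc hG z hθ (P.prox c.γ z)
  have h2 : P.proxObj c.γ z (P.prox c.γ z) ≤ P.proxObj c.γ z θ :=
    isMinOn_prox hc hG z (Set.mem_univ θ)
  have h3 := prox_modulus_pos hc
  have h4 : ‖P.prox c.γ z - θ‖ ^ 2 = 0 := by
    nlinarith [sq_nonneg ‖P.prox c.γ z - θ‖]
  rw [sq_eq_zero_iff, norm_eq_zero, sub_eq_zero] at h4
  rw [h4]; exact hθ

lemma gradY_prox (hc : c.Admissible) (hG : IsSmooth P.G c.L₂) (z : Joint dx dy) :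
    gradY P.G z.fst (P.prox c.γ z) = (1 / c.γ) • (z.snd - P.prox c.γ z) := by
  have h := prox_eq hc hG z
  have h1 : z.snd - P.prox c.γ z = c.γ • gradY P.G z.fst (P.prox c.γ z) := by
    nth_rewrite 1 [h]; abel
  rw [h1, smul_smul, one_div_mul_cancel hc.γ_pos.ne', one_smul]

lemma V_eq (hc : c.Admissible) (hG : IsSmooth P.G c.L₂) (z : Joint dx dy) :
    P.V c.γ z = P.proxObj c.γ z (P.prox c.γ z) := by
  have h := isMinOn_prox hc hG z
  have hb : ∀ θ, P.proxObj c.γ z (P.prox c.γ z) ≤ P.proxObj c.γ z θ := fun θ => h (Set.mem_univ θ)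
  exact le_antisymm (ciInf_le ⟨_, by rintro _ ⟨θ, rfl⟩; exact hb θ⟩ _) (le_ciInf hb)

lemma V_le (hc : c.Admissible) (hG : IsSmooth P.G c.L₂) (z : Joint dx dy) (θ : Vec dy) :
    P.V c.γ z ≤ P.proxObj c.γ z θ := by
  rw [V_eq hc hG]; exact isMinOn_prox hc hG z (Set.mem_univ θ)

lemma V_le_G (hc : c.Admissible) (hG : IsSmooth P.G c.L₂) (z : Joint dx dy) :
    P.V c.γ z ≤ P.G z := by
  have h := V_le hc hG z z.snd
  simpa [Problem.proxObj, pair_eta] using h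

/-- The norm of a linear combination of the components. -/
lemma Params.mul_add_mul_le_slope (c : Params) (z : Joint dx dy) :
    c.L₂ * ‖z.fst‖ + 1 / c.γ * ‖z.snd‖ ≤ c.slope * ‖z‖ := by
  have h0 : 0 ≤ c.slope := Real.sqrt_nonneg _
  refine le_of_sq_le_sq ?_ (by positivity)
  rw [mul_pow, c.slope_sq, norm_sq_eq_fst_snd]
  nlinarith [sq_nonneg (c.L₂ * ‖z.snd‖ - 1 / c.γ * ‖z.fst‖)]

/-- Subtracting the two stationarity equations leaves `L₂ ‖θ - θ'‖` on the right. Absorbing it turns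
the factor `1 / γ` on the left into `η`, and Cauchy-Schwarz collects the `x` and `y` displacements
into `slope`. -/
lemma norm_prox_sub_le (hc : c.Admissible) (hG : IsSmooth P.G c.L₂) (z z' : Joint dx dy) :
    ‖P.prox c.γ z - P.prox c.γ z'‖ ≤ c.lip * ‖z - z'‖ := by
  have hη := hc.eta_pos
  have hg := hc.inv_γ_pos
  set θ := P.prox c.γ z with hθ
  set θ' := P.prox c.γ z' with hθ'
  have e : (1 / c.γ) • (θ - θ') = (1 / c.γ) • (z.snd - z'.snd)
      - (gradY P.G z.fst θ - gradY P.G z'.fst θ') := by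
    rw [gradY_prox hc hG z, gradY_prox hc hG z', ← smul_sub, ← smul_sub]
    congr 1; abel
  have h1 : ‖gradY P.G z.fst θ - gradY P.G z'.fst θ'‖
      ≤ c.L₂ * (‖z.fst - z'.fst‖ + ‖θ - θ'‖) := by
    refine (hG.norm_gradY_sub_le _ _ _ _).trans (mul_le_mul_of_nonneg_left ?_ hc.L₂_pos.le)
    refine le_of_sq_le_sq ?_ (by positivity)
    rw [norm_pair_sq]
    nlinarith [mul_nonneg (norm_nonneg (z.fst - z'.fst)) (norm_nonneg (θ - θ'))]
  have h2 : 1 / c.γ * ‖θ - θ'‖ ≤ 1 / c.γ * ‖z.snd - z'.snd‖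
      + c.L₂ * (‖z.fst - z'.fst‖ + ‖θ - θ'‖) := by
    have := norm_sub_le ((1 / c.γ) • (z.snd - z'.snd)) (gradY P.G z.fst θ - gradY P.G z'.fst θ')
    rw [← e, norm_smul, norm_smul, Real.norm_eq_abs, abs_of_pos hg] at this
    linarith
  have h3 := c.mul_add_mul_le_slope (z - z')
  rw [WithLp.sub_fst, WithLp.sub_snd] at h3
  rw [Params.lip, div_mul_eq_mul_div, le_div_iff₀ hη]
  unfold Params.eta
  linarith

lemma continuous_prox (hc : c.Admissible) (hG : IsSmooth P.G c.L₂) : Continuous (P.prox c.γ) :=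
  (LipschitzWith.of_dist_le_mul (K := c.lip.toNNReal) fun z z' => by
    rw [dist_eq_norm, dist_eq_norm]
    exact (norm_prox_sub_le hc hG z z').trans
      (mul_le_mul_of_nonneg_right (Real.le_coe_toNNReal _) (norm_nonneg _))).continuous

/-- The gradient of the Moreau envelope. -/
def gradV (P : Problem n dx dy Ξf Ξg) (γ : ℝ) (z : Joint dx dy) : Joint dx dy :=
  pair (gradX P.G z.fst (P.prox γ z)) ((1 / γ) • (z.snd - P.prox γ z))

lemma envelope_lower_arith {L g ℓ X Y D : ℝ} (hL : 0 < L) (hLg : 2 * L < g) (hℓ : 1 ≤ ℓ)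
    (hX : 0 ≤ X) (hXD : X ≤ D) (hYD : Y ≤ D) :
    L * (ℓ * D) * X + g * (ℓ * D) * Y + L * X ^ 2 ≤ 2 * ℓ * g * D ^ 2 := by
  have hD : 0 ≤ D := hX.trans hXD
  have hg : 0 < g := by linarith
  have hLg' : L ≤ g / 2 := by linarith
  have h1 : L * (ℓ * D) * X ≤ g / 2 * (ℓ * D) * D := by gcongr
  have h2 : g * (ℓ * D) * Y ≤ g * (ℓ * D) * D := by gcongr
  have h3 : L * X ^ 2 ≤ g / 2 * D ^ 2 := by gcongr
  have h4 : g / 2 * D ^ 2 ≤ ℓ * (g / 2 * D ^ 2) :=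
    le_mul_of_one_le_left (mul_nonneg (by linarith) (sq_nonneg _)) hℓ
  linarith

lemma envelope_upper_arith {L g ℓ X Y D : ℝ} (hL : 0 < L) (hLg : 2 * L < g) (hℓ : 1 ≤ ℓ)
    (hd : D ^ 2 = X ^ 2 + Y ^ 2) : L * X ^ 2 + g * Y ^ 2 / 2 ≤ 2 * ℓ * g * D ^ 2 := by
  have hg : 0 < g := by linarith
  have h1 : L * X ^ 2 ≤ g * X ^ 2 := by gcongr; linarith
  have h2 : g * D ^ 2 ≤ ℓ * (g * D ^ 2) := le_mul_of_one_le_left (by positivity) hℓ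
  have h3 : 0 ≤ g * Y ^ 2 := by positivity
  have h4 : 0 ≤ g * X ^ 2 := by positivity
  rw [hd] at h2 ⊢
  linarith

/-- Envelope argument: the minimizer at one point is a competitor at the other. With the minimizer
at `z` one gets the upper bound directly. With the minimizer at `z'` one gets the lower bound, up to
replacing it by the minimizer at `z` in the gradient, which costs a quadratic term because the
proximal map is Lipschitz. -/
lemma abs_V_sub_le (hc : c.Admissible) (hG : IsSmooth P.G c.L₂) (z z' : Joint dx dy) :
    |P.V c.γ z' - P.V c.γ z - inner ℝ (gradV P c.γ z) (z' - z)|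
      ≤ 2 * c.lip * (1 / c.γ) * ‖z' - z‖ ^ 2 := by
  have hg := hc.inv_γ_pos
  have hL := hc.L₂_pos
  have hℓ := hc.one_le_lip
  have hLg := hc.two_L₂_lt
  have hmv : ∀ θ : Vec dy, |P.G (pair z'.fst θ) - P.G (pair z.fst θ)
      - inner ℝ (gradX P.G z.fst θ) (z'.fst - z.fst)| ≤ c.L₂ * ‖z'.fst - z.fst‖ ^ 2 := by
    intro θ
    have h := hG.abs_sub_sub_inner_le hL.le (pair z.fst θ) (pair z'.fst θ)
    rw [pair_sub, sub_self, norm_pair_zero_right, inner_eq_fst_snd] at h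
    simpa [gradX] using h
  have hsq : ∀ θ : Vec dy, 1 / (2 * c.γ) * ‖θ - z'.snd‖ ^ 2 - 1 / (2 * c.γ) * ‖θ - z.snd‖ ^ 2
      = inner ℝ ((1 / c.γ) • (z.snd - θ)) (z'.snd - z.snd)
        + 1 / c.γ * ‖z'.snd - z.snd‖ ^ 2 / 2 := by
    intro θ
    have : ‖θ - z'.snd‖ ^ 2 = ‖θ - z.snd‖ ^ 2 + 2 * inner ℝ (z.snd - θ) (z'.snd - z.snd)
        + ‖z'.snd - z.snd‖ ^ 2 := by
      rw [norm_sub_rev θ z.snd, norm_sub_rev θ z'.snd, ← norm_add_sq_real]; congr 2; abel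
    have h2 : 1 / (2 * c.γ) = 1 / c.γ / 2 := by ring
    rw [this, real_inner_smul_left, h2]; ring
  have hin : inner ℝ (gradV P c.γ z) (z' - z)
      = inner ℝ (gradX P.G z.fst (P.prox c.γ z)) (z'.fst - z.fst)
        + inner ℝ ((1 / c.γ) • (z.snd - P.prox c.γ z)) (z'.snd - z.snd) :=
    inner_eq_fst_snd _ _
  have hd := norm_sq_eq_fst_snd (z' - z)
  rw [WithLp.sub_fst, WithLp.sub_snd] at hd
  set X := ‖z'.fst - z.fst‖ with hX
  set Y := ‖z'.snd - z.snd‖ with hY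
  set D := ‖z' - z‖ with hD
  have hXD : X ≤ D := norm_fst_le (z' - z)
  have hYD : Y ≤ D := norm_snd_le (z' - z)
  have hX0 : 0 ≤ X := norm_nonneg _
  have hY0 : 0 ≤ Y := norm_nonneg _
  rw [abs_le]
  constructor
  · have h1 := V_le hc hG z (P.prox c.γ z')
    rw [V_eq hc hG z', hin]
    have h2 := (abs_le.1 (hmv (P.prox c.γ z'))).1
    have h3 := hsq (P.prox c.γ z')
    have hp := norm_prox_sub_le hc hG z' z
    set θ := P.prox c.γ z
    set θ' := P.prox c.γ z'
    unfold Problem.proxObj at h1 ⊢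
    have h4 : inner ℝ (gradX P.G z.fst θ) (z'.fst - z.fst)
        - inner ℝ (gradX P.G z.fst θ') (z'.fst - z.fst) ≤ c.L₂ * (c.lip * D) * X := by
      rw [← inner_sub_left]
      refine (real_inner_le_norm _ _).trans (mul_le_mul_of_nonneg_right ?_ hX0)
      refine (hG.norm_gradX_sub_le _ _ _ _).trans (mul_le_mul_of_nonneg_left ?_ hL.le)
      rw [sub_self, norm_pair_zero_left, norm_sub_rev]
      exact hp
    have h5 : inner ℝ ((1 / c.γ) • (z.snd - θ)) (z'.snd - z.snd)
        - inner ℝ ((1 / c.γ) • (z.snd - θ')) (z'.snd - z.snd) ≤ 1 / c.γ * (c.lip * D) * Y := by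
      rw [← inner_sub_left, ← smul_sub, sub_sub_sub_cancel_left]
      refine (real_inner_le_norm _ _).trans (mul_le_mul_of_nonneg_right ?_ hY0)
      rw [norm_smul, Real.norm_eq_abs, abs_of_pos hg]
      exact mul_le_mul_of_nonneg_left hp hg.le
    have h6 := envelope_lower_arith hL hLg hℓ hX0 hXD hYD
    have h8 : 0 ≤ 1 / c.γ * Y ^ 2 / 2 := by positivity
    linarith
  · have h1 := V_le hc hG z' (P.prox c.γ z)
    rw [V_eq hc hG z, hin]
    have h2 := (abs_le.1 (hmv (P.prox c.γ z))).2
    have h3 := hsq (P.prox c.γ z)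
    unfold Problem.proxObj at h1 ⊢
    have h4 := envelope_upper_arith hL hLg hℓ hd
    linarith

/-! ### The penalized objective -/

/-- The gradient of the penalized objective. -/
def gradPsi (P : Problem n dx dy Ξf Ξg) (γ μ : ℝ) (z : Joint dx dy) : Joint dx dy :=
  μ • gradient P.F z + gradient P.G z - gradV P γ z

/-- A constant in the quadratic bounds on the penalized objective. -/
def Params.curv (c : Params) (μ : ℝ) : ℝ := μ * c.L₁ + 3 * c.lip * (1 / c.γ)

lemma abs_Psi_sub_le (hc : c.Admissible) (hF : IsSmooth P.F c.L₁) (hG : IsSmooth P.G c.L₂) {μ : ℝ}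
    (hμ : 0 ≤ μ) (z z' : Joint dx dy) :
    |P.Psi c.γ μ z' - P.Psi c.γ μ z - inner ℝ (gradPsi P c.γ μ z) (z' - z)|
      ≤ c.curv μ * ‖z' - z‖ ^ 2 := by
  have h1 := abs_le.1 (hF.abs_sub_sub_inner_le hc.L₁_pos.le z z')
  have h2 := abs_le.1 (hG.abs_sub_sub_inner_le hc.L₂_pos.le z z')
  have h3 := abs_le.1 (abs_V_sub_le hc hG z z')
  -- This puts the contribution of `G` together with the `2 * lip / γ` of the envelope, whence the
  -- `3` in `curv`.
  have h4 : c.L₂ ≤ c.lip * (1 / c.γ) := by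
    have := hc.one_le_lip; have := hc.two_L₂_lt; have := hc.inv_γ_pos; have := hc.L₂_pos
    nlinarith
  have h5 := mul_le_mul_of_nonneg_right h4 (sq_nonneg ‖z' - z‖)
  have e : inner ℝ (gradPsi P c.γ μ z) (z' - z) = μ * inner ℝ (gradient P.F z) (z' - z)
      + inner ℝ (gradient P.G z) (z' - z) - inner ℝ (gradV P c.γ z) (z' - z) := by
    rw [gradPsi, inner_sub_left, inner_add_left, real_inner_smul_left]
  have h6 := mul_le_mul_of_nonneg_left h1.1 hμ
  have h7 := mul_le_mul_of_nonneg_left h1.2 hμ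
  rw [e, abs_le]
  unfold Problem.Psi Params.curv
  constructor <;> nlinarith

lemma hasGradientAt_Psi (hc : c.Admissible) (hF : IsSmooth P.F c.L₁) (hG : IsSmooth P.G c.L₂)
    {μ : ℝ} (hμ : 0 ≤ μ) (z : Joint dx dy) :
    HasGradientAt (P.Psi c.γ μ) (gradPsi P c.γ μ z) z :=
  hasGradientAt_of_abs_le_sq fun z' => abs_Psi_sub_le hc hF hG hμ z z'

lemma continuous_gradPsi (hc : c.Admissible) (hF : IsSmooth P.F c.L₁) (hG : IsSmooth P.G c.L₂)
    (μ : ℝ) : Continuous (gradPsi P c.γ μ) := by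
  have h1 := hF.continuous_gradient
  have h2 := hG.continuous_gradient
  have h3 := continuous_prox hc hG
  have hx := continuous_fst_joint (dx := dx) (dy := dy)
  have hy := continuous_snd_joint (dx := dx) (dy := dy)
  have h4 : Continuous (gradV P c.γ) :=
    continuous_pair.comp (Continuous.prodMk (hx.comp (h2.comp (continuous_pair.comp (hx.prodMk h3))))
      ((hy.sub h3).const_smul (1 / c.γ)))
  exact ((h1.const_smul μ).add h2).sub h4

lemma Phi_eq (P : Problem n dx dy Ξf Ξg) (γ Flow μ : ℝ) (z : Joint dx dy) :
    P.Phi γ Flow μ z = P.Psi γ μ z - μ * Flow := by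
  unfold Problem.Phi Problem.Psi; ring

lemma Phi_le (hc : c.Admissible) (hF : IsSmooth P.F c.L₁) (hG : IsSmooth P.G c.L₂) {μ Flow : ℝ}
    (hμ : 0 ≤ μ) (z z' : Joint dx dy) :
    P.Phi c.γ Flow μ z' ≤ P.Phi c.γ Flow μ z + inner ℝ (gradPsi P c.γ μ z) (z' - z)
      + c.curv μ * ‖z' - z‖ ^ 2 := by
  have := (abs_le.1 (abs_Psi_sub_le hc hF hG hμ z z')).2
  rw [Phi_eq, Phi_eq]; linarith

lemma Phi_nonneg (hc : c.Admissible) (hG : IsSmooth P.G c.L₂) {μ Flow : ℝ} (hμ : 0 ≤ μ)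
    (hFlow : ∀ z, Flow ≤ P.F z) (z : Joint dx dy) : 0 ≤ P.Phi c.γ Flow μ z := by
  have h1 := V_le_G hc hG z
  have h2 := mul_nonneg hμ (sub_nonneg.2 (hFlow z))
  unfold Problem.Phi; linarith

/-- The shift by the lower bound of `F` serves this: passing to a smaller penalty parameter can only
lower the function. -/
lemma Phi_antitone {μ μ' γ Flow : ℝ} (h : μ' ≤ μ) (hFlow : ∀ z, Flow ≤ P.F z) (z : Joint dx dy) :
    P.Phi γ Flow μ' z ≤ P.Phi γ Flow μ z := by
  have := mul_le_mul_of_nonneg_right h (sub_nonneg.2 (hFlow z))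
  unfold Problem.Phi; linarith

lemma Params.Admissible.curv_pos (hc : c.Admissible) {μ : ℝ} (hμ : 0 ≤ μ) : 0 < c.curv μ := by
  have h1 := hc.one_le_lip; have h2 := hc.inv_γ_pos; have h3 := hc.L₁_pos
  unfold Params.curv; positivity

/-- A gradient step of length `1 / (2 curv)` decreases `Φ_μ` by `‖∇Ψ_μ‖² / (4 curv)`, and the value
reached is still nonnegative. -/
lemma norm_gradPsi_sq_le (hc : c.Admissible) (hF : IsSmooth P.F c.L₁) (hG : IsSmooth P.G c.L₂)
    {μ Flow : ℝ} (hμ : 0 ≤ μ) (hFlow : ∀ z, Flow ≤ P.F z) (z : Joint dx dy) :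
    ‖gradPsi P c.γ μ z‖ ^ 2 ≤ 4 * c.curv μ * P.Phi c.γ Flow μ z := by
  have hQ := hc.curv_pos hμ
  set p := gradPsi P c.γ μ z
  have h := Phi_le hc hF hG (Flow := Flow) hμ z (z - (2 * c.curv μ)⁻¹ • p)
  have h0 := Phi_nonneg hc hG hμ hFlow (z - (2 * c.curv μ)⁻¹ • p)
  rw [sub_sub_cancel_left, inner_neg_right, norm_neg, norm_smul, real_inner_smul_right,
    real_inner_self_eq_norm_sq, mul_pow, norm_inv, inv_pow, Real.norm_eq_abs, sq_abs] at h
  have e : c.curv μ * (((2 * c.curv μ) ^ 2)⁻¹ * ‖p‖ ^ 2) = ‖p‖ ^ 2 / (4 * c.curv μ) := by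
    field_simp; ring
  have e' : (2 * c.curv μ)⁻¹ * ‖p‖ ^ 2 = 2 * (‖p‖ ^ 2 / (4 * c.curv μ)) := by
    field_simp; ring
  rw [e, e'] at h
  have h1 : ‖p‖ ^ 2 / (4 * c.curv μ) ≤ P.Phi c.γ Flow μ z := by linarith
  rw [div_le_iff₀ (by positivity)] at h1
  linarith

lemma continuous_Psi (hc : c.Admissible) (hF : IsSmooth P.F c.L₁) (hG : IsSmooth P.G c.L₂)
    {μ : ℝ} (hμ : 0 ≤ μ) : Continuous (P.Psi c.γ μ) :=
  continuous_iff_continuousAt.2 fun z => (hasGradientAt_Psi hc hF hG hμ z).continuousAt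

end Prox

/-! ### Mean directions and noise -/

section Directions

variable {n dx dy : ℕ} {Ξf : Type u} {Ξg : Type v} [MeasurableSpace Ξf] [MeasurableSpace Ξg]

/-- The local variables `(x_i, y_i)`. -/
def State.z (s : State n dx dy) (i : Fin n) : Joint dx dy := pair (s.x i) (s.y i)

/-- The local variables `(x_i, θ_i)`. -/
def State.w (s : State n dx dy) (i : Fin n) : Joint dx dy := pair (s.x i) (s.θ i)

/-- The mean direction for `θ_i`. -/
def mdTheta (P : Problem n dx dy Ξf Ξg) (γ : ℝ) (s : State n dx dy) (i : Fin n) : Vec dy :=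
  gradY (P.g i) (s.x i) (s.θ i) + (1 / γ) • (s.θ i - s.y i)

/-- The mean direction for `(x_i, y_i)`. -/
def mdZ (P : Problem n dx dy Ξf Ξg) (γ μ : ℝ) (s : State n dx dy) (i : Fin n) : Joint dx dy :=
  μ • gradient (P.f i) (s.z i) + gradient (P.g i) (s.z i)
    - pair (gradX (P.g i) (s.x i) (s.θ i)) ((1 / γ) • (s.y i - s.θ i))

/-- The error of the stochastic gradient of `f_i`. -/
def noiseF (P : Problem n dx dy Ξf Ξg) (i : Fin n) (z : Joint dx dy) (ξ : Ξf) : Joint dx dy :=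
  gradient (P.fSample i ξ) z - gradient (P.f i) z

/-- The error of the stochastic gradient of `g_i`. -/
def noiseG (P : Problem n dx dy Ξf Ξg) (i : Fin n) (z : Joint dx dy) (ξ : Ξg) : Joint dx dy :=
  gradient (P.gSample i ξ) z - gradient (P.g i) z

/-- The error of the stochastic direction for `θ_i`. -/
def noiseTheta (P : Problem n dx dy Ξf Ξg) (s : State n dx dy) (i : Fin n) (ξ : Ξg) : Vec dy :=
  (noiseG P i (s.w i) ξ).snd

/-- The error of the stochastic direction for `(x_i, y_i)`. -/
def noiseZ (P : Problem n dx dy Ξf Ξg) (μ : ℝ) (s : State n dx dy) (i : Fin n) (ξ : Ξf × Ξg) :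
    Joint dx dy :=
  μ • noiseF P i (s.z i) ξ.1 + noiseG P i (s.z i) ξ.2 - pair (noiseG P i (s.w i) ξ.2).fst 0

variable (P : Problem n dx dy Ξf Ξg)

lemma dirTheta_eq (γ : ℝ) (s : State n dx dy) (ξg : Fin n → Ξg) (i : Fin n) :
    dirTheta P γ s ξg i = mdTheta P γ s i + noiseTheta P s i (ξg i) := by
  simp only [dirTheta, mdTheta, noiseTheta, noiseG, gradY, WithLp.sub_snd, State.w]
  abel

lemma pair_dirX_dirY_eq (γ μ : ℝ) (s : State n dx dy) (ξf : Fin n → Ξf) (ξg : Fin n → Ξg)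
    (i : Fin n) : pair (dirX P μ s ξf ξg i) (dirY P γ μ s ξf ξg i)
      = mdZ P γ μ s i + noiseZ P μ s i (ξf i, ξg i) := by
  have h : pair (dirX P μ s ξf ξg i) (dirY P γ μ s ξf ξg i)
      = μ • gradient (P.fSample i (ξf i)) (s.z i) + gradient (P.gSample i (ξg i)) (s.z i)
        - pair (gradX (P.gSample i (ξg i)) (s.x i) (s.θ i)) ((1 / γ) • (s.y i - s.θ i)) := rfl
  have h2 : pair (noiseG P i (s.w i) (ξg i)).fst (0 : Vec dy)
      = pair (gradX (P.gSample i (ξg i)) (s.x i) (s.θ i)) ((1 / γ) • (s.y i - s.θ i))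
        - pair (gradX (P.g i) (s.x i) (s.θ i)) ((1 / γ) • (s.y i - s.θ i)) := by
    rw [pair_sub, sub_self]; rfl
  rw [h, mdZ, noiseZ, h2]
  simp only [noiseF, noiseG, smul_sub]
  abel

lemma State.mean_eq (s : State n dx dy) : s.mean = amean s.z := (amean_pair s.x s.y).symm

lemma State.consensusError_eq (s : State n dx dy) : s.consensusError = dev s.z + dev s.θ := by
  have h := dev_pair s.x s.y
  exact congrArg (· + dev s.θ) h.symm

lemma State.consensusError_nonneg (s : State n dx dy) : 0 ≤ s.consensusError := by
  rw [s.consensusError_eq]; exact add_nonneg (dev_nonneg _) (dev_nonneg _)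

/-! ### The averages under one iteration -/

section Step

variable {W : Matrix (Fin n) (Fin n) ℝ} {ρ : ℝ}

lemma step_theta (γ μ l k : ℝ) (ξf : Fin n → Ξf) (ξg : Fin n → Ξg) (s : State n dx dy) (i : Fin n) :
    (step P W γ μ l k k ξf ξg s).θ i
      = ∑ j, W i j • (s.θ j - l • (mdTheta P γ s j + noiseTheta P s j (ξg j))) := by
  simp only [step, dirTheta_eq]

lemma step_z (γ μ l k : ℝ) (ξf : Fin n → Ξf) (ξg : Fin n → Ξg) (s : State n dx dy) (i : Fin n) :
    (step P W γ μ l k k ξf ξg s).z i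
      = ∑ j, W i j • (s.z j - k • (mdZ P γ μ s j + noiseZ P μ s j (ξf j, ξg j))) := by
  simp only [← pair_dirX_dirY_eq]
  apply WithLp.ofLp_injective
  refine Prod.ext ?_ ?_
  · exact (map_sum (WithLp.fstL 2 ℝ (Vec dx) (Vec dy)) (fun j => W i j • (s.z j
      - k • pair (dirX P μ s ξf ξg j) (dirY P γ μ s ξf ξg j))) Finset.univ).symm
  · exact (map_sum (WithLp.sndL 2 ℝ (Vec dx) (Vec dy)) (fun j => W i j • (s.z j
      - k • pair (dirX P μ s ξf ξg j) (dirY P γ μ s ξf ξg j))) Finset.univ).symm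

/-- The columns of `W` sum to one, so gossip leaves averages unchanged and `W` disappears. -/
lemma avg_step_theta (hW : NetworkMatrix W ρ) (γ μ l k : ℝ) (ξf : Fin n → Ξf) (ξg : Fin n → Ξg)
    (s : State n dx dy) : avg (step P W γ μ l k k ξf ξg s).θ
      = avg s.θ - l • (amean (mdTheta P γ s) + amean fun i => noiseTheta P s i (ξg i)) := by
  have h : (step P W γ μ l k k ξf ξg s).θ = _ := funext (step_theta P γ μ l k ξf ξg s)
  rw [h]
  refine (hW.amean_gossip _).trans ?_
  rw [amean_sub, amean_smul, amean_add]; rfl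

lemma mean_step (hW : NetworkMatrix W ρ) (γ μ l k : ℝ) (ξf : Fin n → Ξf) (ξg : Fin n → Ξg)
    (s : State n dx dy) : (step P W γ μ l k k ξf ξg s).mean
      = s.mean - k • (amean (mdZ P γ μ s) + amean fun i => noiseZ P μ s i (ξf i, ξg i)) := by
  have h : (step P W γ μ l k k ξf ξg s).z = _ := funext (step_z P γ μ l k ξf ξg s)
  rw [State.mean_eq, State.mean_eq, h, hW.amean_gossip, amean_sub, amean_smul, amean_add]

end Step

/-! ### Estimates on the mean directions -/

lemma norm_add_sq_le_two {E : Type*} [SeminormedAddCommGroup E] (a b : E) :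
    ‖a + b‖ ^ 2 ≤ 2 * (‖a‖ ^ 2 + ‖b‖ ^ 2) := by
  have h := pow_le_pow_left₀ (norm_nonneg _) (norm_add_le a b) 2
  nlinarith [sq_nonneg (‖a‖ - ‖b‖)]

lemma norm_sum_sq_le {E : Type*} [SeminormedAddCommGroup E] {m : ℕ} (v : Fin m → E) :
    ‖∑ i, v i‖ ^ 2 ≤ m * ∑ i, ‖v i‖ ^ 2 := by
  have h := pow_le_pow_left₀ (norm_nonneg _) (norm_sum_le Finset.univ v) 2
  refine h.trans (sq_sum_le_card_mul_sum_sq.trans ?_)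
  simp

lemma norm_add_sq_le_three {E : Type*} [SeminormedAddCommGroup E] (a b d : E) :
    ‖a + b + d‖ ^ 2 ≤ 3 * (‖a‖ ^ 2 + ‖b‖ ^ 2 + ‖d‖ ^ 2) := by
  have h := norm_sum_sq_le ![a, b, d]
  simpa [Fin.sum_univ_succ, add_assoc] using h

lemma norm_add_sq_le_seven {E : Type*} [SeminormedAddCommGroup E] (a₁ a₂ a₃ a₄ a₅ a₆ a₇ : E) :
    ‖a₁ + a₂ + a₃ + a₄ + a₅ + a₆ + a₇‖ ^ 2 ≤ 7 * (‖a₁‖ ^ 2 + ‖a₂‖ ^ 2 + ‖a₃‖ ^ 2 + ‖a₄‖ ^ 2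
      + ‖a₅‖ ^ 2 + ‖a₆‖ ^ 2 + ‖a₇‖ ^ 2) := by
  have h := norm_sum_sq_le ![a₁, a₂, a₃, a₄, a₅, a₆, a₇]
  simpa [Fin.sum_univ_succ, add_assoc] using h

variable {P} {W : Matrix (Fin n) (Fin n) ℝ} {c : Params} {ρ δf δg σf σg Flow : ℝ}

lemma Assumptions.gradient_F (hA : Assumptions P W c.L₁ c.L₂ ρ δf δg σf σg Flow)
    (z : Joint dx dy) : gradient P.F z = amean fun i => gradient (P.f i) z :=
  (hasGradientAt_amean fun i => (hA.smooth_f i).hasGradientAt z).gradient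

lemma Assumptions.gradient_G (hA : Assumptions P W c.L₁ c.L₂ ρ δf δg σf σg Flow)
    (z : Joint dx dy) : gradient P.G z = amean fun i => gradient (P.g i) z :=
  (hasGradientAt_amean fun i => (hA.smooth_g i).hasGradientAt z).gradient

lemma Assumptions.smooth_F (hA : Assumptions P W c.L₁ c.L₂ ρ δf δg σf σg Flow) (hn : 0 < n) :
    IsSmooth P.F c.L₁ := isSmooth_amean hn hA.smooth_f

lemma Assumptions.smooth_G (hA : Assumptions P W c.L₁ c.L₂ ρ δf δg σf σg Flow) (hn : 0 < n) :
    IsSmooth P.G c.L₂ := isSmooth_amean hn hA.smooth_g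

lemma IsSmooth.norm_sub_sq_le {h : Joint dx dy → ℝ} {L : ℝ} (hs : IsSmooth h L)
    (z z' : Joint dx dy) : ‖gradient h z - gradient h z'‖ ^ 2 ≤ L ^ 2 * ‖z - z'‖ ^ 2 := by
  rw [← mul_pow]; exact pow_le_pow_left₀ (norm_nonneg _) (hs.lipschitz z z') 2

/-- The square distances `‖z_i - z̄‖² + ‖θ_i - θ̄‖²`. -/
def State.sqDist (s : State n dx dy) (i : Fin n) : ℝ :=
  ‖s.z i - s.mean‖ ^ 2 + ‖s.θ i - avg s.θ‖ ^ 2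

lemma State.amean_sqDist (s : State n dx dy) : amean s.sqDist = s.consensusError := by
  rw [s.consensusError_eq, dev, dev, ← amean_add, ← s.mean_eq]; rfl

lemma State.norm_z_sub_sq_le (s : State n dx dy) (i : Fin n) :
    ‖s.z i - s.mean‖ ^ 2 ≤ s.sqDist i := le_add_of_nonneg_right (sq_nonneg _)

lemma State.norm_w_sub_sq_le (s : State n dx dy) (i : Fin n) :
    ‖s.w i - pair (avg s.x) (avg s.θ)‖ ^ 2 ≤ s.sqDist i := by
  have h1 : ‖s.w i - pair (avg s.x) (avg s.θ)‖ ^ 2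
      = ‖s.x i - avg s.x‖ ^ 2 + ‖s.θ i - avg s.θ‖ ^ 2 := norm_pair_sq _ _
  have h2 : ‖s.z i - s.mean‖ ^ 2 = ‖s.x i - avg s.x‖ ^ 2 + ‖s.y i - avg s.y‖ ^ 2 :=
    norm_pair_sq _ _
  rw [h1, State.sqDist, h2]; nlinarith [sq_nonneg ‖s.y i - avg s.y‖]

lemma State.norm_y_sub_theta_sq_le (s : State n dx dy) (i : Fin n) :
    ‖(s.y i - s.θ i) - (avg s.y - avg s.θ)‖ ^ 2 ≤ 2 * s.sqDist i := by
  have h2 : ‖s.z i - s.mean‖ ^ 2 = ‖s.x i - avg s.x‖ ^ 2 + ‖s.y i - avg s.y‖ ^ 2 :=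
    norm_pair_sq _ _
  have h := norm_add_sq_le_two (s.y i - avg s.y) (-(s.θ i - avg s.θ))
  rw [norm_neg] at h
  have e : (s.y i - s.θ i) - (avg s.y - avg s.θ) = s.y i - avg s.y + -(s.θ i - avg s.θ) := by abel
  rw [e, State.sqDist, h2]
  nlinarith [sq_nonneg ‖s.x i - avg s.x‖]

/-- Two sources of error. The vector `r` compares local gradients at local points with those at the
averages, which costs consensus error. The vector `q` replaces `θ*_γ` by `θ̄` in the gradient of the
envelope, which costs `slope` times the tracking error. -/
lemma norm_gradPsi_sub_amean_mdZ_le (hA : Assumptions P W c.L₁ c.L₂ ρ δf δg σf σg Flow)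
    (hn : 0 < n) (μ : ℝ)
    (s : State n dx dy) : ‖gradPsi P c.γ μ s.mean - amean (mdZ P c.γ μ s)‖ ^ 2
      ≤ 2 * c.slope ^ 2 * ‖avg s.θ - P.prox c.γ s.mean‖ ^ 2
        + 6 * (μ ^ 2 * c.L₁ ^ 2 + 2 * c.L₂ ^ 2) * s.consensusError := by
  have hG := hA.smooth_G hn
  set wbar : Joint dx dy := pair (avg s.x) (avg s.θ) with hw
  set t := P.prox c.γ s.mean
  let r : Fin n → Joint dx dy := fun i =>
    μ • (gradient (P.f i) (s.z i) - gradient (P.f i) s.mean)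
      + (gradient (P.g i) (s.z i) - gradient (P.g i) s.mean)
      + -pair ((gradient (P.g i) (s.w i) - gradient (P.g i) wbar).fst) (0 : Vec dy)
  let q : Joint dx dy := pair (gradX P.G (avg s.x) (avg s.θ) - gradX P.G (avg s.x) t)
    ((1 / c.γ) • (t - avg s.θ))
  have hfst : amean (fun i => (gradient (P.g i) wbar).fst) = gradX P.G (avg s.x) (avg s.θ) := by
    have h := map_amean (WithLp.fstL 2 ℝ (Vec dx) (Vec dy)) fun i => gradient (P.g i) wbar
    rw [← hA.gradient_G] at h
    exact h.symm
  have hmd : amean (mdZ P c.γ μ s) = μ • amean (fun i => gradient (P.f i) (s.z i))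
      + amean (fun i => gradient (P.g i) (s.z i))
      - pair (amean fun i => (gradient (P.g i) (s.w i)).fst)
        ((1 / c.γ) • (avg s.y - avg s.θ)) := by
    have : (1 / c.γ) • (avg s.y - avg s.θ) = amean fun i => (1 / c.γ) • (s.y i - s.θ i) := by
      rw [amean_smul, amean_sub]; rfl
    rw [this, ← amean_pair, ← amean_smul, ← amean_add, ← amean_sub]; rfl
  have hr : amean r = μ • (amean (fun i => gradient (P.f i) (s.z i)) - gradient P.F s.mean)
      + (amean (fun i => gradient (P.g i) (s.z i)) - gradient P.G s.mean)
      + -pair ((amean fun i => (gradient (P.g i) (s.w i)).fst) - gradX P.G (avg s.x) (avg s.θ))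
        0 := by
    have h0 : pair ((amean fun i => (gradient (P.g i) (s.w i)).fst)
        - gradX P.G (avg s.x) (avg s.θ)) (0 : Vec dy)
        = amean fun i => pair ((gradient (P.g i) (s.w i) - gradient (P.g i) wbar).fst) 0 := by
      rw [amean_pair]
      simp only [WithLp.sub_fst]
      rw [amean_sub, hfst, amean_const hn]
    rw [h0, hA.gradient_F, hA.gradient_G, ← amean_sub, ← amean_sub, ← amean_smul, ← amean_add,
      ← sub_eq_add_neg, ← amean_sub]
    simp only [r, sub_eq_add_neg]
  have hdec : gradPsi P c.γ μ s.mean - amean (mdZ P c.γ μ s) = -(amean r) + q := by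
    rw [hr, hmd, gradPsi, gradV]
    have h1 : q = pair (gradX P.G (avg s.x) (avg s.θ)) 0 - pair (gradX P.G (avg s.x) t)
        ((1 / c.γ) • (avg s.y - t)) + pair 0 ((1 / c.γ) • (avg s.y - avg s.θ)) := by
      rw [pair_sub, pair_add, add_zero]
      exact congrArg (pair _) (by module)
    have h2 : pair (amean fun i => (gradient (P.g i) (s.w i)).fst)
          ((1 / c.γ) • (avg s.y - avg s.θ))
        = pair ((amean fun i => (gradient (P.g i) (s.w i)).fst) - gradX P.G (avg s.x) (avg s.θ)) 0
          + pair (gradX P.G (avg s.x) (avg s.θ)) 0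
          + pair 0 ((1 / c.γ) • (avg s.y - avg s.θ)) := by
      simp only [pair_add, sub_add_cancel, add_zero, zero_add]
    have h3 : pair (gradX P.G s.mean.fst t) ((1 / c.γ) • (s.mean.snd - t))
        = pair (gradX P.G (avg s.x) t) ((1 / c.γ) • (avg s.y - t)) := rfl
    rw [h1, h2, h3]
    module
  have hqn : ‖q‖ ^ 2 ≤ c.slope ^ 2 * ‖avg s.θ - t‖ ^ 2 := by
    have h1 := hG.norm_gradX_sub_le (avg s.x) (avg s.x) (avg s.θ) t
    rw [sub_self, norm_pair_zero_left] at h1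
    have h2 := pow_le_pow_left₀ (norm_nonneg _) h1 2
    rw [norm_pair_sq, norm_smul, mul_pow, norm_sub_rev t, Real.norm_eq_abs, sq_abs, c.slope_sq]
    linarith
  have hrn : ‖amean r‖ ^ 2 ≤ 3 * (μ ^ 2 * c.L₁ ^ 2 + 2 * c.L₂ ^ 2) * s.consensusError := by
    refine (norm_amean_sq_le hn r).trans ?_
    rw [← s.amean_sqDist, ← amean_mul]
    refine amean_mono fun i => ?_
    refine (norm_add_sq_le_three _ _ _).trans ?_
    rw [norm_neg, norm_pair_zero_right, norm_smul, mul_pow, Real.norm_eq_abs, sq_abs]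
    have h1 := (hA.smooth_f i).norm_sub_sq_le (s.z i) s.mean
    have h2 := (hA.smooth_g i).norm_sub_sq_le (s.z i) s.mean
    have h3 := (hA.smooth_g i).norm_sub_sq_le (s.w i) wbar
    have h4 := pow_le_pow_left₀ (norm_nonneg _)
      (norm_fst_le (gradient (P.g i) (s.w i) - gradient (P.g i) wbar)) 2
    have h5 := mul_le_mul_of_nonneg_left (s.norm_z_sub_sq_le i) (sq_nonneg c.L₁)
    have h6 := mul_le_mul_of_nonneg_left (s.norm_z_sub_sq_le i) (sq_nonneg c.L₂)
    have h7 := mul_le_mul_of_nonneg_left (s.norm_w_sub_sq_le i) (sq_nonneg c.L₂)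
    have h8 := mul_le_mul_of_nonneg_left (h1.trans h5) (sq_nonneg μ)
    linarith
  rw [hdec]
  have h := norm_add_sq_le_two (-(amean r)) q
  rw [norm_neg] at h
  linarith

/-- The quadratic term of the proximal objective contracts by `1 - l / γ`, and `∇_y G` is a
perturbation of size `l L₂` times the error, so the net factor is `1 - lη`. The target is taken at
an arbitrary point `v`, because it will be evaluated at `z̄ + q` and not at `z̄`. -/
lemma norm_theta_step_sub_prox_le (hc : c.Admissible)
    (hA : Assumptions P W c.L₁ c.L₂ ρ δf δg σf σg Flow) (hn : 0 < n) {l : ℝ} (hl : 0 ≤ l)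
    (hlγ : l * (1 / c.γ) ≤ 1) (s : State n dx dy) (v : Joint dx dy) :
    ‖avg s.θ - l • amean (mdTheta P c.γ s) - P.prox c.γ v‖
      ≤ (1 - l * c.eta) * ‖avg s.θ - P.prox c.γ v‖
        + l * (c.slope * ‖v - s.mean‖ + c.L₂ * √s.consensusError) := by
  have hG := hA.smooth_G hn
  have hg := hc.inv_γ_pos
  have hL := hc.L₂_pos
  set wbar : Joint dx dy := pair (avg s.x) (avg s.θ) with hw
  set t := P.prox c.γ v with ht
  set ε := amean fun i => (gradient (P.g i) (s.w i) - gradient (P.g i) wbar).snd with hε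
  have hsnd : amean (fun i => (gradient (P.g i) wbar).snd) = gradY P.G (avg s.x) (avg s.θ) := by
    have h := map_amean (WithLp.sndL 2 ℝ (Vec dx) (Vec dy)) fun i => gradient (P.g i) wbar
    rw [← hA.gradient_G] at h
    exact h.symm
  have hmd : amean (mdTheta P c.γ s) = ε + gradY P.G (avg s.x) (avg s.θ)
      + (1 / c.γ) • (avg s.θ - avg s.y) := by
    have h1 : (1 / c.γ) • (avg s.θ - avg s.y) = amean fun i => (1 / c.γ) • (s.θ i - s.y i) := by
      rw [amean_smul, amean_sub]; rfl
    rw [h1, ← hsnd, hε, ← amean_add, ← amean_add]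
    simp only [WithLp.sub_snd, sub_add_cancel]
    rfl
  have hεn : ‖ε‖ ≤ c.L₂ * √s.consensusError := by
    refine le_of_sq_le_sq ?_ (by positivity)
    rw [mul_pow, Real.sq_sqrt s.consensusError_nonneg]
    refine (norm_amean_sq_le hn _).trans ?_
    rw [← s.amean_sqDist, ← amean_mul]
    refine amean_mono fun i => ?_
    exact (pow_le_pow_left₀ (norm_nonneg _) (norm_snd_le _) 2).trans
      (((hA.smooth_g i).norm_sub_sq_le (s.w i) wbar).trans
        (mul_le_mul_of_nonneg_left (s.norm_w_sub_sq_le i) (sq_nonneg c.L₂)))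
  have hpr := gradY_prox hc hG v
  rw [← ht] at hpr
  set e := avg s.θ - t with he
  have hdec : avg s.θ - l • amean (mdTheta P c.γ s) - t = (1 - l * (1 / c.γ)) • e
      + -(l • (ε + (gradY P.G (avg s.x) (avg s.θ) - gradY P.G v.fst t)
        + (1 / c.γ) • (v.snd - avg s.y))) := by
    have h1 : (1 / c.γ) • (avg s.θ - avg s.y)
        = (1 / c.γ) • e - gradY P.G v.fst t + (1 / c.γ) • (v.snd - avg s.y) := by
      rw [hpr, ← smul_sub, ← smul_add, he]; congr 1; abel
    rw [hmd, h1, he]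
    module
  have h1 : ‖gradY P.G (avg s.x) (avg s.θ) - gradY P.G v.fst t‖
      ≤ c.L₂ * (‖v.fst - avg s.x‖ + ‖e‖) := by
    refine (hG.norm_gradY_sub_le _ _ _ _).trans (mul_le_mul_of_nonneg_left ?_ hL.le)
    refine le_of_sq_le_sq ?_ (by positivity)
    rw [norm_pair_sq, norm_sub_rev (avg s.x)]
    nlinarith [mul_nonneg (norm_nonneg (v.fst - avg s.x)) (norm_nonneg e)]
  have h2 : ‖(1 / c.γ) • (v.snd - avg s.y)‖ = 1 / c.γ * ‖v.snd - avg s.y‖ := by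
    rw [norm_smul, Real.norm_eq_abs, abs_of_pos hg]
  have h3 : c.L₂ * ‖v.fst - avg s.x‖ + 1 / c.γ * ‖v.snd - avg s.y‖ ≤ c.slope * ‖v - s.mean‖ :=
    c.mul_add_mul_le_slope (v - s.mean)
  have h4 : ‖ε + (gradY P.G (avg s.x) (avg s.θ) - gradY P.G v.fst t)
        + (1 / c.γ) • (v.snd - avg s.y)‖
      ≤ c.L₂ * √s.consensusError + c.slope * ‖v - s.mean‖ + c.L₂ * ‖e‖ := by
    refine (norm_add₃_le).trans ?_
    rw [h2]
    linarith
  rw [hdec]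
  refine (norm_add_le _ _).trans ?_
  rw [norm_neg, norm_smul, norm_smul, Real.norm_eq_abs, Real.norm_eq_abs, abs_of_nonneg hl,
    abs_of_nonneg (by linarith)]
  have h5 := mul_le_mul_of_nonneg_left h4 hl
  unfold Params.eta
  linarith

lemma dev_mdTheta_le (hA : Assumptions P W c.L₁ c.L₂ ρ δf δg σf σg Flow) (hn : 0 < n)
    (s : State n dx dy) : dev (mdTheta P c.γ s)
      ≤ 3 * ((c.L₂ ^ 2 + 2 * (1 / c.γ) ^ 2) * s.consensusError + σg ^ 2) := by
  set wbar : Joint dx dy := pair (avg s.x) (avg s.θ) with hw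
  have h0 := dev_le hn (mdTheta P c.γ s)
    ((gradient P.G wbar).snd + -((1 / c.γ) • (avg s.y - avg s.θ)))
  refine h0.trans ?_
  have hd : amean (fun i => ‖gradient (P.g i) wbar - gradient P.G wbar‖ ^ 2) ≤ σg ^ 2 :=
    hA.dissimilar_g wbar
  refine le_trans ?_ (mul_le_mul_of_nonneg_left (add_le_add_right hd _) (by norm_num))
  rw [← s.amean_sqDist, ← amean_mul, ← amean_add, ← amean_mul]
  refine amean_mono fun i => ?_
  have hdec : mdTheta P c.γ s i - ((gradient P.G wbar).snd + -((1 / c.γ) • (avg s.y - avg s.θ)))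
      = (gradient (P.g i) (s.w i) - gradient (P.g i) wbar).snd
        + (gradient (P.g i) wbar - gradient P.G wbar).snd
        + -((1 / c.γ) • ((s.y i - s.θ i) - (avg s.y - avg s.θ))) := by
    have h1 : mdTheta P c.γ s i
        = (gradient (P.g i) (s.w i)).snd + -((1 / c.γ) • (s.y i - s.θ i)) := by
      rw [← smul_neg, neg_sub]; rfl
    rw [h1, WithLp.sub_snd, WithLp.sub_snd]; module
  rw [hdec]
  refine (norm_add_sq_le_three _ _ _).trans ?_
  rw [norm_neg, norm_smul, mul_pow, Real.norm_eq_abs, sq_abs]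
  have h3 := (hA.smooth_g i).norm_sub_sq_le (s.w i) wbar
  have h4 := pow_le_pow_left₀ (norm_nonneg _)
      (norm_snd_le (gradient (P.g i) (s.w i) - gradient (P.g i) wbar)) 2
  have h4' := pow_le_pow_left₀ (norm_nonneg _)
      (norm_snd_le (gradient (P.g i) wbar - gradient P.G wbar)) 2
  have h7 := mul_le_mul_of_nonneg_left (s.norm_w_sub_sq_le i) (sq_nonneg c.L₂)
  have h8 := mul_le_mul_of_nonneg_left (s.norm_y_sub_theta_sq_le i) (sq_nonneg (1 / c.γ))
  linarith

/-- The centre is the direction built from the global gradients at the averages. Four of the seven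
resulting terms measure consensus, the other three the dissimilarity of the agents. -/
lemma dev_mdZ_le (hA : Assumptions P W c.L₁ c.L₂ ρ δf δg σf σg Flow) (hn : 0 < n) (μ : ℝ)
    (s : State n dx dy) : dev (mdZ P c.γ μ s)
      ≤ 7 * ((μ ^ 2 * c.L₁ ^ 2 + 2 * c.L₂ ^ 2 + 2 * (1 / c.γ) ^ 2) * s.consensusError
        + (μ ^ 2 * σf ^ 2 + 2 * σg ^ 2)) := by
  set wbar : Joint dx dy := pair (avg s.x) (avg s.θ) with hw
  have h0 := dev_le hn (mdZ P c.γ μ s) (μ • gradient P.F s.mean + gradient P.G s.mean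
    + -pair (gradient P.G wbar).fst ((1 / c.γ) • (avg s.y - avg s.θ)))
  refine h0.trans ?_
  have hd : amean (fun i => ‖gradient (P.g i) wbar - gradient P.G wbar‖ ^ 2) ≤ σg ^ 2 :=
    hA.dissimilar_g wbar
  have hdg : amean (fun i => ‖gradient (P.g i) s.mean - gradient P.G s.mean‖ ^ 2) ≤ σg ^ 2 :=
    hA.dissimilar_g s.mean
  have hdf : amean (fun i => ‖gradient (P.f i) s.mean - gradient P.F s.mean‖ ^ 2) ≤ σf ^ 2 :=
    hA.dissimilar_f s.mean
  have hsum := add_le_add (mul_le_mul_of_nonneg_left hdf (sq_nonneg μ)) (add_le_add hdg hd)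
  rw [← two_mul] at hsum
  refine le_trans ?_ (mul_le_mul_of_nonneg_left (add_le_add_right hsum _) (by norm_num))
  rw [← s.amean_sqDist, ← amean_mul, ← amean_mul, ← amean_add, ← amean_add, ← amean_add,
    ← amean_mul]
  refine amean_mono fun i => ?_
  have hdec : mdZ P c.γ μ s i - (μ • gradient P.F s.mean + gradient P.G s.mean
      + -pair (gradient P.G wbar).fst ((1 / c.γ) • (avg s.y - avg s.θ)))
      = μ • (gradient (P.f i) (s.z i) - gradient (P.f i) s.mean)
        + (gradient (P.g i) (s.z i) - gradient (P.g i) s.mean)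
        + -pair ((gradient (P.g i) (s.w i) - gradient (P.g i) wbar).fst) (0 : Vec dy)
        + -pair (0 : Vec dx) ((1 / c.γ) • ((s.y i - s.θ i) - (avg s.y - avg s.θ)))
        + μ • (gradient (P.f i) s.mean - gradient P.F s.mean)
        + (gradient (P.g i) s.mean - gradient P.G s.mean)
        + -pair ((gradient (P.g i) wbar - gradient P.G wbar).fst) (0 : Vec dy) := by
    have h1 : pair (gradX (P.g i) (s.x i) (s.θ i)) ((1 / c.γ) • (s.y i - s.θ i))
        = pair ((gradient (P.g i) (s.w i) - gradient (P.g i) wbar).fst) (0 : Vec dy)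
          + pair (0 : Vec dx) ((1 / c.γ) • ((s.y i - s.θ i) - (avg s.y - avg s.θ)))
          + pair ((gradient (P.g i) wbar - gradient P.G wbar).fst) (0 : Vec dy)
          + pair (gradient P.G wbar).fst ((1 / c.γ) • (avg s.y - avg s.θ)) := by
      simp only [pair_add, WithLp.sub_fst, smul_sub, zero_add, add_zero, sub_add_cancel,
        sub_add_sub_cancel]
      rfl
    rw [mdZ, h1]; module
  rw [hdec]
  refine (norm_add_sq_le_seven _ _ _ _ _ _ _).trans ?_
  rw [norm_neg, norm_neg, norm_neg, norm_pair_zero_right, norm_pair_zero_right,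
    norm_pair_zero_left, norm_smul, norm_smul, norm_smul, mul_pow, mul_pow, mul_pow,
    Real.norm_eq_abs, Real.norm_eq_abs, sq_abs, sq_abs]
  have h1 := (hA.smooth_f i).norm_sub_sq_le (s.z i) s.mean
  have h2 := (hA.smooth_g i).norm_sub_sq_le (s.z i) s.mean
  have h3 := (hA.smooth_g i).norm_sub_sq_le (s.w i) wbar
  have h4 := pow_le_pow_left₀ (norm_nonneg _)
      (norm_fst_le (gradient (P.g i) (s.w i) - gradient (P.g i) wbar)) 2
  have h4' := pow_le_pow_left₀ (norm_nonneg _)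
      (norm_fst_le (gradient (P.g i) wbar - gradient P.G wbar)) 2
  have h5 := mul_le_mul_of_nonneg_left (s.norm_z_sub_sq_le i) (sq_nonneg c.L₁)
  have h6 := mul_le_mul_of_nonneg_left (s.norm_z_sub_sq_le i) (sq_nonneg c.L₂)
  have h7 := mul_le_mul_of_nonneg_left (s.norm_w_sub_sq_le i) (sq_nonneg c.L₂)
  have h8 := mul_le_mul_of_nonneg_left (h1.trans h5) (sq_nonneg μ)
  have h9 := mul_le_mul_of_nonneg_left (s.norm_y_sub_theta_sq_le i) (sq_nonneg (1 / c.γ))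
  linarith

end Directions

/-! ### Second moments of centred random vectors -/

section Moments

variable {Ω : Type*} [MeasurableSpace Ω] {Pr : Measure Ω} [IsProbabilityMeasure Pr]
  {E : Type*} [NormedAddCommGroup E] [InnerProductSpace ℝ E] [FiniteDimensional ℝ E]
  [MeasurableSpace E] [BorelSpace E] {n : ℕ}

lemma MemLp.amean {N : Fin n → Ω → E} (hN : ∀ i, MemLp (N i) 2 Pr) :
    MemLp (fun ω => amean fun i => N i ω) 2 Pr :=
  (memLp_finsetSum Finset.univ fun i _ => hN i).const_smul (n : ℝ)⁻¹

lemma integral_amean {N : Fin n → Ω → E} (hN : ∀ i, Integrable (N i) Pr) :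
    ∫ ω, amean (fun i => N i ω) ∂Pr = amean fun i => ∫ ω, N i ω ∂Pr := by
  unfold amean
  rw [integral_smul, integral_finsetSum _ fun i _ => hN i]

lemma integrable_norm_add_sq {N : Ω → E} (hN : MemLp N 2 Pr) (a : E) :
    Integrable (fun ω => ‖a + N ω‖ ^ 2) Pr :=
  MemLp.integrable_norm_pow (p := 2) ((memLp_const a).add hN) (by norm_num)

lemma integrable_norm_sq {N : Ω → E} (hN : MemLp N 2 Pr) : Integrable (fun ω => ‖N ω‖ ^ 2) Pr :=
  MemLp.integrable_norm_pow (p := 2) hN (by norm_num)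

lemma integral_norm_add_sq {N : Ω → E} (hN : MemLp N 2 Pr) (h0 : ∫ ω, N ω ∂Pr = 0) (a : E) :
    ∫ ω, ‖a + N ω‖ ^ 2 ∂Pr = ‖a‖ ^ 2 + ∫ ω, ‖N ω‖ ^ 2 ∂Pr := by
  have hi : Integrable N Pr := hN.integrable (by norm_num)
  have hi2 := integrable_norm_sq hN
  have h1 : Integrable (fun ω => 2 * inner ℝ a (N ω)) Pr := (hi.const_inner a).const_mul 2
  simp_rw [norm_add_sq_real]
  have h2 : Integrable (fun ω => ‖a‖ ^ 2 + 2 * inner ℝ a (N ω)) Pr := (integrable_const _).add h1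
  rw [integral_add h2 hi2, integral_add (integrable_const _) h1, integral_const_mul,
    integral_inner hi, h0]
  simp

lemma integral_norm_smul_sq (N : Ω → E) (k : ℝ) :
    ∫ ω, ‖k • N ω‖ ^ 2 ∂Pr = k ^ 2 * ∫ ω, ‖N ω‖ ^ 2 ∂Pr := by
  rw [← integral_const_mul]
  congr 1; ext ω
  rw [norm_smul, mul_pow, Real.norm_eq_abs, sq_abs]

/-- Expanding the square, the off-diagonal terms vanish by independence of centred vectors. The gain
of `1 / n` is the source of the linear speed-up. -/
lemma integral_norm_amean_sq_le (hn : 0 < n) {N : Fin n → Ω → E} (hN : ∀ i, MemLp (N i) 2 Pr)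
    (h0 : ∀ i, ∫ ω, N i ω ∂Pr = 0) (hind : iIndepFun N Pr) {B : ℝ}
    (hB : ∀ i, ∫ ω, ‖N i ω‖ ^ 2 ∂Pr ≤ B) :
    ∫ ω, ‖amean fun i => N i ω‖ ^ 2 ∂Pr ≤ B / n := by
  have hn' : (0 : ℝ) < n := by positivity
  have hint : ∀ i j, Integrable (fun ω => inner ℝ (N i ω) (N j ω)) Pr := by
    intro i j
    refine Integrable.mono' ((integrable_norm_sq (hN i)).add (integrable_norm_sq (hN j)))
      ((hN i).1.inner (hN j).1) (Filter.Eventually.of_forall fun ω => ?_)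
    refine (norm_inner_le_norm _ _).trans ?_
    simp only [Pi.add_apply]
    nlinarith [sq_nonneg (‖N i ω‖ - ‖N j ω‖), sq_nonneg ‖N i ω‖, sq_nonneg ‖N j ω‖]
  have hcross : ∀ i j, i ≠ j → ∫ ω, inner ℝ (N i ω) (N j ω) ∂Pr = 0 := by
    intro i j hij
    have h := (hind.indepFun hij).integral_bilin ((hN i).integrable (by norm_num))
      ((hN j).integrable (by norm_num)) (innerSL ℝ)
    rw [h0, map_zero, zero_apply] at h
    exact h
  have hexp : ∀ ω, ‖amean fun i => N i ω‖ ^ 2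
      = ((n : ℝ)⁻¹) ^ 2 * ∑ i, ∑ j, inner ℝ (N i ω) (N j ω) := by
    intro ω
    rw [amean, norm_smul, mul_pow, ← real_inner_self_eq_norm_sq (∑ i, N i ω), sum_inner]
    simp only [inner_sum, Real.norm_eq_abs, sq_abs]
  simp_rw [hexp]
  rw [integral_const_mul, integral_finsetSum _ fun i _ => integrable_finsetSum _ fun j _ => hint i j]
  have hdiag : ∀ i, ∫ ω, ∑ j, inner ℝ (N i ω) (N j ω) ∂Pr ≤ B := by
    intro i
    rw [integral_finsetSum _ fun j _ => hint i j,
      Finset.sum_eq_single i (fun j _ hj => hcross i j hj.symm) (by simp)]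
    simpa only [real_inner_self_eq_norm_sq] using hB i
  have hs : ∑ i : Fin n, ∫ ω, ∑ j, inner ℝ (N i ω) (N j ω) ∂Pr ≤ n * B := by
    refine (Finset.sum_le_sum fun i _ => hdiag i).trans ?_
    simp
  refine (mul_le_mul_of_nonneg_left hs (by positivity)).trans (le_of_eq ?_)
  field_simp

/-- Young's inequality tuned so that the contraction `ρ²` degrades only to `ρ`. After the triangle
inequality the gap between the two sides is a sum of squares over `1 - ρ`. -/
lemma mul_norm_sub_sq_le {ρ : ℝ} (h0 : 0 ≤ ρ) (h1 : ρ < 1) (a b : E) :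
    ρ ^ 2 * ‖a - b‖ ^ 2 ≤ ρ * ‖a‖ ^ 2 + 1 / (1 - ρ) * ‖b‖ ^ 2 := by
  have hp : 0 < 1 - ρ := by linarith
  have h2 : ‖a - b‖ ^ 2 ≤ (‖a‖ + ‖b‖) ^ 2 := pow_le_pow_left₀ (norm_nonneg _) (norm_sub_le a b) 2
  have h3 : ρ * ‖a‖ ^ 2 + 1 / (1 - ρ) * ‖b‖ ^ 2 - ρ ^ 2 * (‖a‖ + ‖b‖) ^ 2
      = (ρ * ((1 - ρ) * ‖a‖ - ρ * ‖b‖) ^ 2 + (1 - ρ ^ 2) * ‖b‖ ^ 2) / (1 - ρ) := by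
    field_simp; ring
  have h4 : 0 ≤ (ρ * ((1 - ρ) * ‖a‖ - ρ * ‖b‖) ^ 2 + (1 - ρ ^ 2) * ‖b‖ ^ 2) / (1 - ρ) := by
    have : 0 ≤ 1 - ρ ^ 2 := by nlinarith
    positivity
  nlinarith [mul_le_mul_of_nonneg_left h2 (sq_nonneg ρ)]

lemma integrable_dev {N : Fin n → Ω → E} (hN : ∀ i, MemLp (N i) 2 Pr) :
    Integrable (fun ω => dev fun i => N i ω) Pr := by
  unfold dev
  have : ∀ i, Integrable (fun ω => ‖N i ω - amean fun j => N j ω‖ ^ 2) Pr := fun i =>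
    integrable_norm_sq ((hN i).sub (MemLp.amean hN))
  exact (integrable_finsetSum Finset.univ fun i _ => this i).const_mul _

variable {W : Matrix (Fin n) (Fin n) ℝ} {ρ : ℝ}

lemma memLp_gossip (u D : Fin n → E) {N : Fin n → Ω → E} (hN : ∀ i, MemLp (N i) 2 Pr) (k : ℝ)
    (i : Fin n) : MemLp (fun ω => ∑ j, W i j • (u j - k • (D j + N j ω))) 2 Pr :=
  memLp_finsetSum Finset.univ fun j _ =>
    ((memLp_const (u j)).sub (((memLp_const (D j)).add (hN j)).const_smul k)).const_smul (W i j)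

/-- Before gossip the deviation splits exactly into a deterministic part and a centred one. Young's
inequality is applied to the deterministic part only, so the noise is not amplified by `1 / (1 -
ρ)`. No independence between agents is needed. -/
lemma NetworkMatrix.integral_dev_gossip_le (hW : NetworkMatrix W ρ) (hn : 0 < n) (u D : Fin n → E)
    {N : Fin n → Ω → E} (hN : ∀ i, MemLp (N i) 2 Pr) (h0 : ∀ i, ∫ ω, N i ω ∂Pr = 0) {B : ℝ}
    (hB : ∀ i, ∫ ω, ‖N i ω‖ ^ 2 ∂Pr ≤ B) (k : ℝ) :
    ∫ ω, dev (fun i => ∑ j, W i j • (u j - k • (D j + N j ω))) ∂Pr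
      ≤ ρ * dev u + k ^ 2 / (1 - ρ) * dev D + k ^ 2 * B := by
  have hρ := hW.rho_nonneg
  have hρ1 := hW.rho_lt_one
  let A : Fin n → E := fun i => u i - k • D i
  let M : Fin n → Ω → E := fun i ω => -(k • (N i ω - amean fun j => N j ω))
  have hM : ∀ i, MemLp (M i) 2 Pr := fun i => (((hN i).sub (MemLp.amean hN)).const_smul k).neg
  have hNi : ∀ i, Integrable (N i) Pr := fun i => (hN i).integrable (by norm_num)
  have hM0 : ∀ i, ∫ ω, M i ω ∂Pr = 0 := by
    intro i
    simp only [M]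
    rw [integral_neg, integral_smul,
      integral_sub (hNi i) ((MemLp.amean hN).integrable (by norm_num)), integral_amean hNi]
    simp [h0, amean]
  have hdev : ∀ ω, dev (fun i => u i - k • (D i + N i ω))
      = amean fun i => ‖(A i - amean A) + M i ω‖ ^ 2 := by
    intro ω
    have h1 : amean (fun i => u i - k • (D i + N i ω)) = amean A - k • amean fun j => N j ω := by
      rw [← amean_smul, ← amean_sub]
      congr 1; ext i; simp only [A]; module
    unfold dev
    rw [h1]
    congr 1; ext i
    congr 2; simp only [A, M]; module
  have hMi : ∀ i, Integrable (fun ω => ‖(A i - amean A) + M i ω‖ ^ 2) Pr := fun i =>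
    integrable_norm_add_sq (hM i) _
  have hdevi : Integrable (fun ω => dev fun i => u i - k • (D i + N i ω)) Pr :=
    integrable_dev fun i => (memLp_const (u i)).sub (((memLp_const (D i)).add (hN i)).const_smul k)
  have hNdev : ∫ ω, dev (fun i => N i ω) ∂Pr ≤ B := by
    have h1 : ∫ ω, dev (fun i => N i ω) ∂Pr ≤ ∫ ω, amean (fun i => ‖N i ω‖ ^ 2) ∂Pr := by
      refine integral_mono (integrable_dev hN)
        ((integrable_finsetSum Finset.univ fun i _ => integrable_norm_sq (hN i)).const_mul _)
        fun ω => ?_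
      simpa using dev_le hn (fun i => N i ω) 0
    refine h1.trans ?_
    rw [integral_amean fun i => integrable_norm_sq (hN i)]
    refine (amean_mono hB).trans (amean_const hn B).le
  have hMsum : ∫ ω, amean (fun i => ‖M i ω‖ ^ 2) ∂Pr ≤ k ^ 2 * B := by
    refine le_trans (le_of_eq ?_) (mul_le_mul_of_nonneg_left hNdev (sq_nonneg k))
    rw [← integral_const_mul]
    congr 1; ext ω
    rw [dev, ← amean_mul]
    congr 1; ext i
    rw [norm_neg, norm_smul, mul_pow, Real.norm_eq_abs, sq_abs]
  rw [integral_amean fun i => integrable_norm_sq (hM i)] at hMsum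
  have hA : ρ ^ 2 * dev A ≤ ρ * dev u + k ^ 2 / (1 - ρ) * dev D := by
    unfold dev
    rw [← amean_mul, ← amean_mul, ← amean_mul, ← amean_add]
    refine amean_mono fun i => ?_
    have h1 := mul_norm_sub_sq_le hρ hρ1 (u i - amean u) (k • (D i - amean D))
    rw [norm_smul, mul_pow, Real.norm_eq_abs, sq_abs] at h1
    have h2 : A i - amean A = (u i - amean u) - k • (D i - amean D) := by
      simp only [A]
      rw [amean_sub, amean_smul]; module
    rw [h2]
    refine h1.trans (le_of_eq ?_)
    ring
  calc ∫ ω, dev (fun i => ∑ j, W i j • (u j - k • (D j + N j ω))) ∂Pr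
      ≤ ∫ ω, ρ ^ 2 * dev (fun i => u i - k • (D i + N i ω)) ∂Pr :=
        integral_mono (integrable_dev fun i => memLp_gossip u D hN k i) (hdevi.const_mul _)
          fun ω => hW.dev_gossip_le hn _
    _ = ρ ^ 2 * (dev A + amean fun i => ∫ ω, ‖M i ω‖ ^ 2 ∂Pr) := by
        rw [integral_const_mul]
        congr 1
        simp_rw [hdev]
        rw [integral_amean hMi]
        simp_rw [integral_norm_add_sq (hM _) (hM0 _)]
        rw [amean_add]; rfl
    _ ≤ ρ * dev u + k ^ 2 / (1 - ρ) * dev D + k ^ 2 * B := by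
        have h1 : 0 ≤ amean fun i => ∫ ω, ‖M i ω‖ ^ 2 ∂Pr :=
          amean_nonneg fun i => integral_nonneg fun ω => sq_nonneg _
        have h2 : ρ ^ 2 ≤ 1 := by nlinarith
        nlinarith

end Moments

/-! ### The noise of the stochastic directions -/

section Noise

variable {n dx dy : ℕ} {Ξf : Type u} {Ξg : Type v} [MeasurableSpace Ξf] [MeasurableSpace Ξg]
  {Ω : Type w} [MeasurableSpace Ω] {Pr : Measure Ω} [IsProbabilityMeasure Pr]

lemma StochasticOracle.measurable_gradient {Ξ : Type u} [MeasurableSpace Ξ]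
    {h : Ξ → Joint dx dy → ℝ} {law : Measure Ξ} {δ : ℝ} (ho : StochasticOracle h law δ)
    (z : Joint dx dy) : Measurable fun ξ => gradient (h ξ) z :=
  ho.measurable.comp (measurable_id.prodMk measurable_const)

/-- A square integrable centred random vector with second moment at most `B`. -/
structure IsNoise {E : Type*} [NormedAddCommGroup E] [NormedSpace ℝ E] (Pr : Measure Ω)
    (N : Ω → E) (B : ℝ) : Prop where
  memLp : MemLp N 2 Pr
  mean_zero : ∫ ω, N ω ∂Pr = 0
  moment : ∫ ω, ‖N ω‖ ^ 2 ∂Pr ≤ B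

lemma isNoise_sub_mean {Ξ : Type*} [MeasurableSpace Ξ] {E : Type*} [NormedAddCommGroup E]
    [InnerProductSpace ℝ E] [FiniteDimensional ℝ E] [MeasurableSpace E] [BorelSpace E]
    {law : Measure Ξ} [IsProbabilityMeasure law] {B : ℝ} {ξ : Ω → Ξ} (hξ : Measurable ξ)
    (hlaw : Pr.map ξ = law) {X : Ξ → E} {m : E} (hX : Measurable X) (hint : Integrable X law)
    (hmean : ∫ a, X a ∂law = m) (hsq : Integrable (fun a => ‖m - X a‖ ^ 2) law)
    (hB : ∫ a, ‖m - X a‖ ^ 2 ∂law ≤ B) : IsNoise Pr (fun ω => X (ξ ω) - m) B := by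
  have hm : Measurable fun a => X a - m := hX.sub_const m
  simp_rw [norm_sub_rev m] at hsq hB
  refine ⟨?_, ?_, ?_⟩
  · refine (memLp_two_iff_integrable_sq_norm (hm.comp hξ).aestronglyMeasurable).2 ?_
    exact (hlaw ▸ hsq).comp_measurable hξ
  · have h1 := integral_map hξ.aemeasurable (f := fun a => X a - m) (μ := Pr)
      hm.aestronglyMeasurable
    rw [← h1, hlaw, integral_sub hint (integrable_const _), hmean]
    simp
  · have h1 := integral_map hξ.aemeasurable (f := fun a => ‖X a - m‖ ^ 2) (μ := Pr)
      (hm.norm.pow_const 2).aestronglyMeasurable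
    rw [← h1, hlaw]
    exact hB

lemma StochasticOracle.isNoise {Ξ : Type u} [MeasurableSpace Ξ] {h : Ξ → Joint dx dy → ℝ}
    {law : Measure Ξ} {δ : ℝ} (ho : StochasticOracle h law δ) {ξ : Ω → Ξ} (hξ : Measurable ξ)
    (hlaw : Pr.map ξ = law) (z : Joint dx dy) :
    IsNoise Pr (fun ω => gradient (h (ξ ω)) z - gradient (fun z' => ∫ ξ', h ξ' z' ∂law) z)
      (δ ^ 2) := by
  have := ho.prob
  exact isNoise_sub_mean hξ hlaw (ho.measurable_gradient z) (ho.grad_integrable z) (ho.unbiased z)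
    (ho.sq_integrable z) (ho.variance z)

variable {P : Problem n dx dy Ξf Ξg} {W : Matrix (Fin n) (Fin n) ℝ} {L₁ L₂ ρ δf δg σf σg Flow : ℝ}
  {ξf : ℕ → Fin n → Ω → Ξf} {ξg : ℕ → Fin n → Ω → Ξg}

lemma isNoise_noiseF (hA : Assumptions P W L₁ L₂ ρ δf δg σf σg Flow) (hS : Sampling P Pr ξf ξg)
    (k : ℕ) (i : Fin n) (z : Joint dx dy) :
    IsNoise Pr (fun ω => noiseF P i z (ξf k i ω)) (δf ^ 2) := 
  (hA.oracle_f i).isNoise (hS.measurable_f k i) (hS.law_f k i) z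

lemma isNoise_noiseG (hA : Assumptions P W L₁ L₂ ρ δf δg σf σg Flow) (hS : Sampling P Pr ξf ξg)
    (k : ℕ) (i : Fin n) (z : Joint dx dy) :
    IsNoise Pr (fun ω => noiseG P i z (ξg k i ω)) (δg ^ 2) := 
  (hA.oracle_g i).isNoise (hS.measurable_g k i) (hS.law_g k i) z

lemma IsNoise.map {E F : Type*} [NormedAddCommGroup E] [InnerProductSpace ℝ E]
    [FiniteDimensional ℝ E] [NormedAddCommGroup F] [InnerProductSpace ℝ F] [FiniteDimensional ℝ F]
    {N : Ω → E} {B : ℝ} (hN : IsNoise Pr N B) (T : E →L[ℝ] F) (hT : ∀ x, ‖T x‖ ≤ ‖x‖) :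
    IsNoise Pr (fun ω => T (N ω)) B := by
  have h := T.comp_memLp' hN.memLp
  refine ⟨h, ?_, le_trans (integral_mono (MemLp.integrable_norm_pow (p := 2) h (by norm_num))
    (MemLp.integrable_norm_pow (p := 2) hN.memLp (by norm_num)) fun ω =>
      pow_le_pow_left₀ (norm_nonneg _) (hT _) 2) hN.moment⟩
  rw [T.integral_comp_comm (hN.memLp.integrable (by norm_num)), hN.mean_zero, map_zero]

lemma isNoise_noiseTheta (hA : Assumptions P W L₁ L₂ ρ δf δg σf σg Flow)
    (hS : Sampling P Pr ξf ξg) (k : ℕ) (i : Fin n) (s : State n dx dy) :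
    IsNoise Pr (fun ω => noiseTheta P s i (ξg k i ω)) (δg ^ 2) :=
  (isNoise_noiseG hA hS k i (s.w i)).map (WithLp.sndL 2 ℝ (Vec dx) (Vec dy)) norm_snd_le

/-- The projection of the joint space to the first component. -/
def projX (dx dy : ℕ) : Joint dx dy →L[ℝ] Joint dx dy :=
  ((WithLp.prodContinuousLinearEquiv 2 ℝ (Vec dx) (Vec dy)).symm : _ →L[ℝ] Joint dx dy).comp
    ((ContinuousLinearMap.inl ℝ (Vec dx) (Vec dy)).comp (WithLp.fstL 2 ℝ (Vec dx) (Vec dy)))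

lemma projX_apply (z : Joint dx dy) : projX dx dy z = pair z.fst 0 := rfl

/-- The two errors of `∇g_i` share one sample, so the three errors are added by the elementary
inequality with factor `3`, without any independence within an agent. -/
lemma isNoise_noiseZ (hA : Assumptions P W L₁ L₂ ρ δf δg σf σg Flow) (hS : Sampling P Pr ξf ξg)
    (k : ℕ) (i : Fin n) (μ : ℝ) (s : State n dx dy) :
    IsNoise Pr (fun ω => noiseZ P μ s i (ξf k i ω, ξg k i ω))
      (3 * (μ ^ 2 * δf ^ 2 + 2 * δg ^ 2)) := by
  have h1 := isNoise_noiseF hA hS k i (s.z i)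
  have h2 := isNoise_noiseG hA hS k i (s.z i)
  have h3 := (isNoise_noiseG hA hS k i (s.w i)).map (projX dx dy) fun z => by
    rw [projX_apply, norm_pair_zero_right]; exact norm_fst_le z
  have hm := ((h1.memLp.const_smul μ).add h2.memLp).sub h3.memLp
  have i1 := (h1.memLp.integrable (by norm_num)).smul μ
  have i2 := h2.memLp.integrable (by norm_num)
  have i3 := h3.memLp.integrable (by norm_num)
  have j1 := integrable_norm_sq h1.memLp
  have j2 := integrable_norm_sq h2.memLp
  have j3 := integrable_norm_sq h3.memLp
  refine ⟨hm, ?_, ?_⟩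
  · refine (integral_sub (i1.add i2) i3).trans ?_
    rw [integral_add' i1 i2, h3.mean_zero, h2.mean_zero]
    have : ∫ ω, (μ • fun ω => noiseF P i (s.z i) (ξf k i ω)) ω ∂Pr = 0 := by
      simp only [Pi.smul_apply]
      rw [integral_smul, h1.mean_zero, smul_zero]
    rw [this]; simp
  · have hle : ∫ ω, ‖noiseZ P μ s i (ξf k i ω, ξg k i ω)‖ ^ 2 ∂Pr
        ≤ ∫ ω, 3 * (μ ^ 2 * ‖noiseF P i (s.z i) (ξf k i ω)‖ ^ 2
          + ‖noiseG P i (s.z i) (ξg k i ω)‖ ^ 2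
          + ‖projX dx dy (noiseG P i (s.w i) (ξg k i ω))‖ ^ 2) ∂Pr := by
      refine integral_mono (integrable_norm_sq hm) ((((j1.const_mul _).add j2).add j3).const_mul 3)
        fun ω => ?_
      have h := norm_add_sq_le_three (μ • noiseF P i (s.z i) (ξf k i ω))
        (noiseG P i (s.z i) (ξg k i ω)) (-projX dx dy (noiseG P i (s.w i) (ξg k i ω)))
      rw [norm_neg, norm_smul, mul_pow, Real.norm_eq_abs, sq_abs, ← sub_eq_add_neg] at h
      exact h
    refine hle.trans ?_
    have j12 : Integrable (fun ω => μ ^ 2 * ‖noiseF P i (s.z i) (ξf k i ω)‖ ^ 2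
        + ‖noiseG P i (s.z i) (ξg k i ω)‖ ^ 2) Pr := (j1.const_mul _).add j2
    rw [integral_const_mul, integral_add j12 j3,
      integral_add (j1.const_mul _) j2, integral_const_mul]
    have := mul_le_mul_of_nonneg_left h1.moment (sq_nonneg μ)
    linarith [h2.moment, h3.moment]

lemma iIndepFun_noise (hS : Sampling P Pr ξf ξg) (k : ℕ) {E : Type*} [MeasurableSpace E]
    {φ : Fin n → Ξf × Ξg → E} (hφ : ∀ i, Measurable (φ i)) :
    iIndepFun (fun i ω => φ i (ξf k i ω, ξg k i ω)) Pr :=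
  (hS.indep.precomp (g := fun i : Fin n => (k, i)) fun _ _ h => (Prod.mk.inj h).2).comp φ hφ

lemma measurable_noiseF (hA : Assumptions P W L₁ L₂ ρ δf δg σf σg Flow) (i : Fin n)
    (z : Joint dx dy) : Measurable (noiseF P i z) :=
  ((hA.oracle_f i).measurable_gradient z).sub_const _

lemma measurable_noiseG (hA : Assumptions P W L₁ L₂ ρ δf δg σf σg Flow) (i : Fin n)
    (z : Joint dx dy) : Measurable (noiseG P i z) :=
  ((hA.oracle_g i).measurable_gradient z).sub_const _

lemma measurable_noiseTheta (hA : Assumptions P W L₁ L₂ ρ δf δg σf σg Flow) (s : State n dx dy)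
    (i : Fin n) : Measurable (noiseTheta P s i) :=
  (WithLp.sndL 2 ℝ (Vec dx) (Vec dy)).continuous.measurable.comp (measurable_noiseG hA i (s.w i))

lemma measurable_noiseZ (hA : Assumptions P W L₁ L₂ ρ δf δg σf σg Flow) (μ : ℝ)
    (s : State n dx dy) (i : Fin n) : Measurable (noiseZ P μ s i) := by
  have h1 : Measurable fun ξ : Ξf × Ξg => noiseF P i (s.z i) ξ.1 :=
    (measurable_noiseF hA i _).comp measurable_fst
  have h2 : ∀ z, Measurable fun ξ : Ξf × Ξg => noiseG P i z ξ.2 := fun z =>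
    (measurable_noiseG hA i z).comp measurable_snd
  have h3 : Measurable fun ξ : Ξf × Ξg => projX dx dy (noiseG P i (s.w i) ξ.2) :=
    (projX dx dy).continuous.measurable.comp (h2 _)
  exact ((h1.const_smul μ).add (h2 _)).sub h3

lemma isNoise_amean_noiseTheta (hA : Assumptions P W L₁ L₂ ρ δf δg σf σg Flow)
    (hS : Sampling P Pr ξf ξg) (hn : 0 < n) (k : ℕ) (s : State n dx dy) :
    IsNoise Pr (fun ω => amean fun i => noiseTheta P s i (ξg k i ω)) (δg ^ 2 / n) := by
  have h := fun i => isNoise_noiseTheta hA hS k i s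
  refine ⟨MemLp.amean fun i => (h i).memLp, ?_, ?_⟩
  · rw [integral_amean fun i => (h i).memLp.integrable (by norm_num)]
    simp [fun i => (h i).mean_zero, amean]
  · exact integral_norm_amean_sq_le hn (fun i => (h i).memLp) (fun i => (h i).mean_zero)
      (iIndepFun_noise hS k fun i => (measurable_noiseTheta hA s i).comp measurable_snd)
      fun i => (h i).moment

lemma isNoise_amean_noiseZ (hA : Assumptions P W L₁ L₂ ρ δf δg σf σg Flow)
    (hS : Sampling P Pr ξf ξg) (hn : 0 < n) (k : ℕ) (μ : ℝ) (s : State n dx dy) :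
    IsNoise Pr (fun ω => amean fun i => noiseZ P μ s i (ξf k i ω, ξg k i ω))
      (3 * (μ ^ 2 * δf ^ 2 + 2 * δg ^ 2) / n) := by
  have h := fun i => isNoise_noiseZ hA hS k i μ s
  refine ⟨MemLp.amean fun i => (h i).memLp, ?_, ?_⟩
  · rw [integral_amean fun i => (h i).memLp.integrable (by norm_num)]
    simp [fun i => (h i).mean_zero, amean]
  · exact integral_norm_amean_sq_le hn (fun i => (h i).memLp) (fun i => (h i).mean_zero)
      (iIndepFun_noise hS k fun i => measurable_noiseZ hA μ s i) fun i => (h i).moment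

end Noise

/-! ### Consequences of the step-size conditions -/

namespace Params

variable {c : Params}

lemma Admissible.lip_pos (hc : c.Admissible) : 0 < c.lip := zero_lt_one.trans_le hc.one_le_lip

lemma Admissible.lip_le_Lθ (hc : c.Admissible) : c.lip ≤ c.Lθ := hc.Lθ_ge

lemma Admissible.Lθ_pos (hc : c.Admissible) : 0 < c.Lθ := hc.lip_pos.trans_le hc.lip_le_Lθ

lemma a₁_eq (c : Params) : c.a₁ = c.slope / (2 * c.Lθ) := by
  unfold a₁ slope; ring

lemma Admissible.a₁_pos (hc : c.Admissible) : 0 < c.a₁ := by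
  have := hc.slope_pos; have := hc.Lθ_pos; rw [a₁_eq]; positivity

/-- By the definition of `a₁`, the bound on `c_λ` reads `16 c_λ slope L_θ ≤ η`. Now `L_θ ≥ lip` and
`slope = lip η`. -/
lemma Admissible.cLam_mul_lip_sq_le (hc : c.Admissible) : c.cLam * c.lip ^ 2 ≤ 1 / 16 := by
  have hs := hc.slope_pos
  have hL := hc.Lθ_pos
  have hη := hc.eta_pos
  have hℓ := hc.lip_pos
  have h1 : 32 * c.a₁ * c.Lθ ^ 2 = 16 * c.slope * c.Lθ := by
    rw [a₁_eq]; field_simp; ring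
  have h2 := hc.cLam_le
  rw [h1, le_div_iff₀ (by positivity)] at h2
  have h3 : c.cLam * (16 * c.slope * c.lip) ≤ c.eta :=
    (mul_le_mul_of_nonneg_left (mul_le_mul_of_nonneg_left hc.lip_le_Lθ (by positivity))
      hc.cLam_pos.le).trans h2
  rw [← hc.lip_mul_eta] at h3
  have h4 : c.cLam * (16 * (c.lip * c.eta) * c.lip) = 16 * (c.cLam * c.lip ^ 2) * c.eta := by ring
  rw [h4] at h3
  have h5 : 16 * (c.cLam * c.lip ^ 2) ≤ 1 := by
    by_contra h
    nlinarith [not_le.1 h]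
  linarith

lemma Admissible.cLam_div_a₁_le (hc : c.Admissible) :
    c.cLam * (8 * c.slope ^ 2) ≤ c.eta * c.a₁ := by
  have hs := hc.slope_pos
  have hL := hc.Lθ_pos
  have h1 : 32 * c.a₁ * c.Lθ ^ 2 = 16 * c.slope * c.Lθ := by
    rw [a₁_eq]; field_simp; ring
  have h2 := hc.cLam_le
  rw [h1, le_div_iff₀ (by positivity)] at h2
  rw [a₁_eq, mul_div_assoc', le_div_iff₀ (by positivity)]
  nlinarith

/-- This comes from the condition involving `τ₄`. Its numerator `τ₄ c_λ (1 - ρ)` is `24 a₁ slope² /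
η` plus terms proportional to `c_λ`, which the bound on `c_λ` makes at most one more unit of `a₁
slope² / η`, whence `25`. The conclusion follows with `1 / γ < 2η`. -/
lemma StepCondition.mul_inv_γ_le (hc : c.Admissible) {ρ l : ℝ} (hρ : ρ < 1)
    (hl : c.StepCondition ρ l) : l * (1 / c.γ) ≤ 25 / 96 * (1 - ρ) := by
  have h1 := hl.le₅
  have hη := hc.eta_pos
  have ha := hc.a₁_pos
  have hc0 := hc.cLam_pos
  have hs := hc.slope_pos
  have hp : 0 < 1 - ρ := by linarith
  have hg := hc.inv_γ_pos
  have hS : c.L₂ ^ 2 + 1 / c.γ ^ 2 = c.slope ^ 2 := by rw [slope_sq, one_div_pow]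
  have hτ : c.tau₄ ρ * c.cLam * (1 - ρ)
      = 2 * ((3 * c.L₂ ^ 2 + 4 * (1 / c.γ) ^ 2) * c.cLam + 12 * c.a₁ / c.eta * c.slope ^ 2) := by
    rw [← hS, tau₄]
    field_simp
    ring
  rw [hτ, hS] at h1
  have hle : 2 * ((3 * c.L₂ ^ 2 + 4 * (1 / c.γ) ^ 2) * c.cLam + 12 * c.a₁ / c.eta * c.slope ^ 2)
      ≤ 25 * c.a₁ * c.slope ^ 2 / c.eta := by
    have h2 : (3 * c.L₂ ^ 2 + 4 * (1 / c.γ) ^ 2) * c.cLam ≤ 4 * c.slope ^ 2 * c.cLam := by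
      rw [slope_sq]
      exact mul_le_mul_of_nonneg_right (by nlinarith [sq_nonneg c.L₂]) hc0.le
    have h3 := hc.cLam_div_a₁_le
    have h4 : 4 * c.slope ^ 2 * c.cLam ≤ c.a₁ * c.slope ^ 2 / c.eta / 2 := by
      have h5 : c.eta ^ 2 ≤ c.slope ^ 2 := by
        have := hc.eta_lt.le.trans hc.inv_γ_le_slope
        nlinarith
      rw [div_div, le_div_iff₀ (by positivity)]
      calc 4 * c.slope ^ 2 * c.cLam * (c.eta * 2) = c.cLam * (8 * c.slope ^ 2) * c.eta := by ring
        _ ≤ c.eta * c.a₁ * c.eta := mul_le_mul_of_nonneg_right h3 hη.le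
        _ = c.a₁ * c.eta ^ 2 := by ring
        _ ≤ c.a₁ * c.slope ^ 2 := mul_le_mul_of_nonneg_left h5 ha.le
    have h6 : 12 * c.a₁ / c.eta * c.slope ^ 2 = 12 * (c.a₁ * c.slope ^ 2 / c.eta) := by ring
    have h7 : 25 * c.a₁ * c.slope ^ 2 / c.eta = 25 * (c.a₁ * c.slope ^ 2 / c.eta) := by ring
    rw [h6, h7]; linarith
  have h2 : l ≤ 25 * c.a₁ * c.slope ^ 2 / c.eta
      / (96 * c.slope ^ 2 * (2 * c.a₁) * (1 / (1 - ρ))) :=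
    h1.trans (div_le_div_of_nonneg_right hle (by positivity))
  have h3 : 25 * c.a₁ * c.slope ^ 2 / c.eta / (96 * c.slope ^ 2 * (2 * c.a₁) * (1 / (1 - ρ)))
      = 25 / 192 * (1 - ρ) / c.eta := by
    field_simp; ring
  rw [h3, le_div_iff₀ hη] at h2
  have h4 : 1 / c.γ ≤ 2 * c.eta := hc.inv_γ_lt.le
  rcases le_or_gt l 0 with h0 | h0
  · nlinarith
  · nlinarith

/-- The weight of the filtered noise in the Lyapunov function. -/
def kq (c : Params) : ℝ := 13 * c.slope ^ 2 / c.eta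

/-- The weight of the consensus error in the Lyapunov function, up to the factor `l / (1 - ρ)`. -/
def kd (c : Params) : ℝ := 10 * (1 / c.γ) ^ 2

lemma Admissible.kq_pos (hc : c.Admissible) : 0 < c.kq := by
  have := hc.slope_pos; have := hc.eta_pos; unfold kq; positivity

lemma Admissible.kd_pos (hc : c.Admissible) : 0 < c.kd := by
  have := hc.inv_γ_pos; unfold kd; positivity

end Params

/-! ### The arithmetic of the Lyapunov function -/

/-- The descent term offers `-k l / 2` for `‖D‖²`. The curvature without its `μ L₁` part and the
motion of the target use at most half of it. -/
lemma direction_coeff_le {k l g ℓ : ℝ} (hk : 0 < k) (hl : 0 ≤ l) (hℓ : 1 ≤ ℓ)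
    (hkℓ : k * ℓ ^ 2 ≤ 1 / 16) (hlg : l * g ≤ 25 / 96) :
    3 * ℓ * g * (k * l) ^ 2 + 3 * l * (ℓ ^ 2 * k ^ 2) ≤ k * l / 2 - k * l / 4 := by
  have h1 : k * ℓ ≤ 1 / 16 := by nlinarith [mul_nonneg hk.le (by linarith : 0 ≤ ℓ - 1)]
  have h2 : 0 ≤ k * ℓ := by positivity
  have h3 : (k * ℓ) * (l * g) ≤ 1 / 16 * (25 / 96) := by nlinarith
  have h4 : 3 * ((k * ℓ) * (l * g)) + 3 * (k * ℓ ^ 2) ≤ 1 / 4 := by linarith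
  have h5 : 0 ≤ k * l := by positivity
  nlinarith [mul_le_mul_of_nonneg_left h4 h5]

/-- Here `r` is `l / (1 - ρ)` and `h` is `μ L₁`. Contraction of the weighted consensus error
releases `10 g² l`; one quarter of it is kept as guaranteed decrease, and the terms in `h` are
allowed to exceed the rest by `l (h² - g²)`. -/
lemma consensus_coeff_le {k l g L₂ h r : ℝ} (hk : 0 < k) (hk16 : k ≤ 1 / 16) (hl : 0 ≤ l)
    (hg : 0 < g) (hL : 0 < L₂) (hLg : 2 * L₂ < g) (hr : 0 ≤ r) (hrg : r * g ≤ 25 / 96) :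
    k * l / 2 * (6 * (h ^ 2 + 2 * L₂ ^ 2)) + 3 * l * L₂ ^ 2
      + 10 * g ^ 2 * l * r ^ 2 * (3 * (L₂ ^ 2 + 2 * g ^ 2)
        + k ^ 2 * (7 * (h ^ 2 + 2 * L₂ ^ 2 + 2 * g ^ 2)))
      ≤ 10 * g ^ 2 * l - 10 * g ^ 2 / 4 * l + l * (h ^ 2 - g ^ 2) := by
  have h1 : L₂ ^ 2 ≤ g ^ 2 / 4 := by nlinarith
  have h2 : 0 ≤ h ^ 2 := sq_nonneg h
  have h3 : k ^ 2 ≤ 1 / 256 := by nlinarith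
  have h4 : (r * g) ^ 2 ≤ (25 / 96) ^ 2 := pow_le_pow_left₀ (by positivity) hrg 2
  have h5 : 3 * (L₂ ^ 2 + 2 * g ^ 2) + k ^ 2 * (7 * (h ^ 2 + 2 * L₂ ^ 2 + 2 * g ^ 2))
      ≤ 6.82 * g ^ 2 + 0.028 * h ^ 2 := by
    have : k ^ 2 * (7 * (h ^ 2 + 2 * L₂ ^ 2 + 2 * g ^ 2))
        ≤ 1 / 256 * (7 * (h ^ 2 + 2 * L₂ ^ 2 + 2 * g ^ 2)) :=
      mul_le_mul_of_nonneg_right h3 (by positivity)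
    nlinarith
  have h6 : 10 * (r * g) ^ 2 * (3 * (L₂ ^ 2 + 2 * g ^ 2)
        + k ^ 2 * (7 * (h ^ 2 + 2 * L₂ ^ 2 + 2 * g ^ 2)))
      ≤ 10 * (25 / 96) ^ 2 * (6.82 * g ^ 2 + 0.028 * h ^ 2) :=
    mul_le_mul (by linarith) h5 (by positivity) (by norm_num)
  have h7 : k * (3 * (h ^ 2 + 2 * L₂ ^ 2)) ≤ 1 / 16 * (3 * (h ^ 2 + 2 * L₂ ^ 2)) :=
    mul_le_mul_of_nonneg_right hk16 (by positivity)
  have h8 : k * (3 * (h ^ 2 + 2 * L₂ ^ 2)) + 3 * L₂ ^ 2 + 10 * (r * g) ^ 2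
      * (3 * (L₂ ^ 2 + 2 * g ^ 2) + k ^ 2 * (7 * (h ^ 2 + 2 * L₂ ^ 2 + 2 * g ^ 2)))
      ≤ 10 * g ^ 2 - 10 * g ^ 2 / 4 + (h ^ 2 - g ^ 2) := by
    have hg2 : 0 ≤ g ^ 2 := sq_nonneg g
    norm_num at h6 h7 ⊢
    linarith
  have h9 := mul_le_mul_of_nonneg_left h8 hl
  calc _ = l * (k * (3 * (h ^ 2 + 2 * L₂ ^ 2)) + 3 * L₂ ^ 2 + 10 * (r * g) ^ 2
      * (3 * (L₂ ^ 2 + 2 * g ^ 2) + k ^ 2 * (7 * (h ^ 2 + 2 * L₂ ^ 2 + 2 * g ^ 2)))) := by ring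
    _ ≤ _ := h9
    _ = _ := by ring

/-- The tracking recursion needs `12 l S` and the gradient error at most `l S / 8`, which is why the
weight of `‖q‖²` is `13 S / η`. -/
lemma filter_coeff_le {k l ℓ η S : ℝ} (hl : 0 ≤ l) (hη : 0 < η) (hS : S = ℓ ^ 2 * η ^ 2)
    (hkℓ : k * ℓ ^ 2 ≤ 1 / 16) :
    k * l / 2 * (4 * S * ℓ ^ 2) + 12 * l * S ≤ 13 * S / η * (l * η) := by
  have h1 : 13 * S / η * (l * η) = 13 * S * l := by field_simp
  have h2 : 0 ≤ S * l := by rw [hS]; positivity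
  rw [h1]
  nlinarith [mul_le_mul_of_nonneg_left hkℓ h2]

lemma tracking_coeff_le {k l ℓ η S : ℝ} (hl : 0 ≤ l) (hS : S = ℓ ^ 2 * η ^ 2)
    (hkℓ : k * ℓ ^ 2 ≤ 1 / 16) : k * l / 2 * (4 * S) ≤ η * (l * η) := by
  have h2 : 0 ≤ η ^ 2 * l := by positivity
  rw [hS]
  nlinarith [mul_le_mul_of_nonneg_left hkℓ h2]

/-- Dictionary: `k = c_λ`, `g = 1 / γ`, `h = μ L₁`, `ℓ = lip`, `S = slope²`; `pp`, `DD`, `pD` are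
the squared norms of `∇Ψ_μ`, of the averaged direction and of their difference; `ee` is the tracking
error at `z̄ + q` and `qq` is `‖q‖²`. Each coefficient is absorbed separately by the preceding
lemmas. -/
lemma lyapunov_arith {k l ρ g L₂ η ℓ S h Φ pp DD pD ee qq Δ vZ vθ dθ dZ nθ nZ σθ σZ : ℝ}
    (hk : 0 < k) (hl : 0 ≤ l) (hρ0 : 0 ≤ ρ) (hρ : ρ < 1) (hg : 0 < g) (hL : 0 < L₂)
    (hLg : 2 * L₂ < g) (hη : 0 < η) (hℓ : 1 ≤ ℓ) (hS : S = ℓ ^ 2 * η ^ 2)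
    (hkℓ : k * ℓ ^ 2 ≤ 1 / 16) (hlg : l * g ≤ 25 / 96 * (1 - ρ)) (hDD : 0 ≤ DD) (hee : 0 ≤ ee)
    (hqq : 0 ≤ qq) (hΔ : 0 ≤ Δ)
    (hpD : pD ≤ 2 * S * (2 * (ee + ℓ ^ 2 * qq)) + 6 * (h ^ 2 + 2 * L₂ ^ 2) * Δ)
    (hdθ : dθ ≤ 3 * ((L₂ ^ 2 + 2 * g ^ 2) * Δ + σθ))
    (hdZ : dZ ≤ 7 * ((h ^ 2 + 2 * L₂ ^ 2 + 2 * g ^ 2) * Δ + σZ)) :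
    (Φ - k * l / 2 * (pp + DD - pD) + (h + 3 * ℓ * g) * (k * l) ^ 2 * (DD + vZ))
      + η * ((1 - l * η) * ee + l / η * (3 * (4 * S * qq + L₂ ^ 2 * Δ + ℓ ^ 2 * k ^ 2 * DD))
        + l ^ 2 * vθ)
      + 13 * S / η * ((1 - l * η) * qq + (k * l) ^ 2 * vZ)
      + 10 * g ^ 2 * l / (1 - ρ) * ((ρ * Δ + l ^ 2 / (1 - ρ) * (dθ + k ^ 2 * dZ))
        + l ^ 2 * (nθ + k ^ 2 * nZ))
    ≤ (Φ + η * ee + 13 * S / η * qq + 10 * g ^ 2 * l / (1 - ρ) * Δ) - k * l / 2 * pp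
      - 10 * g ^ 2 / 4 * l * Δ + k * l * (k * l * h - 1 / 4) * DD + l * (h ^ 2 - g ^ 2) * Δ
      + ((h + 3 * ℓ * g + 13 * S / η) * (k * l) ^ 2 * vZ + η * l ^ 2 * vθ
        + 10 * g ^ 2 * l / (1 - ρ) * l ^ 2 * (nθ + k ^ 2 * nZ)
        + 10 * g ^ 2 * l / (1 - ρ) * (l ^ 2 / (1 - ρ)) * (3 * σθ + k ^ 2 * (7 * σZ))) := by
  have hp : 0 < 1 - ρ := by linarith
  set r := l / (1 - ρ) with hr
  have hr0 : 0 ≤ r := by positivity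
  have hrg : r * g ≤ 25 / 96 := by
    rw [hr, div_mul_eq_mul_div, div_le_iff₀ hp]; exact hlg
  have hlr : l = r * (1 - ρ) := by rw [hr]; field_simp
  have hk16 : k ≤ 1 / 16 := by
    have : 1 ≤ ℓ ^ 2 := one_le_pow₀ hℓ
    nlinarith
  have hlg' : l * g ≤ 25 / 96 := by nlinarith
  have c1 := direction_coeff_le hk hl hℓ hkℓ hlg'
  have c2 := consensus_coeff_le (h := h) hk hk16 hl hg hL hLg hr0 hrg
  have c3 := filter_coeff_le hl hη hS hkℓ
  have c4 := tracking_coeff_le hl hS hkℓ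
  have m1 := mul_le_mul_of_nonneg_right c1 hDD
  have m2 := mul_le_mul_of_nonneg_right c2 hΔ
  have m3 := mul_le_mul_of_nonneg_right c3 hqq
  have m4 := mul_le_mul_of_nonneg_right c4 hee
  have m5 := mul_le_mul_of_nonneg_left hpD (by positivity : 0 ≤ k * l / 2)
  have hw : 10 * g ^ 2 * l / (1 - ρ) = 10 * g ^ 2 * r := by rw [hr]; ring
  have hw2 : l ^ 2 / (1 - ρ) = l * r := by rw [hr]; ring
  have m6 := mul_le_mul_of_nonneg_left (add_le_add hdθ (mul_le_mul_of_nonneg_left hdZ (sq_nonneg k)))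
    (by positivity : 0 ≤ 10 * g ^ 2 * r * (l * r))
  have e1 : η * (l / η * (3 * (4 * S * qq + L₂ ^ 2 * Δ + ℓ ^ 2 * k ^ 2 * DD)))
      = l * (3 * (4 * S * qq + L₂ ^ 2 * Δ + ℓ ^ 2 * k ^ 2 * DD)) := by field_simp
  have e2 : 10 * g ^ 2 * r * (ρ * Δ) = 10 * g ^ 2 * r * Δ - 10 * g ^ 2 * l * Δ := by
    linear_combination (10 * g ^ 2 * Δ) * hlr
  rw [hw, hw2]
  linarith

/-! ### The expected decrease of the Lyapunov function -/

section OneStep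

variable {n dx dy : ℕ} {Ξf : Type u} {Ξg : Type v} [MeasurableSpace Ξf] [MeasurableSpace Ξg]
  {Ω : Type w} [MeasurableSpace Ω] {Pr : Measure Ω} [IsProbabilityMeasure Pr]

/-- The Lyapunov function of a state together with the filtered noise. -/
def lyap (P : Problem n dx dy Ξf Ξg) (c : Params) (Flow μ w : ℝ)
    (p : State n dx dy × Joint dx dy) : ℝ :=
  P.Phi c.γ Flow μ p.1.mean + c.eta * ‖avg p.1.θ - P.prox c.γ (p.1.mean + p.2)‖ ^ 2
    + c.kq * ‖p.2‖ ^ 2 + w * p.1.consensusError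

/-- One iteration for the state and the filtered noise. The sum of the averaged iterate and the
filtered noise moves without noise. -/
def augStep (P : Problem n dx dy Ξf Ξg) (W : Matrix (Fin n) (Fin n) ℝ) (c : Params) (μ l : ℝ)
    (ξ : Fin n → Ξf × Ξg) (p : State n dx dy × Joint dx dy) : State n dx dy × Joint dx dy :=
  (step P W c.γ μ l (c.cLam * l) (c.cLam * l) (fun i => (ξ i).1) (fun i => (ξ i).2) p.1,
    (1 - l * c.eta) • p.2 + (c.cLam * l) • amean fun i => noiseZ P μ p.1 i (ξ i))

variable {P : Problem n dx dy Ξf Ξg} {W : Matrix (Fin n) (Fin n) ℝ} {c : Params}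
  {ρ δf δg σf σg Flow : ℝ} {ξf : ℕ → Fin n → Ω → Ξf} {ξg : ℕ → Fin n → Ω → Ξg}

/-- Descent with a polarized inner product: the term of `Φ` linear in the noise has mean zero, and
the smaller parameter `μ'` is reached at no cost. -/
lemma Phi_noise_step (hc : c.Admissible) (hF : IsSmooth P.F c.L₁) (hG : IsSmooth P.G c.L₂)
    (hFlow : ∀ z, Flow ≤ P.F z) {μ μ' : ℝ} (hμ' : 0 ≤ μ') (hμ : μ' ≤ μ) {N : Ω → Joint dx dy}
    {B : ℝ} (hN : IsNoise Pr N B) (z D : Joint dx dy) (a : ℝ) :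
    Integrable (fun ω => P.Phi c.γ Flow μ' (z - a • (D + N ω))) Pr ∧
    ∫ ω, P.Phi c.γ Flow μ' (z - a • (D + N ω)) ∂Pr
      ≤ P.Phi c.γ Flow μ z
        - a / 2 * (‖gradPsi P c.γ μ z‖ ^ 2 + ‖D‖ ^ 2 - ‖gradPsi P c.γ μ z - D‖ ^ 2)
        + c.curv μ * a ^ 2 * (‖D‖ ^ 2 + B) := by
  have hμ0 := hμ'.trans hμ
  have hQ := hc.curv_pos hμ0
  set p := gradPsi P c.γ μ z
  have hNi : Integrable N Pr := hN.memLp.integrable (by norm_num)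
  have hpt : ∀ ω, P.Phi c.γ Flow μ' (z - a • (D + N ω)) ≤ P.Phi c.γ Flow μ z - a * inner ℝ p D
      - a * inner ℝ p (N ω) + c.curv μ * a ^ 2 * ‖D + N ω‖ ^ 2 := by
    intro ω
    refine (Phi_antitone hμ hFlow _).trans ((Phi_le hc hF hG hμ0 z _).trans (le_of_eq ?_))
    rw [sub_sub_cancel_left, inner_neg_right, norm_neg, norm_smul, real_inner_smul_right,
      inner_add_right, mul_pow, Real.norm_eq_abs, sq_abs]
    ring
  have i1 : Integrable (fun ω => P.Phi c.γ Flow μ z - a * inner ℝ p D - a * inner ℝ p (N ω)) Pr :=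
    (integrable_const _).sub ((hNi.const_inner p).const_mul a)
  have i2 : Integrable (fun ω => c.curv μ * a ^ 2 * ‖D + N ω‖ ^ 2) Pr :=
    (integrable_norm_add_sq hN.memLp D).const_mul _
  have hcont : Continuous fun v => P.Phi c.γ Flow μ' (z - a • (D + v)) := by
    simp_rw [Phi_eq]
    exact ((continuous_Psi hc hF hG hμ').comp (continuous_const.sub
      ((continuous_const.add continuous_id).const_smul a))).sub continuous_const
  -- Nonnegativity of `Φ` turns the pointwise upper bound into a domination.
  have hint : Integrable (fun ω => P.Phi c.γ Flow μ' (z - a • (D + N ω))) Pr := by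
    refine (i1.add i2).mono' (hcont.comp_aestronglyMeasurable hN.memLp.1)
      (Filter.Eventually.of_forall fun ω => ?_)
    rw [Real.norm_eq_abs, abs_of_nonneg (Phi_nonneg hc hG hμ' hFlow _)]
    exact hpt ω
  refine ⟨hint, (integral_mono hint (i1.add i2) hpt).trans ?_⟩
  have e1 : ∫ ω, (P.Phi c.γ Flow μ z - a * inner ℝ p D - a * inner ℝ p (N ω)) ∂Pr
      = P.Phi c.γ Flow μ z - a * inner ℝ p D := by
    rw [integral_sub (integrable_const _) ((hNi.const_inner p).const_mul a), integral_const_mul,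
      integral_inner hNi, hN.mean_zero]
    simp
  rw [integral_add' i1 i2, e1, integral_const_mul, integral_norm_add_sq hN.memLp hN.mean_zero]
  have h1 := norm_sub_sq_real p D
  have h2 := mul_le_mul_of_nonneg_left hN.moment (by positivity : 0 ≤ c.curv μ * a ^ 2)
  rw [h1]
  linarith

/-- The target moves from `z̄ + q` to a point which involves no noise, at distance at most `l (c_λ
‖D‖ + η ‖q‖)`. The term `slope ‖q‖` occurs twice: once because the `θ` step aims at `z̄` instead of
`z̄ + q`, once because the filter decays (`lip η = slope`). -/
lemma norm_theta_target_sq_le (hc : c.Admissible)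
    (hA : Assumptions P W c.L₁ c.L₂ ρ δf δg σf σg Flow) (hn : 0 < n) {l : ℝ} (hl : 0 ≤ l)
    (hlγ : l * (1 / c.γ) ≤ 1) (s : State n dx dy) (q D : Joint dx dy) :
    ‖avg s.θ - l • amean (mdTheta P c.γ s)
        - P.prox c.γ (s.mean - (c.cLam * l) • D + (1 - l * c.eta) • q)‖ ^ 2
      ≤ (1 - l * c.eta) * ‖avg s.θ - P.prox c.γ (s.mean + q)‖ ^ 2
        + l / c.eta * (3 * (4 * c.slope ^ 2 * ‖q‖ ^ 2 + c.L₂ ^ 2 * s.consensusError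
          + c.lip ^ 2 * c.cLam ^ 2 * ‖D‖ ^ 2)) := by
  have hη := hc.eta_pos
  have hℓ := hc.lip_pos
  have hL := hc.L₂_pos
  have hk := hc.cLam_pos
  have hs := hc.slope_pos
  have hG := hA.smooth_G hn
  have hle : l * c.eta ≤ 1 := (mul_le_mul_of_nonneg_left hc.eta_lt.le hl).trans hlγ
  set z' := s.mean - (c.cLam * l) • D + (1 - l * c.eta) • q with hz'
  set e := ‖avg s.θ - P.prox c.γ (s.mean + q)‖ with he
  have h1 := norm_theta_step_sub_prox_le hc hA hn hl hlγ s (s.mean + q)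
  rw [add_sub_cancel_left] at h1
  have h2 := norm_prox_sub_le hc hG (s.mean + q) z'
  have h3 : ‖s.mean + q - z'‖ ≤ l * (c.cLam * ‖D‖ + c.eta * ‖q‖) := by
    have : s.mean + q - z' = l • (c.cLam • D + c.eta • q) := by rw [hz']; module
    rw [this, norm_smul, Real.norm_eq_abs, abs_of_nonneg hl]
    refine mul_le_mul_of_nonneg_left ((norm_add_le _ _).trans (le_of_eq ?_)) hl
    rw [norm_smul, norm_smul, Real.norm_eq_abs, Real.norm_eq_abs, abs_of_pos hk, abs_of_pos hη]
  set B := 2 * c.slope * ‖q‖ + c.L₂ * √s.consensusError + c.lip * c.cLam * ‖D‖ with hB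
  have h4 : ‖avg s.θ - l • amean (mdTheta P c.γ s) - P.prox c.γ z'‖ ≤ (1 - l * c.eta) * e + l * B := by
    have h5 : avg s.θ - l • amean (mdTheta P c.γ s) - P.prox c.γ z'
        = (avg s.θ - l • amean (mdTheta P c.γ s) - P.prox c.γ (s.mean + q))
          + (P.prox c.γ (s.mean + q) - P.prox c.γ z') := by abel
    rw [h5]
    refine (norm_add_le _ _).trans ?_
    have h6 := h2.trans (mul_le_mul_of_nonneg_left h3 hℓ.le)
    have h7 : c.lip * (l * (c.cLam * ‖D‖ + c.eta * ‖q‖))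
        = l * (c.lip * c.cLam * ‖D‖ + c.slope * ‖q‖) := by
      rw [← hc.lip_mul_eta]; ring
    rw [h7] at h6
    have h8 := add_le_add h1 h6
    refine h8.trans (le_of_eq ?_)
    rw [hB]; ring
  have hB3 : B ^ 2 ≤ 3 * (4 * c.slope ^ 2 * ‖q‖ ^ 2 + c.L₂ ^ 2 * s.consensusError
      + c.lip ^ 2 * c.cLam ^ 2 * ‖D‖ ^ 2) := by
    have h := norm_add_sq_le_three (2 * c.slope * ‖q‖) (c.L₂ * √s.consensusError)
      (c.lip * c.cLam * ‖D‖)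
    simp only [Real.norm_eq_abs, sq_abs] at h
    rw [← hB, mul_pow c.L₂, Real.sq_sqrt s.consensusError_nonneg] at h
    refine h.trans (le_of_eq ?_)
    ring
  -- Convexity of the square for the weights `1 - lη` and `lη` at the points `e` and `B / η`.
  have h5 : ((1 - l * c.eta) * e + l * B) ^ 2 ≤ (1 - l * c.eta) * e ^ 2 + l / c.eta * B ^ 2 := by
    have h6 : (1 - l * c.eta) * e ^ 2 + l / c.eta * B ^ 2 - ((1 - l * c.eta) * e + l * B) ^ 2
        = (1 - l * c.eta) * (l * c.eta) * (e - B / c.eta) ^ 2 := by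
      field_simp; ring
    have h7 : 0 ≤ (1 - l * c.eta) * (l * c.eta) * (e - B / c.eta) ^ 2 :=
      mul_nonneg (mul_nonneg (by linarith) (by positivity)) (sq_nonneg _)
    linarith
  refine (pow_le_pow_left₀ (norm_nonneg _) h4 2).trans (h5.trans ?_)
  have := mul_le_mul_of_nonneg_left hB3 (by positivity : 0 ≤ l / c.eta)
  linarith

lemma consensus_noise_step (hA : Assumptions P W c.L₁ c.L₂ ρ δf δg σf σg Flow)
    (hS : Sampling P Pr ξf ξg) (hn : 0 < n) (k : ℕ) (μ l : ℝ) (s : State n dx dy) :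
    Integrable (fun ω => (step P W c.γ μ l (c.cLam * l) (c.cLam * l) (fun i => ξf k i ω)
      (fun i => ξg k i ω) s).consensusError) Pr ∧
    ∫ ω, (step P W c.γ μ l (c.cLam * l) (c.cLam * l) (fun i => ξf k i ω)
      (fun i => ξg k i ω) s).consensusError ∂Pr
      ≤ (ρ * s.consensusError
          + l ^ 2 / (1 - ρ) * (dev (mdTheta P c.γ s) + c.cLam ^ 2 * dev (mdZ P c.γ μ s)))
        + l ^ 2 * (δg ^ 2 + c.cLam ^ 2 * (3 * (μ ^ 2 * δf ^ 2 + 2 * δg ^ 2))) := by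
  have hW := hA.network
  have hθ := fun i => isNoise_noiseTheta hA hS k i s
  have hz := fun i => isNoise_noiseZ hA hS k i μ s
  have hpt : ∀ ω, (step P W c.γ μ l (c.cLam * l) (c.cLam * l) (fun i => ξf k i ω)
      (fun i => ξg k i ω) s).consensusError
      = dev (fun i => ∑ j, W i j • (s.z j - (c.cLam * l) • (mdZ P c.γ μ s j
          + noiseZ P μ s j (ξf k j ω, ξg k j ω))))
        + dev (fun i => ∑ j, W i j • (s.θ j - l • (mdTheta P c.γ s j
          + noiseTheta P s j (ξg k j ω)))) := by
    intro ω
    rw [State.consensusError_eq]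
    congr 1
    · congr 1; ext1 i; exact step_z P c.γ μ l (c.cLam * l) _ _ s i
    · congr 1; ext1 i; exact step_theta P c.γ μ l (c.cLam * l) _ _ s i
  have i1 := integrable_dev fun i => memLp_gossip (W := W) s.z (mdZ P c.γ μ s)
    (fun i => (hz i).memLp) (c.cLam * l) i
  have i2 := integrable_dev fun i => memLp_gossip (W := W) s.θ (mdTheta P c.γ s)
    (fun i => (hθ i).memLp) l i
  simp_rw [hpt]
  refine ⟨i1.add i2, ?_⟩
  rw [integral_add i1 i2, s.consensusError_eq]
  have h1 := hW.integral_dev_gossip_le hn s.z (mdZ P c.γ μ s) (fun i => (hz i).memLp)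
    (fun i => (hz i).mean_zero) (fun i => (hz i).moment) (c.cLam * l)
  have h2 := hW.integral_dev_gossip_le hn s.θ (mdTheta P c.γ s) (fun i => (hθ i).memLp)
    (fun i => (hθ i).mean_zero) (fun i => (hθ i).moment) l
  refine (add_le_add h1 h2).trans (le_of_eq ?_)
  ring

/-- A constant in front of the noise terms. -/
def Params.noiseC (c : Params) : ℝ :=
  (c.curv c.μ₀ + c.kq) * c.cLam ^ 2 * (3 * (c.μ₀ ^ 2 + 2)) + c.eta
    + c.kd * (1 + c.cLam ^ 2 * (3 * (c.μ₀ ^ 2 + 2))) + c.kd * (3 + c.cLam ^ 2 * (7 * (c.μ₀ ^ 2 + 2)))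

lemma Params.Admissible.noiseC_pos (hc : c.Admissible) : 0 < c.noiseC := by
  have h1 := hc.curv_pos hc.μ₀_pos.le
  have h2 := hc.kq_pos; have h3 := hc.kd_pos; have h4 := hc.eta_pos
  unfold Params.noiseC; positivity

lemma noise_terms_le (hc : c.Admissible) (hn : 0 < n) {l μ : ℝ} (hl : 0 ≤ l) (hρ : ρ < 1)
    (hμ : 0 ≤ μ) (hμ0 : μ ≤ c.μ₀) :
    (c.curv μ + c.kq) * (c.cLam * l) ^ 2 * (3 * (μ ^ 2 * δf ^ 2 + 2 * δg ^ 2) / n)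
      + c.eta * l ^ 2 * (δg ^ 2 / n)
      + c.kd * l / (1 - ρ) * l ^ 2
        * (δg ^ 2 + c.cLam ^ 2 * (3 * (μ ^ 2 * δf ^ 2 + 2 * δg ^ 2)))
      + c.kd * l / (1 - ρ) * (l ^ 2 / (1 - ρ))
        * (3 * σg ^ 2 + c.cLam ^ 2 * (7 * (μ ^ 2 * σf ^ 2 + 2 * σg ^ 2)))
    ≤ c.noiseC * (l ^ 2 * (δf ^ 2 + δg ^ 2) / n + l ^ 3 * (δf ^ 2 + δg ^ 2) / (1 - ρ)
        + l ^ 3 * (σf ^ 2 + σg ^ 2) / (1 - ρ) ^ 2) := by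
  have hp : 0 < 1 - ρ := by linarith
  have hL := hc.L₁_pos
  have h1 := hc.curv_pos hc.μ₀_pos.le
  have h1' := hc.curv_pos hμ
  have h2 := hc.kq_pos
  have h3 := hc.kd_pos
  have h4 := hc.eta_pos
  have hn' : (0 : ℝ) < n := by positivity
  have hμ2 : μ ^ 2 ≤ c.μ₀ ^ 2 := pow_le_pow_left₀ hμ hμ0 2
  have hcurv : c.curv μ ≤ c.curv c.μ₀ := by
    unfold Params.curv
    have := mul_le_mul_of_nonneg_right hμ0 hL.le
    linarith
  have hδ : ∀ a b : ℝ, μ ^ 2 * a ^ 2 + 2 * b ^ 2 ≤ (c.μ₀ ^ 2 + 2) * (a ^ 2 + b ^ 2) := by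
    intro a b
    have := mul_le_mul_of_nonneg_right hμ2 (sq_nonneg a)
    nlinarith [sq_nonneg a, sq_nonneg b, mul_nonneg (sq_nonneg c.μ₀) (sq_nonneg b)]
  set d := δf ^ 2 + δg ^ 2 with hd
  set σ := σf ^ 2 + σg ^ 2 with hσ
  have hd0 : 0 ≤ d := by positivity
  have hσ0 : 0 ≤ σ := by positivity
  have hdg : δg ^ 2 ≤ d := le_add_of_nonneg_left (sq_nonneg _)
  have hσg : σg ^ 2 ≤ σ := le_add_of_nonneg_left (sq_nonneg _)
  set m := c.μ₀ ^ 2 + 2 with hm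
  have hm0 : 0 < m := by positivity
  set x := l ^ 2 * d / n with hx
  set y := l ^ 3 * d / (1 - ρ) with hy
  set t := l ^ 3 * σ / (1 - ρ) ^ 2 with ht
  have hx0 : 0 ≤ x := by positivity
  have hy0 : 0 ≤ y := by positivity
  have ht0 : 0 ≤ t := by positivity
  have a1 : (c.curv μ + c.kq) * (c.cLam * l) ^ 2 * (3 * (μ ^ 2 * δf ^ 2 + 2 * δg ^ 2) / n)
      ≤ (c.curv c.μ₀ + c.kq) * c.cLam ^ 2 * (3 * m) * x := by
    calc _ ≤ (c.curv c.μ₀ + c.kq) * (c.cLam * l) ^ 2 * (3 * (m * d) / n) := by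
          gcongr
          exact hδ δf δg
      _ = _ := by rw [hx]; ring
  have a2 : c.eta * l ^ 2 * (δg ^ 2 / n) ≤ c.eta * x := by
    calc _ ≤ c.eta * l ^ 2 * (d / n) := by gcongr
      _ = _ := by rw [hx]; ring
  have a3 : c.kd * l / (1 - ρ) * l ^ 2
        * (δg ^ 2 + c.cLam ^ 2 * (3 * (μ ^ 2 * δf ^ 2 + 2 * δg ^ 2)))
      ≤ c.kd * (1 + c.cLam ^ 2 * (3 * m)) * y := by
    calc _ ≤ c.kd * l / (1 - ρ) * l ^ 2 * (d + c.cLam ^ 2 * (3 * (m * d))) := by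
          gcongr
          exact hδ δf δg
      _ = _ := by rw [hy]; ring
  have a4 : c.kd * l / (1 - ρ) * (l ^ 2 / (1 - ρ))
        * (3 * σg ^ 2 + c.cLam ^ 2 * (7 * (μ ^ 2 * σf ^ 2 + 2 * σg ^ 2)))
      ≤ c.kd * (3 + c.cLam ^ 2 * (7 * m)) * t := by
    calc _ ≤ c.kd * l / (1 - ρ) * (l ^ 2 / (1 - ρ)) * (3 * σ + c.cLam ^ 2 * (7 * (m * σ))) := by
          gcongr
          exact hδ σf σg
      _ = _ := by rw [ht]; field_simp
  have b1 : 0 ≤ (c.curv c.μ₀ + c.kq) * c.cLam ^ 2 * (3 * m) := by positivity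
  have b3 : 0 ≤ c.kd * (1 + c.cLam ^ 2 * (3 * m)) := by positivity
  have b4 : 0 ≤ c.kd * (3 + c.cLam ^ 2 * (7 * m)) := by positivity
  have c1 := mul_nonneg b1 (add_nonneg hy0 ht0)
  have c2 := mul_nonneg h4.le (add_nonneg hy0 ht0)
  have c3 := mul_nonneg b3 (add_nonneg hx0 ht0)
  have c4 := mul_nonneg b4 (add_nonneg hx0 hy0)
  unfold Params.noiseC
  rw [← hm]
  linarith

/-- The state and the filter are fixed and only the new samples are random, so all errors of the
directions are centred. The two terms with no definite sign are kept for `residual_le_growthAt_mul`.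
-/
theorem lyap_one_step (hc : c.Admissible) (hA : Assumptions P W c.L₁ c.L₂ ρ δf δg σf σg Flow)
    (hS : Sampling P Pr ξf ξg) (hn : 0 < n) {l μ μ' : ℝ} (hl : 0 ≤ l)
    (hlg : l * (1 / c.γ) ≤ 25 / 96 * (1 - ρ)) (hμ' : 0 ≤ μ') (hμ : μ' ≤ μ) (hμ0 : μ ≤ c.μ₀)
    (k : ℕ) (p : State n dx dy × Joint dx dy) :
    Integrable (fun ω => lyap P c Flow μ' (c.kd * l / (1 - ρ))
      (augStep P W c μ l (fun i => (ξf k i ω, ξg k i ω)) p)) Pr ∧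
    ∫ ω, lyap P c Flow μ' (c.kd * l / (1 - ρ))
      (augStep P W c μ l (fun i => (ξf k i ω, ξg k i ω)) p) ∂Pr
    ≤ lyap P c Flow μ (c.kd * l / (1 - ρ)) p
      - c.cLam * l / 2 * ‖gradPsi P c.γ μ p.1.mean‖ ^ 2
      - c.kd / 4 * l * p.1.consensusError
      + c.cLam * l * (c.cLam * l * (μ * c.L₁) - 1 / 4) * ‖amean (mdZ P c.γ μ p.1)‖ ^ 2
      + l * ((μ * c.L₁) ^ 2 - (1 / c.γ) ^ 2) * p.1.consensusError
      + c.noiseC * (l ^ 2 * (δf ^ 2 + δg ^ 2) / n + l ^ 3 * (δf ^ 2 + δg ^ 2) / (1 - ρ)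
        + l ^ 3 * (σf ^ 2 + σg ^ 2) / (1 - ρ) ^ 2) := by
  obtain ⟨s, q⟩ := p
  have hW := hA.network
  have hρ := hW.rho_lt_one
  have hρ0 := hW.rho_nonneg
  have hp : 0 < 1 - ρ := by linarith
  have hF := hA.smooth_F hn
  have hG := hA.smooth_G hn
  have hη := hc.eta_pos
  have hg := hc.inv_γ_pos
  have hlγ : l * (1 / c.γ) ≤ 1 := by linarith
  have hle : l * c.eta ≤ 1 := (mul_le_mul_of_nonneg_left hc.eta_lt.le hl).trans hlγ
  set w := c.kd * l / (1 - ρ) with hw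
  have hw0 : 0 ≤ w := by have := hc.kd_pos; positivity
  set D := amean (mdZ P c.γ μ s) with hD
  have hNz := isNoise_amean_noiseZ hA hS hn k μ s
  have hNθ := isNoise_amean_noiseTheta hA hS hn k s
  set Nz : Ω → Joint dx dy := fun ω => amean fun i => noiseZ P μ s i (ξf k i ω, ξg k i ω) with hNzd
  set Nθ : Ω → Vec dy := fun ω => amean fun i => noiseTheta P s i (ξg k i ω) with hNθd
  obtain ⟨iΦ, bΦ⟩ := Phi_noise_step hc hF hG hA.lower_bound hμ' hμ hNz s.mean D (c.cLam * l)
  obtain ⟨iC, bC⟩ := consensus_noise_step hA hS hn k μ l s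
  set m := avg s.θ - l • amean (mdTheta P c.γ s)
    - P.prox c.γ (s.mean - (c.cLam * l) • D + (1 - l * c.eta) • q) with hm
  have iθ := integrable_norm_add_sq (hNθ.memLp.const_smul (-l)) m
  have eθ := integral_norm_add_sq (hNθ.memLp.const_smul (-l))
    (by simp only [Pi.smul_apply]; rw [integral_smul, hNθ.mean_zero, smul_zero]) m
  have iq := integrable_norm_add_sq (hNz.memLp.const_smul (c.cLam * l)) ((1 - l * c.eta) • q)
  have eq := integral_norm_add_sq (hNz.memLp.const_smul (c.cLam * l))
    (by simp only [Pi.smul_apply]; rw [integral_smul, hNz.mean_zero, smul_zero])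
    ((1 - l * c.eta) • q)
  simp only [Pi.smul_apply] at iθ eθ iq eq
  rw [integral_norm_smul_sq] at eθ eq
  have hpt : ∀ ω, lyap P c Flow μ' w (augStep P W c μ l (fun i => (ξf k i ω, ξg k i ω)) (s, q))
      = P.Phi c.γ Flow μ' (s.mean - (c.cLam * l) • (D + Nz ω))
        + c.eta * ‖m + -l • Nθ ω‖ ^ 2
        + c.kq * ‖(1 - l * c.eta) • q + (c.cLam * l) • Nz ω‖ ^ 2
        + w * (step P W c.γ μ l (c.cLam * l) (c.cLam * l) (fun i => ξf k i ω)
            (fun i => ξg k i ω) s).consensusError := by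
    intro ω
    have h1 := mean_step P hW c.γ μ l (c.cLam * l) (fun i => ξf k i ω) (fun i => ξg k i ω) s
    have h2 := avg_step_theta P hW c.γ μ l (c.cLam * l) (fun i => ξf k i ω) (fun i => ξg k i ω) s
    simp only [lyap, augStep]
    rw [h1, h2]
    -- The cancellation for which the filter is designed: the new target point does not depend on
    -- `ω`.
    have h3 : s.mean - (c.cLam * l) • (D + Nz ω)
        + ((1 - l * c.eta) • q + (c.cLam * l) • Nz ω)
        = s.mean - (c.cLam * l) • D + (1 - l * c.eta) • q := by module
    have h4 : avg s.θ - l • (amean (mdTheta P c.γ s) + Nθ ω)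
        - P.prox c.γ (s.mean - (c.cLam * l) • D + (1 - l * c.eta) • q) = m + -l • Nθ ω := by
      rw [hm]; module
    rw [h3, h4]
  simp_rw [hpt]
  have i1 := iθ.const_mul c.eta
  have i2 := iq.const_mul c.kq
  have i3 := iC.const_mul w
  refine ⟨((iΦ.add i1).add i2).add i3, ?_⟩
  have j1 : Integrable (fun ω => P.Phi c.γ Flow μ' (s.mean - (c.cLam * l) • (D + Nz ω))
        + c.eta * ‖m + -l • Nθ ω‖ ^ 2) Pr := iΦ.add i1
  have j2 : Integrable (fun ω => P.Phi c.γ Flow μ' (s.mean - (c.cLam * l) • (D + Nz ω))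
        + c.eta * ‖m + -l • Nθ ω‖ ^ 2
        + c.kq * ‖(1 - l * c.eta) • q + (c.cLam * l) • Nz ω‖ ^ 2) Pr := j1.add i2
  rw [integral_add j2 i3, integral_add j1 i2, integral_add iΦ i1, integral_const_mul,
    integral_const_mul, integral_const_mul, eθ, eq, neg_sq]
  have tm := norm_theta_target_sq_le hc hA hn hl hlγ s q D
  have tθ : c.eta * (‖m‖ ^ 2 + l ^ 2 * ∫ ω, ‖Nθ ω‖ ^ 2 ∂Pr)
      ≤ c.eta * ((1 - l * c.eta) * ‖avg s.θ - P.prox c.γ (s.mean + q)‖ ^ 2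
        + l / c.eta * (3 * (4 * c.slope ^ 2 * ‖q‖ ^ 2 + c.L₂ ^ 2 * s.consensusError
          + c.lip ^ 2 * c.cLam ^ 2 * ‖D‖ ^ 2)) + l ^ 2 * (δg ^ 2 / n)) :=
    mul_le_mul_of_nonneg_left (add_le_add tm
      (mul_le_mul_of_nonneg_left hNθ.moment (sq_nonneg l))) hη.le
  have tq : c.kq * (‖(1 - l * c.eta) • q‖ ^ 2 + (c.cLam * l) ^ 2 * ∫ ω, ‖Nz ω‖ ^ 2 ∂Pr)
      ≤ c.kq * ((1 - l * c.eta) * ‖q‖ ^ 2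
        + (c.cLam * l) ^ 2 * (3 * (μ ^ 2 * δf ^ 2 + 2 * δg ^ 2) / n)) := by
    refine mul_le_mul_of_nonneg_left (add_le_add ?_
      (mul_le_mul_of_nonneg_left hNz.moment (sq_nonneg _))) hc.kq_pos.le
    rw [norm_smul, mul_pow, Real.norm_eq_abs, sq_abs]
    refine mul_le_mul_of_nonneg_right ?_ (sq_nonneg _)
    have : 0 ≤ l * c.eta := by positivity
    nlinarith
  have tC := mul_le_mul_of_nonneg_left bC hw0
  have hpD := norm_gradPsi_sub_amean_mdZ_le hA hn μ s
  have he0 : ‖avg s.θ - P.prox c.γ s.mean‖ ^ 2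
      ≤ 2 * (‖avg s.θ - P.prox c.γ (s.mean + q)‖ ^ 2 + c.lip ^ 2 * ‖q‖ ^ 2) := by
    have h1 := norm_add_sq_le_two (avg s.θ - P.prox c.γ (s.mean + q))
      (P.prox c.γ (s.mean + q) - P.prox c.γ s.mean)
    rw [sub_add_sub_cancel] at h1
    have h2 := pow_le_pow_left₀ (norm_nonneg _) (norm_prox_sub_le hc hG (s.mean + q) s.mean) 2
    rw [add_sub_cancel_left, mul_pow] at h2
    linarith
  have hpD' : ‖gradPsi P c.γ μ s.mean - D‖ ^ 2
      ≤ 2 * c.slope ^ 2 * (2 * (‖avg s.θ - P.prox c.γ (s.mean + q)‖ ^ 2 + c.lip ^ 2 * ‖q‖ ^ 2))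
        + 6 * ((μ * c.L₁) ^ 2 + 2 * c.L₂ ^ 2) * s.consensusError := by
    have := mul_le_mul_of_nonneg_left he0 (by positivity : 0 ≤ 2 * c.slope ^ 2)
    rw [mul_pow]
    linarith
  have hdZ := dev_mdZ_le (c := c) hA hn μ s
  rw [← mul_pow] at hdZ
  have hS2 : c.slope ^ 2 = c.lip ^ 2 * c.eta ^ 2 := by rw [← hc.lip_mul_eta, mul_pow]
  have harith := lyapunov_arith (Φ := P.Phi c.γ Flow μ s.mean)
    (pp := ‖gradPsi P c.γ μ s.mean‖ ^ 2) (vZ := 3 * (μ ^ 2 * δf ^ 2 + 2 * δg ^ 2) / n)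
    (vθ := δg ^ 2 / n) (nθ := δg ^ 2) (nZ := 3 * (μ ^ 2 * δf ^ 2 + 2 * δg ^ 2))
    hc.cLam_pos hl hρ0 hρ hg hc.L₂_pos hc.two_L₂_lt hη hc.one_le_lip hS2 hc.cLam_mul_lip_sq_le hlg
    (sq_nonneg ‖D‖) (sq_nonneg ‖avg s.θ - P.prox c.γ (s.mean + q)‖) (sq_nonneg ‖q‖)
    s.consensusError_nonneg hpD' (dev_mdTheta_le hA hn s) hdZ
  have hnoise := noise_terms_le (δf := δf) (δg := δg) (σf := σf) (σg := σg) hc hn hl hρ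
    (hμ'.trans hμ) hμ0
  have hcurv : μ * c.L₁ + 3 * c.lip * (1 / c.γ) = c.curv μ := rfl
  have hkq : 13 * c.slope ^ 2 / c.eta = c.kq := rfl
  have hkd : 10 * (1 / c.γ) ^ 2 = c.kd := rfl
  rw [hcurv, hkq, hkd, ← hw] at harith
  rw [← hw] at hnoise
  simp only [lyap]
  linarith

end OneStep

/-! ### Integration along independent samples -/

section Independence

variable {Ω : Type*} [MeasurableSpace Ω] {Pr : Measure Ω} [IsProbabilityMeasure Pr]
  {S T : Type*} [MeasurableSpace S] [MeasurableSpace T]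

/-- A conditional expectation argument in the form of Fubini's theorem: the joint law is a product,
so a bound for each frozen `x` integrates. Nonnegativity of `H` gives joint integrability from that
of `U`. -/
lemma integral_le_of_indepFun {X : Ω → S} {Y : Ω → T} (hX : Measurable X) (hY : Measurable Y)
    (hXY : IndepFun X Y Pr) {H : S × T → ℝ} (hH : Measurable H) (hH0 : ∀ p, 0 ≤ H p) {U : S → ℝ}
    (hU : Measurable U) (hUi : Integrable (fun ω => U (X ω)) Pr)
    (hHi : ∀ x, Integrable (fun ω => H (x, Y ω)) Pr) (hHU : ∀ x, ∫ ω, H (x, Y ω) ∂Pr ≤ U x) :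
    Integrable (fun ω => H (X ω, Y ω)) Pr ∧ ∫ ω, H (X ω, Y ω) ∂Pr ≤ ∫ ω, U (X ω) ∂Pr := by
  have hmap := (indepFun_iff_map_prod_eq_prod_map_map hX.aemeasurable hY.aemeasurable).1 hXY
  have := Measure.isProbabilityMeasure_map (μ := Pr) hX.aemeasurable
  have := Measure.isProbabilityMeasure_map (μ := Pr) hY.aemeasurable
  have hsec : ∀ x, Measurable fun y => H (x, y) := fun x => hH.comp measurable_prodMk_left
  have hmapY : ∀ x, ∫ y, H (x, y) ∂(Pr.map Y) = ∫ ω, H (x, Y ω) ∂Pr := fun x =>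
    integral_map hY.aemeasurable (hsec x).aestronglyMeasurable
  have hUmap : Integrable U (Pr.map X) :=
    (integrable_map_measure hU.aestronglyMeasurable hX.aemeasurable).2 hUi
  have hprod : Integrable H ((Pr.map X).prod (Pr.map Y)) := by
    rw [integrable_prod_iff hH.aestronglyMeasurable]
    constructor
    · refine Filter.Eventually.of_forall fun x => ?_
      exact (integrable_map_measure (hsec x).aestronglyMeasurable hY.aemeasurable).2 (hHi x)
    · refine hUmap.mono' (hH.norm.stronglyMeasurable.integral_prod_right'
        (ν := Pr.map Y)).aestronglyMeasurable (Filter.Eventually.of_forall fun x => ?_)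
      simp only [Real.norm_of_nonneg (hH0 _)]
      rw [Real.norm_of_nonneg (integral_nonneg fun y => hH0 _), hmapY]
      exact hHU x
  have hpair : Measurable fun ω => (X ω, Y ω) := hX.prodMk hY
  constructor
  · rw [← hmap] at hprod
    exact (integrable_map_measure hH.aestronglyMeasurable hpair.aemeasurable).1 hprod
  · have h1 : ∫ ω, H (X ω, Y ω) ∂Pr = ∫ x, ∫ y, H (x, y) ∂(Pr.map Y) ∂(Pr.map X) := by
      rw [← integral_prod _ hprod, ← hmap, integral_map hpair.aemeasurable hH.aestronglyMeasurable]
    have h2 : ∫ ω, U (X ω) ∂Pr = ∫ x, U x ∂(Pr.map X) :=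
      (integral_map hX.aemeasurable hU.aestronglyMeasurable).symm
    rw [h1, h2]
    refine integral_mono hprod.integral_prod_left hUmap fun x => ?_
    simp only [hmapY]
    exact hHU x

end Independence

/-! ### Measurability of the iterates -/

section Measurability

variable {n dx dy : ℕ}

instance : MeasurableSpace (State n dx dy) :=
  MeasurableSpace.comap (fun s => (s.θ, s.x, s.y)) inferInstance

lemma measurable_state_tuple :
    Measurable fun s : State n dx dy => (s.θ, s.x, s.y) := comap_measurable _

lemma measurable_state_theta (i : Fin n) : Measurable fun s : State n dx dy => s.θ i :=
  (measurable_pi_apply i).comp measurable_state_tuple.fst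

lemma measurable_state_x (i : Fin n) : Measurable fun s : State n dx dy => s.x i :=
  (measurable_pi_apply i).comp measurable_state_tuple.snd.fst

lemma measurable_state_y (i : Fin n) : Measurable fun s : State n dx dy => s.y i :=
  (measurable_pi_apply i).comp measurable_state_tuple.snd.snd

lemma measurable_state_mk {α : Type*} [MeasurableSpace α] {f : α → State n dx dy}
    (hθ : ∀ i, Measurable fun a => (f a).θ i) (hx : ∀ i, Measurable fun a => (f a).x i)
    (hy : ∀ i, Measurable fun a => (f a).y i) : Measurable f :=
  measurable_comap_iff.2
    ((measurable_pi_lambda _ hθ).prodMk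
      ((measurable_pi_lambda _ hx).prodMk (measurable_pi_lambda _ hy)))

lemma measurable_pair {α : Type*} [MeasurableSpace α] {f : α → Vec dx} {g : α → Vec dy}
    (hf : Measurable f) (hg : Measurable g) : Measurable fun a => pair (f a) (g a) :=
  continuous_pair.measurable.comp (hf.prodMk hg)

lemma measurable_joint_fst {α : Type*} [MeasurableSpace α] {f : α → Joint dx dy}
    (hf : Measurable f) : Measurable fun a => (f a).fst :=
  (WithLp.fstL 2 ℝ (Vec dx) (Vec dy)).continuous.measurable.comp hf

lemma measurable_joint_snd {α : Type*} [MeasurableSpace α] {f : α → Joint dx dy}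
    (hf : Measurable f) : Measurable fun a => (f a).snd :=
  (WithLp.sndL 2 ℝ (Vec dx) (Vec dy)).continuous.measurable.comp hf

lemma measurable_avg {α : Type*} [MeasurableSpace α] {d : ℕ} {f : α → Fin n → Vec d}
    (hf : ∀ i, Measurable fun a => f a i) : Measurable fun a => avg (f a) :=
  (Finset.measurable_fun_sum Finset.univ fun i _ => hf i).const_smul (n : ℝ)⁻¹

lemma measurable_state_mean : Measurable fun s : State n dx dy => s.mean :=
  measurable_pair (measurable_avg measurable_state_x) (measurable_avg measurable_state_y)

lemma measurable_dev {α : Type*} [MeasurableSpace α] {d : ℕ} {f : α → Fin n → Vec d}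
    (hf : ∀ i, Measurable fun a => f a i) :
    Measurable fun a => (n : ℝ)⁻¹ * ∑ i, ‖f a i - avg (f a)‖ ^ 2 :=
  (Finset.measurable_fun_sum Finset.univ fun i _ =>
    ((hf i).sub (measurable_avg hf)).norm.pow_const 2).const_mul _

lemma measurable_consensusError : Measurable fun s : State n dx dy => s.consensusError :=
  ((measurable_dev measurable_state_x).add (measurable_dev measurable_state_y)).add
    (measurable_dev measurable_state_theta)

variable {Ξf : Type u} {Ξg : Type v} [MeasurableSpace Ξf] [MeasurableSpace Ξg]
  {P : Problem n dx dy Ξf Ξg} {W : Matrix (Fin n) (Fin n) ℝ} {c : Params}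
  {ρ δf δg σf σg Flow : ℝ}

lemma measurable_lyap (hc : c.Admissible) (hA : Assumptions P W c.L₁ c.L₂ ρ δf δg σf σg Flow)
    (hn : 0 < n) {μ : ℝ} (hμ : 0 ≤ μ) (a : ℝ) : Measurable (lyap P c Flow μ a) := by
  have hF := hA.smooth_F hn
  have hG := hA.smooth_G hn
  have hmean : Measurable fun p : State n dx dy × Joint dx dy => p.1.mean :=
    measurable_state_mean.comp measurable_fst
  have hΦ : Measurable fun z => P.Phi c.γ Flow μ z := by
    simp_rw [Phi_eq]
    exact (continuous_Psi hc hF hG hμ).measurable.sub_const _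
  have hprox := (continuous_prox hc hG).measurable
  have hθ : Measurable fun p : State n dx dy × Joint dx dy => avg p.1.θ :=
    (measurable_avg measurable_state_theta).comp measurable_fst
  exact (((hΦ.comp hmean).add (((hθ.sub (hprox.comp (hmean.add measurable_snd))).norm.pow_const
    2).const_mul _)).add ((measurable_snd.norm.pow_const 2).const_mul _)).add
    ((measurable_consensusError.comp measurable_fst).const_mul _)

lemma measurable_augStep (hA : Assumptions P W c.L₁ c.L₂ ρ δf δg σf σg Flow) (μ l : ℝ) :
    Measurable fun a : (State n dx dy × Joint dx dy) × (Fin n → Ξf × Ξg) =>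
      augStep P W c μ l a.2 a.1 := by
  have hs : Measurable fun a : (State n dx dy × Joint dx dy) × (Fin n → Ξf × Ξg) => a.1.1 :=
    measurable_fst.fst
  have hθ : ∀ i, Measurable fun a : (State n dx dy × Joint dx dy) × (Fin n → Ξf × Ξg) => a.1.1.θ i :=
    fun i => (measurable_state_theta i).comp hs
  have hx : ∀ i, Measurable fun a : (State n dx dy × Joint dx dy) × (Fin n → Ξf × Ξg) => a.1.1.x i :=
    fun i => (measurable_state_x i).comp hs
  have hy : ∀ i, Measurable fun a : (State n dx dy × Joint dx dy) × (Fin n → Ξf × Ξg) => a.1.1.y i :=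
    fun i => (measurable_state_y i).comp hs
  have hξ : ∀ i, Measurable fun a : (State n dx dy × Joint dx dy) × (Fin n → Ξf × Ξg) => a.2 i :=
    fun i => (measurable_pi_apply i).comp measurable_snd
  have hz := fun i => measurable_pair (hx i) (hy i)
  have hw := fun i => measurable_pair (hx i) (hθ i)
  have gf := fun i => (hA.oracle_f i).measurable.comp ((hξ i).fst.prodMk (hz i))
  have gg := fun i => (hA.oracle_g i).measurable.comp ((hξ i).snd.prodMk (hz i))
  have gw := fun i => (hA.oracle_g i).measurable.comp ((hξ i).snd.prodMk (hw i))
  have dθ : ∀ i, Measurable fun a : (State n dx dy × Joint dx dy) × (Fin n → Ξf × Ξg) =>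
      dirTheta P c.γ a.1.1 (fun i => (a.2 i).2) i := fun i =>
    (measurable_joint_snd (gw i)).add (((hθ i).sub (hy i)).const_smul (1 / c.γ))
  have dX : ∀ i, Measurable fun a : (State n dx dy × Joint dx dy) × (Fin n → Ξf × Ξg) =>
      dirX P μ a.1.1 (fun i => (a.2 i).1) (fun i => (a.2 i).2) i := fun i =>
    (((measurable_joint_fst (gf i)).const_smul μ).add (measurable_joint_fst (gg i))).sub
      (measurable_joint_fst (gw i))
  have dY : ∀ i, Measurable fun a : (State n dx dy × Joint dx dy) × (Fin n → Ξf × Ξg) =>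
      dirY P c.γ μ a.1.1 (fun i => (a.2 i).1) (fun i => (a.2 i).2) i := fun i =>
    (((measurable_joint_snd (gf i)).const_smul μ).add (measurable_joint_snd (gg i))).sub
      (((hy i).sub (hθ i)).const_smul (1 / c.γ))
  have hnoise : ∀ i, Measurable fun a : (State n dx dy × Joint dx dy) × (Fin n → Ξf × Ξg) =>
      noiseZ P μ a.1.1 i (a.2 i) := by
    intro i
    have g1 := (gf i).sub ((hA.smooth_f i).continuous_gradient.measurable.comp (hz i))
    have g2 := (gg i).sub ((hA.smooth_g i).continuous_gradient.measurable.comp (hz i))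
    have g3 := (gw i).sub ((hA.smooth_g i).continuous_gradient.measurable.comp (hw i))
    exact ((g1.const_smul μ).add g2).sub (measurable_pair (measurable_joint_fst g3) measurable_const)
  refine Measurable.prodMk (measurable_state_mk (fun i => ?_) (fun i => ?_) fun i => ?_) ?_
  · exact Finset.measurable_fun_sum Finset.univ fun j _ =>
      ((hθ j).sub ((dθ j).const_smul l)).const_smul (W i j)
  · exact Finset.measurable_fun_sum Finset.univ fun j _ =>
      ((hx j).sub ((dX j).const_smul (c.cLam * l))).const_smul (W i j)
  · exact Finset.measurable_fun_sum Finset.univ fun j _ =>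
      ((hy j).sub ((dY j).const_smul (c.cLam * l))).const_smul (W i j)
  · exact (measurable_fst.snd.const_smul (1 - l * c.eta)).add
      (((Finset.measurable_fun_sum Finset.univ fun i _ => hnoise i).const_smul
        (n : ℝ)⁻¹).const_smul (c.cLam * l))

/-- The σ-algebra `m` of the source is arbitrary, so that it can be the σ-algebra generated by the
past samples. -/
lemma measurable_augStep_comp {α : Type*} {m : MeasurableSpace α}
    (hA : Assumptions P W c.L₁ c.L₂ ρ δf δg σf σg Flow) (μ l : ℝ)
    {X : α → State n dx dy × Joint dx dy} {Y : α → Fin n → Ξf × Ξg} (hX : Measurable X)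
    (hY : Measurable Y) : Measurable fun a => augStep P W c μ l (Y a) (X a) := by
  have h := measurable_augStep (W := W) (c := c) hA μ l
  generalize hg : (fun a : (State n dx dy × Joint dx dy) × (Fin n → Ξf × Ξg) =>
      augStep P W c μ l a.2 a.1) = g at h
  have h2 : (fun a => augStep P W c μ l (Y a) (X a)) = g ∘ fun a => (X a, Y a) := by
    rw [← hg]; rfl
  rw [h2]
  exact h.comp (hX.prodMk hY)

end Measurability

/-! ### The iterates with the filtered noise -/

section Iterates

variable {n dx dy : ℕ} {Ξf : Type u} {Ξg : Type v} [MeasurableSpace Ξf] [MeasurableSpace Ξg]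
  {Ω : Type w} [MeasurableSpace Ω] {Pr : Measure Ω} [IsProbabilityMeasure Pr]

/-- The iterates together with the filtered noise. -/
def augIter (P : Problem n dx dy Ξf Ξg) (W : Matrix (Fin n) (Fin n) ℝ) (c : Params) (l : ℝ)
    (ξf : ℕ → Fin n → Ω → Ξf) (ξg : ℕ → Fin n → Ω → Ξg) (s₀ : State n dx dy) :
    ℕ → Ω → State n dx dy × Joint dx dy
  | 0, _ => (s₀, 0)
  | k + 1, ω => augStep P W c (c.mu k) l (fun i => (ξf k i ω, ξg k i ω))
      (augIter P W c l ξf ξg s₀ k ω)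

variable {P : Problem n dx dy Ξf Ξg} {W : Matrix (Fin n) (Fin n) ℝ} {c : Params}
  {ρ δf δg σf σg Flow : ℝ} {ξf : ℕ → Fin n → Ω → Ξf} {ξg : ℕ → Fin n → Ω → Ξg}

lemma augIter_fst (K : ℕ) (s₀ : State n dx dy) (k : ℕ) (ω : Ω) :
    (augIter P W c (c.rateTheta n K) ξf ξg s₀ k ω).1 = c.run P W K ξf ξg s₀ k ω := by
  induction k with
  | zero => rfl
  | succ k ih =>
    have h : c.run P W K ξf ξg s₀ (k + 1) ω = step P W c.γ (c.mu k) (c.rateTheta n K)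
      (c.cLam * c.rateTheta n K) (c.cLam * c.rateTheta n K) (fun i => ξf k i ω)
      (fun i => ξg k i ω) (c.run P W K ξf ξg s₀ k ω) := rfl
    rw [h, ← ih]; rfl

/-- The σ-algebra generated by the samples of one agent at one iteration. -/
@[reducible] def sampleAlgebra (ξf : ℕ → Fin n → Ω → Ξf) (ξg : ℕ → Fin n → Ω → Ξg) (a : ℕ × Fin n) :
    MeasurableSpace Ω :=
  MeasurableSpace.comap (fun ω => (ξf a.1 a.2 ω, ξg a.1 a.2 ω)) inferInstance

/-- The σ-algebra generated by the samples drawn before iteration `k`. -/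
@[reducible] def pastAlgebra (ξf : ℕ → Fin n → Ω → Ξf) (ξg : ℕ → Fin n → Ω → Ξg) (k : ℕ) :
    MeasurableSpace Ω :=
  ⨆ a ∈ {a : ℕ × Fin n | a.1 < k}, sampleAlgebra ξf ξg a

lemma sampleAlgebra_le (hS : Sampling P Pr ξf ξg) (a : ℕ × Fin n) :
    sampleAlgebra ξf ξg a ≤ (inferInstance : MeasurableSpace Ω) :=
  ((hS.measurable_f a.1 a.2).prodMk (hS.measurable_g a.1 a.2)).comap_le

lemma measurable_augIter_past (hA : Assumptions P W c.L₁ c.L₂ ρ δf δg σf σg Flow) (l : ℝ)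
    (s₀ : State n dx dy) (k : ℕ) :
    Measurable[pastAlgebra ξf ξg k] (augIter P W c l ξf ξg s₀ k) := by
  induction k with
  | zero => exact @measurable_const _ _ _ (pastAlgebra ξf ξg 0) (s₀, 0)
  | succ k ih =>
    have hle : pastAlgebra ξf ξg k ≤ pastAlgebra ξf ξg (k + 1) :=
      biSup_mono fun a (ha : a.1 < k) => ha.trans (Nat.lt_succ_self k)
    have h1 : Measurable[pastAlgebra ξf ξg (k + 1)] (augIter P W c l ξf ξg s₀ k) :=
      ih.mono hle le_rfl
    have h2 : Measurable[pastAlgebra ξf ξg (k + 1)] fun ω i => (ξf k i ω, ξg k i ω) := by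
      refine @measurable_pi_lambda _ _ _ (pastAlgebra ξf ξg (k + 1)) _ _ fun i => ?_
      have h3 : sampleAlgebra ξf ξg (k, i) ≤ pastAlgebra ξf ξg (k + 1) :=
        le_biSup (sampleAlgebra ξf ξg) (show (k, i) ∈ {a : ℕ × Fin n | a.1 < k + 1} from
          Nat.lt_succ_self k)
      exact (comap_measurable (fun ω => (ξf k i ω, ξg k i ω))).mono h3 le_rfl
    exact measurable_augStep_comp (m := pastAlgebra ξf ξg (k + 1)) hA (c.mu k) l h1 h2

lemma measurable_augIter (hA : Assumptions P W c.L₁ c.L₂ ρ δf δg σf σg Flow)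
    (hS : Sampling P Pr ξf ξg) (l : ℝ) (s₀ : State n dx dy) (k : ℕ) :
    Measurable (augIter P W c l ξf ξg s₀ k) :=
  (measurable_augIter_past hA l s₀ k).mono (iSup₂_le fun a _ => sampleAlgebra_le hS a) le_rfl

lemma measurable_samples (hS : Sampling P Pr ξf ξg) (k : ℕ) :
    Measurable fun ω (i : Fin n) => (ξf k i ω, ξg k i ω) :=
  measurable_pi_lambda _ fun i => (hS.measurable_f k i).prodMk (hS.measurable_g k i)

/-- The iterate is measurable for the samples with index below `k`, and the new samples use the
index `k`; disjoint blocks of an independent family are independent. -/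
lemma indepFun_augIter (hA : Assumptions P W c.L₁ c.L₂ ρ δf δg σf σg Flow)
    (hS : Sampling P Pr ξf ξg) (l : ℝ) (s₀ : State n dx dy) (k : ℕ) :
    IndepFun (augIter P W c l ξf ξg s₀ k) (fun ω (i : Fin n) => (ξf k i ω, ξg k i ω)) Pr := by
  have hind : iIndep (sampleAlgebra ξf ξg) Pr := hS.indep
  have hdisj : Disjoint {a : ℕ × Fin n | a.1 < k} {a : ℕ × Fin n | a.1 = k} := by
    rw [Set.disjoint_left]
    exact fun a (h1 : a.1 < k) (h2 : a.1 = k) => absurd h2 h1.ne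
  have h := indep_iSup_of_disjoint (sampleAlgebra_le hS) hind hdisj
  rw [IndepFun_iff_Indep]
  refine indep_of_indep_of_le_right (indep_of_indep_of_le_left h
    (measurable_augIter_past hA l s₀ k).comap_le) ?_
  refine Measurable.comap_le ?_
  refine @measurable_pi_lambda _ _ _ (_) _ _ fun i => ?_
  exact (comap_measurable (fun ω => (ξf k i ω, ξg k i ω))).mono
    (le_biSup (sampleAlgebra ξf ξg) (show (k, i) ∈ {a : ℕ × Fin n | a.1 = k} from rfl)) le_rfl

end Iterates

/-! ### The penalty parameters -/

namespace Params

variable {c : Params}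

lemma mu_zero (c : Params) : c.mu 0 = c.μ₀ := by simp [mu]

lemma Admissible.mu_pos (hc : c.Admissible) (k : ℕ) : 0 < c.mu k :=
  mul_pos hc.μ₀_pos (Real.rpow_pos_of_pos (by positivity) _)

lemma Admissible.mu_antitone (hc : c.Admissible) : Antitone c.mu := fun i j hij =>
  mul_le_mul_of_nonneg_left (Real.rpow_le_rpow_of_nonpos (by positivity)
    (by exact_mod_cast Nat.succ_le_succ hij) (neg_nonpos.2 hc.p_pos.le)) hc.μ₀_pos.le

lemma Admissible.mu_le (hc : c.Admissible) (k : ℕ) : c.mu k ≤ c.μ₀ :=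
  (hc.mu_antitone (Nat.zero_le k)).trans c.mu_zero.le

/-- The penalty parameters tend to zero as `p > 0`. The index depends on the parameters only, so it
may enter the final constant. -/
lemma Admissible.exists_mu_mul_le (hc : c.Admissible) :
    ∃ k₀ : ℕ, ∀ k, k₀ ≤ k → c.mu k * c.L₁ ≤ 1 / c.γ := by
  have h : Filter.Tendsto (fun k => c.mu k * c.L₁) Filter.atTop (nhds (c.μ₀ * 0 * c.L₁)) :=
    (((tendsto_rpow_neg_atTop hc.p_pos).comp (Filter.tendsto_atTop_add_const_right _ 1
      tendsto_natCast_atTop_atTop)).const_mul c.μ₀).mul_const c.L₁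
  rw [mul_zero, zero_mul] at h
  exact Filter.eventually_atTop.1 ((h.eventually_lt_const hc.inv_γ_pos).mono fun k => le_of_lt)

/-- The growth rate of the Lyapunov function while the penalty parameter is large. -/
def growth (c : Params) : ℝ :=
  c.cLam ^ 2 * (c.μ₀ * c.L₁) * (8 * c.curv c.μ₀ * c.γ ^ 2 + 8 * c.slope ^ 2 * c.γ ^ 2 / c.eta
    + 8 * c.slope ^ 2 * c.lip ^ 2 * c.γ ^ 2 / c.kq
    + 12 * ((c.μ₀ * c.L₁) ^ 2 + 2 * c.L₂ ^ 2) * c.γ / c.kd) + (c.μ₀ * c.L₁) ^ 2 / c.kd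

lemma Admissible.growth_pos (hc : c.Admissible) : 0 < c.growth := by
  have := hc.curv_pos hc.μ₀_pos.le; have := hc.kq_pos; have := hc.kd_pos; have := hc.eta_pos
  have := hc.cLam_pos; have := hc.μ₀_pos; have := hc.L₁_pos; have := hc.γ_pos
  unfold growth; positivity

end Params

/-- A crude bound for early iterations. Each of `Φ`, `η ee`, `a qq` and `b l Δ` is at most the
Lyapunov value, `‖D‖²` is bounded through the gradient and its error, and the gradient through `Φ`.
The powers of `l` left over are bounded by `γ`; in the consensus part one factor `l` must be kept,
since its weight is only of order `l`. -/
lemma growth_arith {k l γ h H g L₂ Q Φ S ℓ η a b w ee qq Δ pp pD DD : ℝ} (hl : 0 ≤ l)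
    (hlγ : l ≤ γ) (hh : 0 ≤ h) (hhH : h ≤ H) (hQ : 0 ≤ Q) (hΦ : 0 ≤ Φ) (hS : 0 ≤ S) (hη : 0 < η)
    (ha : 0 < a) (hb : 0 < b) (hw : b * l ≤ w) (hee : 0 ≤ ee) (hqq : 0 ≤ qq) (hΔ : 0 ≤ Δ)
    (hDD0 : 0 ≤ DD) (hk : 0 ≤ k) (hpp : pp ≤ 4 * Q * Φ)
    (hpD : pD ≤ 2 * S * (2 * (ee + ℓ ^ 2 * qq)) + 6 * (H ^ 2 + 2 * L₂ ^ 2) * Δ)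
    (hDD : DD ≤ 2 * (pp + pD)) :
    k * l * (k * l * h - 1 / 4) * DD + l * (h ^ 2 - g ^ 2) * Δ
      ≤ (k ^ 2 * H * (8 * Q * γ ^ 2 + 8 * S * γ ^ 2 / η + 8 * S * ℓ ^ 2 * γ ^ 2 / a
        + 12 * (H ^ 2 + 2 * L₂ ^ 2) * γ / b) + H ^ 2 / b) * (Φ + η * ee + a * qq + w * Δ) := by
  set T := Φ + η * ee + a * qq + w * Δ with hT
  have e1 : 0 ≤ η * ee := by positivity
  have e2 : 0 ≤ a * qq := by positivity
  have e3 : b * (l * Δ) ≤ w * Δ := by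
    rw [← mul_assoc]; exact mul_le_mul_of_nonneg_right hw hΔ
  have e4 : 0 ≤ b * (l * Δ) := by positivity
  have t1 : Φ ≤ T := by linarith
  have t2 : ee ≤ T / η := by rw [le_div_iff₀ hη]; linarith
  have t3 : qq ≤ T / a := by rw [le_div_iff₀ ha]; linarith
  have t4 : l * Δ ≤ T / b := by rw [le_div_iff₀ hb]; linarith
  have hT0 : 0 ≤ T := hΦ.trans t1
  have hγ : 0 ≤ γ := hl.trans hlγ
  have hH : 0 ≤ H := hh.trans hhH
  have hl2 : l ^ 2 ≤ γ ^ 2 := pow_le_pow_left₀ hl hlγ 2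
  have u1 : l ^ 2 * DD ≤ γ ^ 2 * (8 * Q * T) + γ ^ 2 * (8 * S * (T / η))
      + γ ^ 2 * (8 * S * ℓ ^ 2 * (T / a)) + γ * (12 * (H ^ 2 + 2 * L₂ ^ 2) * (T / b)) := by
    have v1 : l ^ 2 * DD ≤ l ^ 2 * (8 * Q * Φ + 8 * S * ee + 8 * S * ℓ ^ 2 * qq
        + 12 * (H ^ 2 + 2 * L₂ ^ 2) * Δ) :=
      mul_le_mul_of_nonneg_left (by linarith) (sq_nonneg l)
    have v2 : l ^ 2 * (8 * Q * Φ) ≤ γ ^ 2 * (8 * Q * T) := by gcongr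
    have v3 : l ^ 2 * (8 * S * ee) ≤ γ ^ 2 * (8 * S * (T / η)) := by gcongr
    have v4 : l ^ 2 * (8 * S * ℓ ^ 2 * qq) ≤ γ ^ 2 * (8 * S * ℓ ^ 2 * (T / a)) := by gcongr
    have v5 : l * (12 * (H ^ 2 + 2 * L₂ ^ 2) * (l * Δ))
        ≤ γ * (12 * (H ^ 2 + 2 * L₂ ^ 2) * (T / b)) := by gcongr
    linarith
  have u2 : k ^ 2 * h * (l ^ 2 * DD) ≤ k ^ 2 * H * (γ ^ 2 * (8 * Q * T) + γ ^ 2 * (8 * S * (T / η))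
      + γ ^ 2 * (8 * S * ℓ ^ 2 * (T / a)) + γ * (12 * (H ^ 2 + 2 * L₂ ^ 2) * (T / b))) := by
    gcongr
  have u3 : h ^ 2 * (l * Δ) ≤ H ^ 2 * (T / b) := by gcongr
  have u4 : 0 ≤ k * l * DD := by positivity
  have u5 : 0 ≤ g ^ 2 * (l * Δ) := by positivity
  calc _ = k ^ 2 * h * (l ^ 2 * DD) - k * l * DD / 4 + (h ^ 2 * (l * Δ) - g ^ 2 * (l * Δ)) := by ring
    _ ≤ k ^ 2 * H * (γ ^ 2 * (8 * Q * T) + γ ^ 2 * (8 * S * (T / η))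
      + γ ^ 2 * (8 * S * ℓ ^ 2 * (T / a)) + γ * (12 * (H ^ 2 + 2 * L₂ ^ 2) * (T / b)))
      + H ^ 2 * (T / b) := by linarith
    _ = _ := by ring

/-! ### Iterating the one-step estimate -/

/-- Discrete Gronwall with at most `k₀` growing steps. The exponent `min k k₀` carries the
induction, which makes the constant independent of `K`. -/
lemma sum_le_of_recursion {m b A : ℕ → ℝ} {B e : ℝ} {k₀ : ℕ} (hB : 0 ≤ B) (he : 0 ≤ e)
    (hm : ∀ k, 0 ≤ m k) (hb : ∀ k, 0 ≤ b k) (hA0 : ∀ k, 0 ≤ A k) (hA : ∀ k, A k ≤ B)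
    (hk₀ : ∀ k, k₀ ≤ k → A k = 0) (h : ∀ k, m (k + 1) ≤ (1 + A k) * m k - b k + e) (K : ℕ) :
    ∑ k ∈ Finset.range K, b k ≤ (1 + B) ^ k₀ * (m 0 + K * e) := by
  have key : ∀ k : ℕ, m k + ∑ j ∈ Finset.range k, b j ≤ (1 + B) ^ (min k k₀) * (m 0 + k * e) := by
    intro k
    induction k with
    | zero => simp
    | succ k ih =>
      have hs : 0 ≤ ∑ j ∈ Finset.range k, b j := Finset.sum_nonneg fun j _ => hb j
      have hQ : (1 + A k) * (1 + B) ^ (min k k₀) ≤ (1 + B) ^ (min (k + 1) k₀) := by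
        rcases lt_or_ge k k₀ with hk | hk
        · rw [min_eq_left hk.le, min_eq_left hk, pow_succ']
          exact mul_le_mul_of_nonneg_right (by linarith [hA k]) (by positivity)
        · rw [min_eq_right hk, min_eq_right (hk.trans k.le_succ), hk₀ k hk, add_zero, one_mul]
      have h0 : 0 ≤ m 0 + k * e := add_nonneg (hm 0) (by positivity)
      have h1 : (1 : ℝ) ≤ (1 + B) ^ (min (k + 1) k₀) := one_le_pow₀ (by linarith)
      have h2 := mul_le_mul_of_nonneg_left ih (by linarith [hA0 k] : 0 ≤ 1 + A k)
      have h3 := mul_le_mul_of_nonneg_right hQ h0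
      have h4 := mul_nonneg (hA0 k) hs
      have h5 := mul_le_mul_of_nonneg_right h1 he
      have h6 := h k
      rw [Finset.sum_range_succ]
      push_cast
      linarith
  have h1 := key K
  have h2 : (1 + B) ^ (min K k₀) ≤ (1 + B) ^ k₀ :=
    pow_le_pow_right₀ (by linarith) (min_le_right _ _)
  have h3 := mul_le_mul_of_nonneg_right h2 (add_nonneg (hm 0) (by positivity) : 0 ≤ m 0 + K * e)
  linarith [hm K]

/-! ### The expected Lyapunov function along the iterates -/

section Chain

variable {n dx dy : ℕ} {Ξf : Type u} {Ξg : Type v} [MeasurableSpace Ξf] [MeasurableSpace Ξg]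
  {Ω : Type w} [MeasurableSpace Ω] {Pr : Measure Ω} [IsProbabilityMeasure Pr]
  {P : Problem n dx dy Ξf Ξg} {W : Matrix (Fin n) (Fin n) ℝ} {c : Params}
  {ρ δf δg σf σg Flow : ℝ} {ξf : ℕ → Fin n → Ω → Ξf} {ξg : ℕ → Fin n → Ω → Ξg}

lemma lyap_nonneg (hc : c.Admissible) (hA : Assumptions P W c.L₁ c.L₂ ρ δf δg σf σg Flow)
    (hn : 0 < n) {μ a : ℝ} (hμ : 0 ≤ μ) (ha : 0 ≤ a) (p : State n dx dy × Joint dx dy) :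
    0 ≤ lyap P c Flow μ a p := by
  have h1 := Phi_nonneg hc (hA.smooth_G hn) hμ hA.lower_bound p.1.mean
  have h2 := p.1.consensusError_nonneg
  have h3 := hc.eta_pos; have h4 := hc.kq_pos
  unfold lyap; positivity

lemma gradPsi_sq_le_lyap (hc : c.Admissible) (hA : Assumptions P W c.L₁ c.L₂ ρ δf δg σf σg Flow)
    (hn : 0 < n) {μ a : ℝ} (hμ : 0 ≤ μ) (ha : 0 ≤ a) (p : State n dx dy × Joint dx dy) :
    ‖gradPsi P c.γ μ p.1.mean‖ ^ 2 ≤ 4 * c.curv μ * lyap P c Flow μ a p := by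
  have h0 := hc.curv_pos hμ
  refine (norm_gradPsi_sq_le hc (hA.smooth_F hn) (hA.smooth_G hn) hμ hA.lower_bound _).trans
    (mul_le_mul_of_nonneg_left ?_ (by positivity))
  have h2 := p.1.consensusError_nonneg
  have h3 := hc.eta_pos; have h4 := hc.kq_pos
  unfold lyap
  have e1 : 0 ≤ c.eta * ‖avg p.1.θ - P.prox c.γ (p.1.mean + p.2)‖ ^ 2 := by positivity
  have e2 : 0 ≤ c.kq * ‖p.2‖ ^ 2 := by positivity
  have e3 : 0 ≤ a * p.1.consensusError := by positivity
  linarith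

lemma consensusError_le_lyap (hc : c.Admissible)
    (hA : Assumptions P W c.L₁ c.L₂ ρ δf δg σf σg Flow) (hn : 0 < n) {μ a : ℝ} (hμ : 0 ≤ μ)
    (p : State n dx dy × Joint dx dy) : a * p.1.consensusError ≤ lyap P c Flow μ a p := by
  have h1 := Phi_nonneg hc (hA.smooth_G hn) hμ hA.lower_bound p.1.mean
  have h3 := hc.eta_pos; have h4 := hc.kq_pos
  unfold lyap
  have e1 : 0 ≤ c.eta * ‖avg p.1.θ - P.prox c.γ (p.1.mean + p.2)‖ ^ 2 := by positivity
  have e2 : 0 ≤ c.kq * ‖p.2‖ ^ 2 := by positivity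
  linarith

/-- The growth rate of the Lyapunov function for the penalty parameter `μ`. -/
def Params.growthAt (c : Params) (μ : ℝ) : ℝ :=
  open Classical in if μ * c.L₁ ≤ 1 / c.γ then 0 else c.growth

lemma Params.Admissible.growthAt_nonneg (hc : c.Admissible) (μ : ℝ) : 0 ≤ c.growthAt μ := by
  unfold Params.growthAt; split_ifs; exacts [le_rfl, hc.growth_pos.le]

lemma Params.Admissible.growthAt_le (hc : c.Admissible) (μ : ℝ) : c.growthAt μ ≤ c.growth := by
  unfold Params.growthAt; split_ifs; exacts [hc.growth_pos.le, le_rfl]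

lemma Params.growthAt_eq_zero {μ : ℝ} (h : μ * c.L₁ ≤ 1 / c.γ) : c.growthAt μ = 0 := if_pos h

/-- If `μ L₁ ≤ 1 / γ`, both coefficients on the left are nonpositive: `c_λ ≤ 1/16` and `l μ L₁ ≤ l /
γ ≤ 1`. Otherwise the crude bound `growth_arith` applies. -/
lemma residual_le_growthAt_mul (hc : c.Admissible)
    (hA : Assumptions P W c.L₁ c.L₂ ρ δf δg σf σg Flow) (hn : 0 < n) {l μ : ℝ} (hl : 0 ≤ l)
    (hlg : l * (1 / c.γ) ≤ 25 / 96 * (1 - ρ)) (hμ : 0 ≤ μ) (hμ0 : μ ≤ c.μ₀)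
    (p : State n dx dy × Joint dx dy) :
    c.cLam * l * (c.cLam * l * (μ * c.L₁) - 1 / 4) * ‖amean (mdZ P c.γ μ p.1)‖ ^ 2
      + l * ((μ * c.L₁) ^ 2 - (1 / c.γ) ^ 2) * p.1.consensusError
    ≤ c.growthAt μ * lyap P c Flow μ (c.kd * l / (1 - ρ)) p := by
  have hρ0 := hA.network.rho_nonneg
  have hρ := hA.network.rho_lt_one
  have hp : 0 < 1 - ρ := by linarith
  have hk := hc.cLam_pos
  have hL := hc.L₁_pos
  have hγ := hc.γ_pos
  have hg := hc.inv_γ_pos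
  have hΔ := p.1.consensusError_nonneg
  have hh : 0 ≤ μ * c.L₁ := by positivity
  have hlγ1 : l * (1 / c.γ) ≤ 1 := by linarith
  unfold Params.growthAt
  split_ifs with hcase
  · have hk16 : c.cLam ≤ 1 / 16 := by
      have h1 := hc.cLam_mul_lip_sq_le
      have h2 : 1 ≤ c.lip ^ 2 := one_le_pow₀ hc.one_le_lip
      nlinarith
    have h1 : l * (μ * c.L₁) ≤ 1 := (mul_le_mul_of_nonneg_left hcase hl).trans hlγ1
    have h2 : c.cLam * l * (μ * c.L₁) - 1 / 4 ≤ 0 := by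
      have : c.cLam * (l * (μ * c.L₁)) ≤ 1 / 16 * 1 :=
        mul_le_mul hk16 h1 (by positivity) (by norm_num)
      linarith
    have h3 : (μ * c.L₁) ^ 2 - (1 / c.γ) ^ 2 ≤ 0 := by
      have := pow_le_pow_left₀ hh hcase 2
      linarith
    have h4 : c.cLam * l * (c.cLam * l * (μ * c.L₁) - 1 / 4) * ‖amean (mdZ P c.γ μ p.1)‖ ^ 2 ≤ 0 :=
      mul_nonpos_of_nonpos_of_nonneg (mul_nonpos_of_nonneg_of_nonpos (by positivity) h2)
        (by positivity)
    have h5 : l * ((μ * c.L₁) ^ 2 - (1 / c.γ) ^ 2) * p.1.consensusError ≤ 0 :=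
      mul_nonpos_of_nonpos_of_nonneg (mul_nonpos_of_nonneg_of_nonpos hl h3) hΔ
    rw [zero_mul]; linarith
  · have hF := hA.smooth_F hn
    have hG := hA.smooth_G hn
    have hlγ : l ≤ c.γ := by
      rwa [mul_one_div, div_le_one hγ] at hlγ1
    have hhH : μ * c.L₁ ≤ c.μ₀ * c.L₁ := mul_le_mul_of_nonneg_right hμ0 hL.le
    have hw : c.kd * l ≤ c.kd * l / (1 - ρ) := by
      have := hc.kd_pos
      rw [le_div_iff₀ hp]
      exact mul_le_of_le_one_right (by positivity) (by linarith)
    have hcurv : c.curv μ ≤ c.curv c.μ₀ := by unfold Params.curv; linarith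
    have hΦ := Phi_nonneg hc hG hμ hA.lower_bound p.1.mean
    have hpp := (norm_gradPsi_sq_le hc hF hG hμ hA.lower_bound p.1.mean).trans
      (mul_le_mul_of_nonneg_right (mul_le_mul_of_nonneg_left hcurv (by norm_num)) hΦ)
    have hpD := norm_gradPsi_sub_amean_mdZ_le (c := c) hA hn μ p.1
    have hθ : ‖avg p.1.θ - P.prox c.γ p.1.mean‖ ^ 2
        ≤ 2 * (‖avg p.1.θ - P.prox c.γ (p.1.mean + p.2)‖ ^ 2 + c.lip ^ 2 * ‖p.2‖ ^ 2) := by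
      have h1 := norm_add_sq_le_two (avg p.1.θ - P.prox c.γ (p.1.mean + p.2))
        (P.prox c.γ (p.1.mean + p.2) - P.prox c.γ p.1.mean)
      have h2 := pow_le_pow_left₀ (norm_nonneg _) (norm_prox_sub_le hc hG (p.1.mean + p.2) p.1.mean) 2
      rw [add_sub_cancel_left, mul_pow] at h2
      rw [sub_add_sub_cancel] at h1
      linarith
    have hDD : ‖amean (mdZ P c.γ μ p.1)‖ ^ 2 ≤ 2 * (‖gradPsi P c.γ μ p.1.mean‖ ^ 2
        + ‖gradPsi P c.γ μ p.1.mean - amean (mdZ P c.γ μ p.1)‖ ^ 2) := by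
      have h1 := norm_add_sq_le_two (gradPsi P c.γ μ p.1.mean)
        (-(gradPsi P c.γ μ p.1.mean - amean (mdZ P c.γ μ p.1)))
      rwa [norm_neg, neg_sub, add_sub_cancel] at h1
    refine growth_arith (g := 1 / c.γ) hl hlγ hh hhH (hc.curv_pos hc.μ₀_pos.le).le hΦ
      (sq_nonneg c.slope) hc.eta_pos hc.kq_pos hc.kd_pos hw (sq_nonneg _) (sq_nonneg _) hΔ
      (sq_nonneg _) hk.le hpp (hpD.trans ?_) hDD
    rw [← mul_pow]
    have h1 := mul_le_mul_of_nonneg_left hθ (by positivity : 0 ≤ 2 * c.slope ^ 2)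
    have h2 := pow_le_pow_left₀ hh hhH 2
    have h3 := mul_le_mul_of_nonneg_right (by linarith : 6 * ((μ * c.L₁) ^ 2 + 2 * c.L₂ ^ 2)
      ≤ 6 * ((c.μ₀ * c.L₁) ^ 2 + 2 * c.L₂ ^ 2)) hΔ
    exact add_le_add h1 h3

/-- The error made by one iteration because of the noise and of the dissimilarity of the agents. -/
def Params.stepError (c : Params) (n : ℕ) (ρ l δf δg σf σg : ℝ) : ℝ :=
  c.noiseC * (l ^ 2 * (δf ^ 2 + δg ^ 2) / n + l ^ 3 * (δf ^ 2 + δg ^ 2) / (1 - ρ)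
    + l ^ 3 * (σf ^ 2 + σg ^ 2) / (1 - ρ) ^ 2)

/-- The guaranteed decrease of the Lyapunov function. -/
def decrease (P : Problem n dx dy Ξf Ξg) (c : Params) (μ l : ℝ) (s : State n dx dy) : ℝ :=
  c.cLam * l / 2 * ‖gradPsi P c.γ μ s.mean‖ ^ 2 + c.kd / 4 * l * s.consensusError

lemma measurable_gradPsi_sq (hc : c.Admissible)
    (hA : Assumptions P W c.L₁ c.L₂ ρ δf δg σf σg Flow) (hn : 0 < n) (μ : ℝ) :
    Measurable fun p : State n dx dy × Joint dx dy => ‖gradPsi P c.γ μ p.1.mean‖ ^ 2 :=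
  (((continuous_gradPsi hc (hA.smooth_F hn) (hA.smooth_G hn) μ).measurable.comp
    (measurable_state_mean.comp measurable_fst)).norm).pow_const 2

lemma integrable_gradPsi_sq (hc : c.Admissible)
    (hA : Assumptions P W c.L₁ c.L₂ ρ δf δg σf σg Flow) (hn : 0 < n) {μ a : ℝ} (hμ : 0 ≤ μ)
    (ha : 0 ≤ a) {X : Ω → State n dx dy × Joint dx dy} (hX : Measurable X)
    (h : Integrable (fun ω => lyap P c Flow μ a (X ω)) Pr) :
    Integrable (fun ω => ‖gradPsi P c.γ μ (X ω).1.mean‖ ^ 2) Pr :=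
  (h.const_mul (4 * c.curv μ)).mono'
    ((measurable_gradPsi_sq hc hA hn μ).comp hX).aestronglyMeasurable
    (Filter.Eventually.of_forall fun ω => by
      rw [Real.norm_of_nonneg (sq_nonneg _)]
      exact gradPsi_sq_le_lyap hc hA hn hμ ha (X ω))

lemma integrable_consensusError (hc : c.Admissible)
    (hA : Assumptions P W c.L₁ c.L₂ ρ δf δg σf σg Flow) (hn : 0 < n) {μ a : ℝ} (hμ : 0 ≤ μ)
    (ha : 0 < a) {X : Ω → State n dx dy × Joint dx dy} (hX : Measurable X)
    (h : Integrable (fun ω => lyap P c Flow μ a (X ω)) Pr) :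
    Integrable (fun ω => (X ω).1.consensusError) Pr :=
  (h.const_mul a⁻¹).mono'
    (measurable_consensusError.comp (measurable_fst.comp hX)).aestronglyMeasurable
    (Filter.Eventually.of_forall fun ω => by
      rw [Real.norm_of_nonneg (State.consensusError_nonneg _), inv_mul_eq_div, le_div_iff₀ ha,
        mul_comm]
      exact consensusError_le_lyap hc hA hn hμ (X ω))

lemma integrable_decrease (hc : c.Admissible)
    (hA : Assumptions P W c.L₁ c.L₂ ρ δf δg σf σg Flow) (hn : 0 < n) {μ a : ℝ} (hμ : 0 ≤ μ)
    (ha : 0 < a) {X : Ω → State n dx dy × Joint dx dy} (hX : Measurable X)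
    (h : Integrable (fun ω => lyap P c Flow μ a (X ω)) Pr) (l : ℝ) :
    Integrable (fun ω => decrease P c μ l (X ω).1) Pr :=
  ((integrable_gradPsi_sq hc hA hn hμ ha.le hX h).const_mul _).add
    ((integrable_consensusError hc hA hn hμ ha hX h).const_mul _)

/-- The one-step estimate for frozen states, with its residual replaced by the growth factor, is
integrated over the past by independence. Integrability is propagated at the same time. -/
lemma lyap_chain_step (hc : c.Admissible) (hA : Assumptions P W c.L₁ c.L₂ ρ δf δg σf σg Flow)
    (hS : Sampling P Pr ξf ξg) (hn : 0 < n) {l : ℝ} (hl : 0 < l)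
    (hlg : l * (1 / c.γ) ≤ 25 / 96 * (1 - ρ)) (s₀ : State n dx dy) (k : ℕ)
    (h : Integrable (fun ω => lyap P c Flow (c.mu k) (c.kd * l / (1 - ρ))
      (augIter P W c l ξf ξg s₀ k ω)) Pr) :
    Integrable (fun ω => lyap P c Flow (c.mu (k + 1)) (c.kd * l / (1 - ρ))
      (augIter P W c l ξf ξg s₀ (k + 1) ω)) Pr ∧
    ∫ ω, lyap P c Flow (c.mu (k + 1)) (c.kd * l / (1 - ρ))
      (augIter P W c l ξf ξg s₀ (k + 1) ω) ∂Pr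
    ≤ (1 + c.growthAt (c.mu k)) * ∫ ω, lyap P c Flow (c.mu k) (c.kd * l / (1 - ρ))
        (augIter P W c l ξf ξg s₀ k ω) ∂Pr
      - ∫ ω, decrease P c (c.mu k) l (augIter P W c l ξf ξg s₀ k ω).1 ∂Pr
      + c.stepError n ρ l δf δg σf σg := by
  have hp : 0 < 1 - ρ := by linarith [hA.network.rho_lt_one]
  have hkd := hc.kd_pos
  set a := c.kd * l / (1 - ρ) with ha
  have ha0 : 0 < a := by positivity
  have hX := measurable_augIter (Pr := Pr) (c := c) hA hS l s₀ k
  have hμ := (hc.mu_pos k).le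
  have hμ' := (hc.mu_pos (k + 1)).le
  have hY := measurable_samples hS k
  have hd := integrable_decrease hc hA hn hμ ha0 hX h l
  have hUi := ((h.const_mul (1 + c.growthAt (c.mu k))).sub hd).add
    (integrable_const (c.stepError n ρ l δf δg σf σg))
  have hU : Measurable fun p : State n dx dy × Joint dx dy =>
      (1 + c.growthAt (c.mu k)) * lyap P c Flow (c.mu k) a p - decrease P c (c.mu k) l p.1
        + c.stepError n ρ l δf δg σf σg :=
    (((measurable_lyap hc hA hn hμ a).const_mul _).sub
      (((measurable_gradPsi_sq hc hA hn _).const_mul _).add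
        ((measurable_consensusError.comp measurable_fst).const_mul _))).add_const _
  obtain ⟨h1, h2⟩ := integral_le_of_indepFun hX hY (indepFun_augIter hA hS l s₀ k)
    (H := fun a' => lyap P c Flow (c.mu (k + 1)) a (augStep P W c (c.mu k) l a'.2 a'.1))
    ((measurable_lyap hc hA hn hμ' a).comp (measurable_augStep hA (c.mu k) l))
    (fun p => lyap_nonneg hc hA hn hμ' ha0.le _) hU hUi
    (fun p => (lyap_one_step hc hA hS hn hl.le hlg hμ' (hc.mu_antitone k.le_succ) (hc.mu_le k) k p).1)
    (fun p => by
      have h1 := (lyap_one_step hc hA hS hn hl.le hlg hμ' (hc.mu_antitone k.le_succ)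
        (hc.mu_le k) k p).2
      have h2 := residual_le_growthAt_mul hc hA hn hl.le hlg hμ (hc.mu_le k) p
      unfold decrease Params.stepError
      linarith)
  refine ⟨h1, h2.trans (le_of_eq ?_)⟩
  have h3 : Integrable (fun ω => (1 + c.growthAt (c.mu k)) * lyap P c Flow (c.mu k) a
      (augIter P W c l ξf ξg s₀ k ω) - decrease P c (c.mu k) l (augIter P W c l ξf ξg s₀ k ω).1) Pr :=
    (h.const_mul _).sub hd
  rw [integral_add h3 (integrable_const _), integral_sub (h.const_mul _) hd,
    integral_const_mul, integral_const, probReal_univ, one_smul]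

theorem lyap_chain (hc : c.Admissible) (hA : Assumptions P W c.L₁ c.L₂ ρ δf δg σf σg Flow)
    (hS : Sampling P Pr ξf ξg) (hn : 0 < n) {l : ℝ} (hl : 0 < l)
    (hlg : l * (1 / c.γ) ≤ 25 / 96 * (1 - ρ)) (s₀ : State n dx dy) (k : ℕ) :
    Integrable (fun ω => lyap P c Flow (c.mu k) (c.kd * l / (1 - ρ))
      (augIter P W c l ξf ξg s₀ k ω)) Pr := by
  induction k with
  | zero => simp only [augIter]; exact integrable_const _
  | succ k ih => exact (lyap_chain_step hc hA hS hn hl hlg s₀ k ih).1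

lemma decrease_nonneg (hc : c.Admissible) {l : ℝ} (hl : 0 ≤ l) (μ : ℝ) (s : State n dx dy) :
    0 ≤ decrease P c μ l s := by
  have := hc.cLam_pos; have := hc.kd_pos; have := s.consensusError_nonneg
  unfold decrease; positivity

theorem sum_integral_decrease_le (hc : c.Admissible)
    (hA : Assumptions P W c.L₁ c.L₂ ρ δf δg σf σg Flow) (hS : Sampling P Pr ξf ξg) (hn : 0 < n)
    {l : ℝ} (hl : 0 < l) (hlg : l * (1 / c.γ) ≤ 25 / 96 * (1 - ρ)) (s₀ : State n dx dy) {k₀ : ℕ}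
    (hk₀ : ∀ k, k₀ ≤ k → c.mu k * c.L₁ ≤ 1 / c.γ) (K : ℕ) :
    ∑ k ∈ Finset.range K,
      ∫ ω, decrease P c (c.mu k) l (augIter P W c l ξf ξg s₀ k ω).1 ∂Pr
    ≤ (1 + c.growth) ^ k₀ * (lyap P c Flow c.μ₀ (c.kd * l / (1 - ρ)) (s₀, 0)
      + K * c.stepError n ρ l δf δg σf σg) := by
  have hp : 0 < 1 - ρ := by linarith [hA.network.rho_lt_one]
  have hkd := hc.kd_pos
  have hnC := hc.noiseC_pos
  have he : 0 ≤ c.stepError n ρ l δf δg σf σg := by unfold Params.stepError; positivity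
  have h := sum_le_of_recursion (k₀ := k₀)
    (m := fun k => ∫ ω, lyap P c Flow (c.mu k) (c.kd * l / (1 - ρ))
      (augIter P W c l ξf ξg s₀ k ω) ∂Pr)
    (b := fun k => ∫ ω, decrease P c (c.mu k) l (augIter P W c l ξf ξg s₀ k ω).1 ∂Pr)
    (A := fun k => c.growthAt (c.mu k)) hc.growth_pos.le he
    (fun k => integral_nonneg fun ω => lyap_nonneg hc hA hn (hc.mu_pos k).le (by positivity) _)
    (fun k => integral_nonneg fun ω => decrease_nonneg hc hl.le _ _)
    (fun k => hc.growthAt_nonneg _) (fun k => hc.growthAt_le _)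
    (fun k hk => Params.growthAt_eq_zero (hk₀ k hk))
    (fun k => (lyap_chain_step hc hA hS hn hl hlg s₀ k
      (lyap_chain hc hA hS hn hl hlg s₀ k)).2) K
  have h0 : ∫ ω, lyap P c Flow (c.mu 0) (c.kd * l / (1 - ρ))
      (augIter P W c l ξf ξg s₀ 0 ω) ∂Pr = lyap P c Flow c.μ₀ (c.kd * l / (1 - ρ)) (s₀, 0) := by
    simp only [augIter, integral_const, probReal_univ, one_smul, c.mu_zero]
  simpa only [h0] using h

end Chain

/-! ### The constants of the convergence rate -/

namespace Params

variable {c : Params}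

/-- The weights depend on the network only through `1 / (1 - ρ)`, as does the weight of the
consensus error in `lyap`; this makes the comparison with `𝒞₁` uniform in `ρ`. -/
lemma tau₂_eq (c : Params) (ρ : ℝ) : c.tau₂ ρ = c.tau₂ 0 / (1 - ρ) := by
  unfold tau₂; rw [sub_zero, mul_one, div_div]

lemma tau₃_eq (c : Params) (ρ : ℝ) : c.tau₃ ρ = c.tau₃ 0 / (1 - ρ) := by
  unfold tau₃; rw [sub_zero, mul_one, div_div]

lemma tau₄_eq (c : Params) (ρ : ℝ) : c.tau₄ ρ = c.tau₄ 0 / (1 - ρ) := by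
  unfold tau₄; rw [sub_zero, mul_one, div_div]

/-- A lower bound for the weights of the consensus errors in the initial Lyapunov value, up to the
factor `l / (1 - ρ)`. -/
def tauMin (c : Params) : ℝ := 24 * c.a₁ * c.L₂ ^ 2 / c.eta

lemma Admissible.tauMin_pos (hc : c.Admissible) : 0 < c.tauMin := by
  have := hc.a₁_pos; have := hc.L₂_pos; have := hc.eta_pos
  unfold tauMin; positivity

lemma Admissible.L₂_sq_le (hc : c.Admissible) : c.L₂ ^ 2 ≤ 1 / c.γ ^ 2 := by
  rw [← one_div_pow]
  exact pow_le_pow_left₀ hc.L₂_pos.le (by linarith [hc.two_L₂_lt, hc.L₂_pos]) 2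

lemma Admissible.tauMin_le_tau₂ (hc : c.Admissible) : c.tauMin ≤ c.tau₂ 0 * c.cLam := by
  have h1 := hc.a₁_pos; have h2 := hc.L₂_pos; have h3 := hc.eta_pos; have h4 := hc.cLam_pos
  have h5 := hc.μ₀_pos; have h6 := hc.L₁_pos
  have e : c.tau₂ 0 * c.cLam = 2 * (3 * (c.μ₀ * c.L₁ ^ 2 + 2 * c.L₂ ^ 2) * c.cLam
      + 4 * (c.μ₀ * c.L₁ ^ 2 + c.L₂ ^ 2) * c.cLam) + c.tauMin := by
    unfold tau₂ tauMin; field_simp; ring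
  rw [e, le_add_iff_nonneg_left]; positivity

lemma Admissible.tauMin_le_tau₃ (hc : c.Admissible) : c.tauMin ≤ c.tau₃ 0 * c.cLam := by
  have h1 := hc.a₁_pos; have h2 := hc.L₂_pos; have h3 := hc.eta_pos; have h4 := hc.cLam_pos
  have h5 := hc.μ₀_pos; have h6 := hc.L₁_pos; have h7 := hc.γ_pos
  have e : c.tau₃ 0 * c.cLam = 2 * (3 * (c.μ₀ * c.L₁ ^ 2 + c.L₂ ^ 2) * c.cLam
      + 4 * (c.μ₀ * c.L₁ ^ 2 + c.L₂ ^ 2 + 1 / c.γ ^ 2) * c.cLam)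
      + 24 * c.a₁ * (1 / c.γ ^ 2) / c.eta := by
    unfold tau₃; field_simp; ring
  have h8 : c.tauMin ≤ 24 * c.a₁ * (1 / c.γ ^ 2) / c.eta := by
    unfold tauMin
    exact div_le_div_of_nonneg_right (mul_le_mul_of_nonneg_left hc.L₂_sq_le (by positivity)) h3.le
  rw [e]
  exact h8.trans (le_add_of_nonneg_left (by positivity))

/-- In `𝒞₁` the deviation of `θ` has the weight `τ₄ l` without the factor `c_λ`, so `c_λ ≤ 1`
enters. -/
lemma Admissible.tauMin_le_tau₄ (hc : c.Admissible) : c.tauMin ≤ c.tau₄ 0 := by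
  have h1 := hc.a₁_pos; have h2 := hc.L₂_pos; have h3 := hc.eta_pos; have h4 := hc.cLam_pos
  have h7 := hc.γ_pos
  have hk : c.cLam ≤ 1 := by
    have h5 := hc.cLam_mul_lip_sq_le
    have h6 : 1 ≤ c.lip ^ 2 := one_le_pow₀ hc.one_le_lip
    nlinarith
  have e : c.tau₄ 0 * c.cLam = 2 * (3 * c.L₂ ^ 2 * c.cLam + 4 / c.γ ^ 2 * c.cLam)
      + 24 * c.a₁ * (1 / c.γ ^ 2) / c.eta + c.tauMin := by
    unfold tau₄ tauMin; field_simp; ring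
  have h8 : c.tauMin ≤ c.tau₄ 0 * c.cLam := by
    rw [e, le_add_iff_nonneg_left]; positivity
  have h9 : 0 ≤ c.tau₄ 0 := by unfold tau₄; rw [sub_zero, mul_one]; positivity
  exact h8.trans (mul_le_of_le_one_right h9 hk)

lemma Admissible.four_mul_a₁_le_M₁ (hc : c.Admissible) : 4 * c.a₁ ≤ c.M₁ := by
  have h1 := hc.a₁_pos; have h2 := hc.L₂_pos; have h4 := hc.cLam_pos
  have h5 := hc.μ₀_pos; have h6 := hc.L₁_pos; have h7 := hc.Lθ_pos
  have h8 : 0 < c.LPhi₀ := by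
    have : 0 < max c.L₂ (1 / c.γ) := h2.trans_le (le_max_left _ _)
    unfold LPhi₀; positivity
  unfold M₁
  rw [le_add_iff_nonneg_right]; positivity

lemma Admissible.M₁_pos (hc : c.Admissible) : 0 < c.M₁ := by
  linarith [hc.four_mul_a₁_le_M₁, hc.a₁_pos]

/-- The ratio of the initial value of `lyap` to `C₁`. -/
def lyapRatio (c : Params) : ℝ := 1 + c.eta / c.a₁ + c.kd / c.tauMin

/-- The ratio of the variances to `C₁`. -/
def noiseRatio (c : Params) : ℝ := (1 / c.μ₀ + 1) / (4 * c.a₁)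

/-- The constant of the upper bound for `C₁`. -/
def initC (c : Params) : ℝ :=
  1 + c.a₁ + c.tau₂ 0 * c.cLam * c.γ + c.tau₃ 0 * c.cLam * c.γ + c.tau₄ 0 * c.γ
    + c.M₁ * (c.μ₀ + 2)

/-- The constant of a rate whose left-hand side has the weight `a` in the Lyapunov decrease. -/
def rateC (c : Params) (A a : ℝ) : ℝ :=
  A / a * (c.lyapRatio / c.cθ + c.noiseC * (c.cθ * c.noiseRatio) + c.noiseC * c.cθ ^ 2)

lemma Admissible.lyapRatio_pos (hc : c.Admissible) : 0 < c.lyapRatio := by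
  have := hc.eta_pos; have := hc.a₁_pos; have := hc.kd_pos; have := hc.tauMin_pos
  unfold lyapRatio; positivity

lemma Admissible.noiseRatio_pos (hc : c.Admissible) : 0 < c.noiseRatio := by
  have := hc.μ₀_pos; have := hc.a₁_pos
  unfold noiseRatio; positivity

lemma Admissible.rateC_pos (hc : c.Admissible) {A a : ℝ} (hA : 0 < A) (ha : 0 < a) :
    0 < c.rateC A a := by
  have := hc.lyapRatio_pos; have := hc.noiseRatio_pos; have := hc.noiseC_pos; have := hc.cθ_pos
  unfold rateC; positivity

lemma Admissible.initC_pos (hc : c.Admissible) : 0 < c.initC := by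
  have h1 := hc.a₁_pos; have h2 := hc.M₁_pos; have h3 := hc.μ₀_pos; have h4 := hc.γ_pos
  have h5 := hc.tauMin_pos.trans_le hc.tauMin_le_tau₂
  have h6 := hc.tauMin_pos.trans_le hc.tauMin_le_tau₃
  have h7 := hc.tauMin_pos.trans_le hc.tauMin_le_tau₄
  unfold initC; positivity

end Params

/-- Here `x = √n`, `y = √K`, `d = 1 - ρ`. Division by `a l y²` gives `1 / (x y)` for the initial
value, `l / x²` for the averaged noise and `l²` for the consensus errors. The averaged noise is
absorbed in `C₁` through `hδC`, and `d² ≤ d` aligns the two remaining denominators. -/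
lemma rate_arith {S l x y d A a N B₀ C₁ κ₁ κ₂ cθ δ σ : ℝ} (hx : 0 < x) (hy : 0 < y) (hd : 0 < d)
    (hd1 : d ≤ 1) (hA : 0 ≤ A) (ha : 0 < a) (hN : 0 ≤ N) (hcθ : 0 < cθ) (hδ : 0 ≤ δ) (hσ : 0 ≤ σ)
    (hC : 0 ≤ C₁) (hκ₁ : 0 ≤ κ₁) (hκ₂ : 0 ≤ κ₂) (hB : B₀ ≤ κ₁ * C₁) (hδC : δ ≤ κ₂ * C₁)
    (hl : l = cθ * (x / y))
    (h : a * l * S ≤ A * (B₀ + y ^ 2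
      * (N * (l ^ 2 * δ / x ^ 2 + l ^ 3 * δ / d + l ^ 3 * σ / d ^ 2)))) :
    1 / y ^ 2 * S ≤ A / a * (κ₁ / cθ + N * (cθ * κ₂) + N * cθ ^ 2)
      * (C₁ / (x * y) + x ^ 2 * δ / (d ^ 2 * y ^ 2) + x ^ 2 * σ / (d ^ 2 * y ^ 2)) := by
  have hl0 : 0 < l := by rw [hl]; positivity
  have h1 : 1 / y ^ 2 * S ≤ A / a * (B₀ / (cθ * (x * y)) + N * (cθ * δ / (x * y)
      + cθ ^ 2 * (x ^ 2 * δ / (d * y ^ 2)) + cθ ^ 2 * (x ^ 2 * σ / (d ^ 2 * y ^ 2)))) := by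
    have e : A / a * (B₀ / (cθ * (x * y)) + N * (cθ * δ / (x * y)
        + cθ ^ 2 * (x ^ 2 * δ / (d * y ^ 2)) + cθ ^ 2 * (x ^ 2 * σ / (d ^ 2 * y ^ 2))))
        = 1 / y ^ 2 * (A * (B₀ + y ^ 2
          * (N * (l ^ 2 * δ / x ^ 2 + l ^ 3 * δ / d + l ^ 3 * σ / d ^ 2))) / (a * l)) := by
      rw [hl]; field_simp
    rw [e]
    refine mul_le_mul_of_nonneg_left ?_ (by positivity)
    rw [le_div_iff₀ (by positivity), mul_comm]
    exact h
  refine h1.trans ?_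
  rw [mul_assoc]
  refine mul_le_mul_of_nonneg_left ?_ (by positivity)
  set X := C₁ / (x * y) with hX
  set Y := x ^ 2 * δ / (d ^ 2 * y ^ 2) with hY
  set Z := x ^ 2 * σ / (d ^ 2 * y ^ 2) with hZ
  have hX0 : 0 ≤ X := by positivity
  have hY0 : 0 ≤ Y := by positivity
  have hZ0 : 0 ≤ Z := by positivity
  have t1 : B₀ / (cθ * (x * y)) ≤ κ₁ / cθ * X := by
    have e : κ₁ / cθ * X = κ₁ * C₁ / (cθ * (x * y)) := by rw [hX]; field_simp
    rw [e]; exact div_le_div_of_nonneg_right hB (by positivity)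
  have t2 : cθ * δ / (x * y) ≤ cθ * κ₂ * X := by
    have e : cθ * κ₂ * X = cθ * (κ₂ * C₁) / (x * y) := by rw [hX]; ring
    rw [e]
    exact div_le_div_of_nonneg_right (mul_le_mul_of_nonneg_left hδC hcθ.le) (by positivity)
  have t3 : x ^ 2 * δ / (d * y ^ 2) ≤ Y := by
    refine div_le_div_of_nonneg_left (by positivity) (by positivity) ?_
    exact mul_le_mul_of_nonneg_right (by nlinarith) (by positivity)
  have t4 : cθ ^ 2 * (x ^ 2 * δ / (d * y ^ 2)) ≤ cθ ^ 2 * Y :=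
    mul_le_mul_of_nonneg_left t3 (sq_nonneg _)
  have t5 : N * (cθ * δ / (x * y) + cθ ^ 2 * (x ^ 2 * δ / (d * y ^ 2)) + cθ ^ 2 * Z)
      ≤ N * (cθ * κ₂ * X + cθ ^ 2 * Y + cθ ^ 2 * Z) :=
    mul_le_mul_of_nonneg_left (by linarith) hN
  have p1 : 0 ≤ (κ₁ / cθ + N * (cθ * κ₂)) * (Y + Z) := by positivity
  have p2 : 0 ≤ N * cθ ^ 2 * X := by positivity
  nlinarith

/-! ### Comparison with the constant of the theorem -/

section Main

variable {n dx dy : ℕ} {Ξf : Type u} {Ξg : Type v} [MeasurableSpace Ξf] [MeasurableSpace Ξg]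
  {P : Problem n dx dy Ξf Ξg} {W : Matrix (Fin n) (Fin n) ℝ} {c : Params}
  {ρ δf δg σf σg Flow : ℝ}

lemma State.devX_nonneg (s : State n dx dy) : 0 ≤ s.devX := by unfold State.devX; positivity

lemma State.devY_nonneg (s : State n dx dy) : 0 ≤ s.devY := by unfold State.devY; positivity

lemma State.devTheta_nonneg (s : State n dx dy) : 0 ≤ s.devTheta := by
  unfold State.devTheta; positivity

lemma C₁_eq (ρ l δf δg : ℝ) (s : State n dx dy) :
    c.C₁ P Flow ρ l δf δg s = P.Phi c.γ Flow c.μ₀ s.mean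
      + c.a₁ * ‖avg s.θ - P.prox c.γ s.mean‖ ^ 2
      + l / (1 - ρ) * (c.tau₂ 0 * c.cLam * s.devX + c.tau₃ 0 * c.cLam * s.devY
        + c.tau₄ 0 * s.devTheta) + c.M₁ * (c.μ₀ * δf ^ 2 + 2 * δg ^ 2) := by
  unfold Params.C₁ Params.lyapunov₀
  rw [c.mu_zero, c.tau₂_eq ρ, c.tau₃_eq ρ, c.tau₄_eq ρ]
  ring

lemma tauMin_le_C₁ (hc : c.Admissible) {l : ℝ} (hl : 0 ≤ l) (hρ : ρ < 1) (s : State n dx dy) :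
    P.Phi c.γ Flow c.μ₀ s.mean + c.a₁ * ‖avg s.θ - P.prox c.γ s.mean‖ ^ 2
      + l / (1 - ρ) * (c.tauMin * s.consensusError) + c.M₁ * (c.μ₀ * δf ^ 2 + 2 * δg ^ 2)
      ≤ c.C₁ P Flow ρ l δf δg s := by
  have hp : 0 < 1 - ρ := by linarith
  have h1 := mul_le_mul_of_nonneg_right hc.tauMin_le_tau₂ s.devX_nonneg
  have h2 := mul_le_mul_of_nonneg_right hc.tauMin_le_tau₃ s.devY_nonneg
  have h3 := mul_le_mul_of_nonneg_right hc.tauMin_le_tau₄ s.devTheta_nonneg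
  have h4 : c.tauMin * s.consensusError ≤ c.tau₂ 0 * c.cLam * s.devX
      + c.tau₃ 0 * c.cLam * s.devY + c.tau₄ 0 * s.devTheta := by
    unfold State.consensusError; linarith
  have h5 := mul_le_mul_of_nonneg_left h4 (by positivity : 0 ≤ l / (1 - ρ))
  rw [C₁_eq]
  linarith

/-- The filter starts at `0`, so the initial tracking error is the one in `𝒞₁`. The two functionals
have different weights, and their ratios are bounded term by term. -/
lemma lyap_zero_le (hc : c.Admissible) (hA : Assumptions P W c.L₁ c.L₂ ρ δf δg σf σg Flow)
    (hn : 0 < n) {l : ℝ} (hl : 0 ≤ l) (s : State n dx dy) :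
    lyap P c Flow c.μ₀ (c.kd * l / (1 - ρ)) (s, 0) ≤ c.lyapRatio * c.C₁ P Flow ρ l δf δg s := by
  have hρ := hA.network.rho_lt_one
  have hp : 0 < 1 - ρ := by linarith
  have ha := hc.a₁_pos; have ht := hc.tauMin_pos; have hη := hc.eta_pos; have hk := hc.kd_pos
  have hM := hc.M₁_pos; have hμ := hc.μ₀_pos
  have hΦ := Phi_nonneg hc (hA.smooth_G hn) hμ.le hA.lower_bound s.mean
  have hΔ := s.consensusError_nonneg
  refine le_trans ?_ (mul_le_mul_of_nonneg_left
    (tauMin_le_C₁ (δf := δf) (δg := δg) hc hl hρ s) hc.lyapRatio_pos.le)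
  simp only [lyap, add_zero, norm_zero]
  set e := ‖avg s.θ - P.prox c.γ s.mean‖ ^ 2 with he
  set Φ := P.Phi c.γ Flow c.μ₀ s.mean
  have he0 : 0 ≤ e := sq_nonneg _
  set r := l / (1 - ρ) with hr
  have hr0 : 0 ≤ r := by positivity
  set T := Φ + c.a₁ * e + r * (c.tauMin * s.consensusError) + c.M₁ * (c.μ₀ * δf ^ 2 + 2 * δg ^ 2)
    with hT
  have q1 : 0 ≤ c.a₁ * e := by positivity
  have q2 : 0 ≤ r * (c.tauMin * s.consensusError) := by positivity
  have q3 : 0 ≤ c.M₁ * (c.μ₀ * δf ^ 2 + 2 * δg ^ 2) := by positivity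
  have t1 : Φ ≤ T := by linarith
  have t2 : c.eta * e ≤ c.eta / c.a₁ * T := by
    have : c.eta * e = c.eta / c.a₁ * (c.a₁ * e) := by field_simp
    rw [this]; exact mul_le_mul_of_nonneg_left (by linarith) (by positivity)
  have t3 : c.kd * l / (1 - ρ) * s.consensusError ≤ c.kd / c.tauMin * T := by
    have : c.kd * l / (1 - ρ) * s.consensusError
        = c.kd / c.tauMin * (r * (c.tauMin * s.consensusError)) := by rw [hr]; field_simp
    rw [this]; exact mul_le_mul_of_nonneg_left (by linarith) (by positivity)
  unfold Params.lyapRatio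
  linarith

/-- The remaining terms of `𝒞₁` are nonnegative, and its noise term has the coefficient `M₁ ≥ 4 a₁`.
-/
lemma variance_le_C₁ (hc : c.Admissible) (hA : Assumptions P W c.L₁ c.L₂ ρ δf δg σf σg Flow)
    (hn : 0 < n) {l : ℝ} (hl : 0 ≤ l) (s : State n dx dy) :
    δf ^ 2 + δg ^ 2 ≤ c.noiseRatio * c.C₁ P Flow ρ l δf δg s := by
  have hρ := hA.network.rho_lt_one
  have hp : 0 < 1 - ρ := by linarith
  have ha := hc.a₁_pos; have ht := hc.tauMin_pos; have hμ := hc.μ₀_pos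
  have hΦ := Phi_nonneg hc (hA.smooth_G hn) hμ.le hA.lower_bound s.mean
  have hΔ := s.consensusError_nonneg
  have h1 := tauMin_le_C₁ (P := P) (Flow := Flow) (δf := δf) (δg := δg) hc hl hρ s
  have q1 : 0 ≤ c.a₁ * ‖avg s.θ - P.prox c.γ s.mean‖ ^ 2 := by positivity
  have q2 : 0 ≤ l / (1 - ρ) * (c.tauMin * s.consensusError) := by positivity
  have q3 := mul_le_mul_of_nonneg_right hc.four_mul_a₁_le_M₁
    (by positivity : 0 ≤ c.μ₀ * δf ^ 2 + 2 * δg ^ 2)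
  have h2 : 4 * c.a₁ * (c.μ₀ * δf ^ 2 + 2 * δg ^ 2) ≤ c.C₁ P Flow ρ l δf δg s := by linarith
  refine le_trans ?_ (mul_le_mul_of_nonneg_left h2 hc.noiseRatio_pos.le)
  have e : c.noiseRatio * (4 * c.a₁ * (c.μ₀ * δf ^ 2 + 2 * δg ^ 2))
      = δf ^ 2 + δg ^ 2 + (δg ^ 2 + 2 / c.μ₀ * δg ^ 2 + c.μ₀ * δf ^ 2) := by
    unfold Params.noiseRatio; field_simp; ring
  rw [e]
  exact le_add_of_nonneg_right (by positivity)

lemma C₁_nonneg (hc : c.Admissible) (hA : Assumptions P W c.L₁ c.L₂ ρ δf δg σf σg Flow)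
    (hn : 0 < n) {l : ℝ} (hl : 0 ≤ l) (s : State n dx dy) : 0 ≤ c.C₁ P Flow ρ l δf δg s :=
  nonneg_of_mul_nonneg_right ((by positivity : 0 ≤ δf ^ 2 + δg ^ 2).trans
    (variance_le_C₁ hc hA hn hl s)) hc.noiseRatio_pos

/-- The step condition bounds `l / (1 - ρ)` by `γ`, which removes both `n` and `1 - ρ` from the
weights. -/
lemma C₁_le (hc : c.Admissible) (hA : Assumptions P W c.L₁ c.L₂ ρ δf δg σf σg Flow)
    (hn : 0 < n) {l : ℝ} (hl : 0 ≤ l) (hlg : l * (1 / c.γ) ≤ 25 / 96 * (1 - ρ))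
    (s : State n dx dy) :
    c.C₁ P Flow ρ l δf δg s ≤ c.initC * (P.Phi c.γ Flow c.μ₀ s.mean
      + ‖avg s.θ - P.prox c.γ s.mean‖ ^ 2 + s.consensusError + δf ^ 2 + δg ^ 2) := by
  have hp : 0 < 1 - ρ := by linarith [hA.network.rho_lt_one]
  have ha := hc.a₁_pos; have hμ := hc.μ₀_pos; have hM := hc.M₁_pos; have hγ := hc.γ_pos
  have hΦ := Phi_nonneg hc (hA.smooth_G hn) hμ.le hA.lower_bound s.mean
  have h5 := hc.tauMin_pos.trans_le hc.tauMin_le_tau₂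
  have h6 := hc.tauMin_pos.trans_le hc.tauMin_le_tau₃
  have h7 := hc.tauMin_pos.trans_le hc.tauMin_le_tau₄
  have hx := s.devX_nonneg; have hy := s.devY_nonneg; have hθ := s.devTheta_nonneg
  have hr : l / (1 - ρ) ≤ c.γ := by
    rw [div_le_iff₀ hp]
    rw [mul_one_div, div_le_iff₀ hγ] at hlg
    nlinarith [mul_pos hp hγ]
  have h1 := mul_le_mul_of_nonneg_right hr (by positivity : 0 ≤ c.tau₂ 0 * c.cLam * s.devX
    + c.tau₃ 0 * c.cLam * s.devY + c.tau₄ 0 * s.devTheta)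
  rw [C₁_eq]
  set T := P.Phi c.γ Flow c.μ₀ s.mean + ‖avg s.θ - P.prox c.γ s.mean‖ ^ 2 + s.consensusError
    + δf ^ 2 + δg ^ 2 with hT
  unfold State.consensusError at hT
  have p1 : 0 ≤ ‖avg s.θ - P.prox c.γ s.mean‖ ^ 2 := sq_nonneg _
  have p2 := sq_nonneg δf
  have p3 := sq_nonneg δg
  have t1 : P.Phi c.γ Flow c.μ₀ s.mean ≤ T := by linarith
  have t2 : c.a₁ * ‖avg s.θ - P.prox c.γ s.mean‖ ^ 2 ≤ c.a₁ * T :=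
    mul_le_mul_of_nonneg_left (by linarith) ha.le
  have t3 : c.tau₂ 0 * c.cLam * c.γ * s.devX ≤ c.tau₂ 0 * c.cLam * c.γ * T :=
    mul_le_mul_of_nonneg_left (by linarith) (by positivity)
  have t4 : c.tau₃ 0 * c.cLam * c.γ * s.devY ≤ c.tau₃ 0 * c.cLam * c.γ * T :=
    mul_le_mul_of_nonneg_left (by linarith) (by positivity)
  have t5 : c.tau₄ 0 * c.γ * s.devTheta ≤ c.tau₄ 0 * c.γ * T :=
    mul_le_mul_of_nonneg_left (by linarith) (by positivity)
  have t6 : c.M₁ * (c.μ₀ * δf ^ 2 + 2 * δg ^ 2) ≤ c.M₁ * ((c.μ₀ + 2) * T) := by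
    have e1 : c.μ₀ * δf ^ 2 ≤ c.μ₀ * T := mul_le_mul_of_nonneg_left (by linarith) hμ.le
    exact mul_le_mul_of_nonneg_left (by linarith) hM.le
  unfold Params.initC
  linarith

end Main

/-! ### From the summed decrease to the rates -/

section Rate

variable {n dx dy : ℕ} {Ξf : Type u} {Ξg : Type v} [MeasurableSpace Ξf] [MeasurableSpace Ξg]
  {Ω : Type w} [MeasurableSpace Ω] {Pr : Measure Ω} [IsProbabilityMeasure Pr]
  {P : Problem n dx dy Ξf Ξg} {W : Matrix (Fin n) (Fin n) ℝ} {c : Params}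
  {ρ δf δg σf σg Flow : ℝ} {ξf : ℕ → Fin n → Ω → Ξf} {ξg : ℕ → Fin n → Ω → Ξg}

lemma average_le_of_weighted_sum_le (hc : c.Admissible)
    (hA : Assumptions P W c.L₁ c.L₂ ρ δf δg σf σg Flow) (hn : 0 < n) {K : ℕ} (hK : 0 < K)
    (s₀ : State n dx dy) {S A a : ℝ} (hA0 : 0 ≤ A) (ha : 0 < a)
    (h : a * c.rateTheta n K * S ≤ A * (lyap P c Flow c.μ₀ (c.kd * c.rateTheta n K / (1 - ρ)) (s₀, 0)
      + K * c.stepError n ρ (c.rateTheta n K) δf δg σf σg)) :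
    1 / (K : ℝ) * S ≤ c.rateC A a *
      (c.C₁ P Flow ρ (c.rateTheta n K) δf δg s₀ / √((n : ℝ) * (K : ℝ))
        + (n : ℝ) * (δf ^ 2 + δg ^ 2) / ((1 - ρ) ^ 2 * (K : ℝ))
        + (n : ℝ) * (σf ^ 2 + σg ^ 2) / ((1 - ρ) ^ 2 * (K : ℝ))) := by
  have hn' : (0 : ℝ) < n := by exact_mod_cast hn
  have hK' : (0 : ℝ) < K := by exact_mod_cast hK
  have hcθ := hc.cθ_pos
  have hl : c.rateTheta n K = c.cθ * (√(n : ℝ) / √(K : ℝ)) := by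
    unfold Params.rateTheta; rw [Real.sqrt_div hn'.le]
  have hl0 : 0 ≤ c.rateTheta n K := by rw [hl]; positivity
  have h1 := rate_arith (x := √(n : ℝ)) (y := √(K : ℝ)) (d := 1 - ρ) (S := S)
    (Real.sqrt_pos.2 hn') (Real.sqrt_pos.2 hK') (by linarith [hA.network.rho_lt_one])
    (by linarith [hA.network.rho_nonneg]) hA0 ha hc.noiseC_pos.le hcθ
    (by positivity : 0 ≤ δf ^ 2 + δg ^ 2) (by positivity : 0 ≤ σf ^ 2 + σg ^ 2)
    (C₁_nonneg hc hA hn hl0 s₀) hc.lyapRatio_pos.le hc.noiseRatio_pos.le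
    (lyap_zero_le hc hA hn hl0 s₀) (variance_le_C₁ hc hA hn hl0 s₀) hl
    (by rw [Real.sq_sqrt hn'.le, Real.sq_sqrt hK'.le]; exact h)
  rw [Real.sq_sqrt hn'.le, Real.sq_sqrt hK'.le, ← Real.sqrt_mul hn'.le] at h1
  exact h1

theorem sum_integral_gradPsi_consensusError_le (hc : c.Admissible)
    (hA : Assumptions P W c.L₁ c.L₂ ρ δf δg σf σg Flow) (hS : Sampling P Pr ξf ξg) (hn : 0 < n)
    {l : ℝ} (hl : 0 < l) (hlg : l * (1 / c.γ) ≤ 25 / 96 * (1 - ρ)) (s₀ : State n dx dy) {k₀ : ℕ}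
    (hk₀ : ∀ k, k₀ ≤ k → c.mu k * c.L₁ ≤ 1 / c.γ) (K : ℕ) :
    c.cLam / 2 * l * ∑ k ∈ Finset.range K,
        ∫ ω, ‖gradPsi P c.γ (c.mu k) (augIter P W c l ξf ξg s₀ k ω).1.mean‖ ^ 2 ∂Pr
      + c.kd / 4 * l * ∑ k ∈ Finset.range K,
        ∫ ω, (augIter P W c l ξf ξg s₀ k ω).1.consensusError ∂Pr
    ≤ (1 + c.growth) ^ k₀ * (lyap P c Flow c.μ₀ (c.kd * l / (1 - ρ)) (s₀, 0)
      + K * c.stepError n ρ l δf δg σf σg) := by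
  refine le_trans (le_of_eq ?_) (sum_integral_decrease_le hc hA hS hn hl hlg s₀ hk₀ K)
  have hp : 0 < 1 - ρ := by linarith [hA.network.rho_lt_one]
  have hkd := hc.kd_pos
  have ha : 0 < c.kd * l / (1 - ρ) := by positivity
  rw [Finset.mul_sum, Finset.mul_sum, ← Finset.sum_add_distrib]
  refine Finset.sum_congr rfl fun k _ => ?_
  have hX := measurable_augIter (Pr := Pr) (c := c) hA hS l s₀ k
  have h := lyap_chain hc hA hS hn hl hlg s₀ k
  have hμ := (hc.mu_pos k).le
  unfold decrease
  rw [integral_add ((integrable_gradPsi_sq hc hA hn hμ ha.le hX h).const_mul _)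
    ((integrable_consensusError hc hA hn hμ ha hX h).const_mul _),
    integral_const_mul, integral_const_mul]
  ring

end Rate

end SunDSBO

end

theorem theorem1 (c : SunDSBO.Params) (hc : c.Admissible) :
    ∃ C : ℝ, 0 < C ∧
      ∀ (n K dx dy : ℕ) (Ξf : Type u) (Ξg : Type v) (Ω : Type w)
        [MeasurableSpace Ξf] [MeasurableSpace Ξg] [MeasurableSpace Ω]
        (Pr : Measure Ω) [IsProbabilityMeasure Pr]
        (P : SunDSBO.Problem n dx dy Ξf Ξg) (W : Matrix (Fin n) (Fin n) ℝ)
        (ρ δf δg σf σg Flow : ℝ)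
        (ξf : ℕ → Fin n → Ω → Ξf) (ξg : ℕ → Fin n → Ω → Ξg) (s₀ : SunDSBO.State n dx dy),
        0 < n → 0 < K → 0 ≤ δf → 0 ≤ δg → 0 ≤ σf → 0 ≤ σg →
        SunDSBO.Assumptions P W c.L₁ c.L₂ ρ δf δg σf σg Flow →
        SunDSBO.Sampling P Pr ξf ξg →
        c.StepCondition ρ (c.rateTheta n K) →
        -- the objects of the conclusion are well defined
        (∀ z, IsMinOn (P.proxObj c.γ z) Set.univ (P.prox c.γ z)) ∧
        (∀ k, Differentiable ℝ (P.Psi c.γ (c.mu k))) ∧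
        (∀ k, Integrable
          (fun ω => ‖gradient (P.Psi c.γ (c.mu k)) (c.run P W K ξf ξg s₀ k ω).mean‖ ^ 2) Pr) ∧
        (∀ k, Integrable (fun ω => (c.run P W K ξf ξg s₀ k ω).consensusError) Pr) ∧
        -- the rate for the stationarity measure
        1 / (K : ℝ) * ∑ k ∈ Finset.range K,
            ∫ ω, ‖gradient (P.Psi c.γ (c.mu k)) (c.run P W K ξf ξg s₀ k ω).mean‖ ^ 2 ∂Pr
          ≤ C * (c.C₁ P Flow ρ (c.rateTheta n K) δf δg s₀ / √((n : ℝ) * (K : ℝ))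
              + (n : ℝ) * (δf ^ 2 + δg ^ 2) / ((1 - ρ) ^ 2 * (K : ℝ))
              + (n : ℝ) * (σf ^ 2 + σg ^ 2) / ((1 - ρ) ^ 2 * (K : ℝ))) ∧
        -- the rate for the consensus error
        1 / (K : ℝ) * ∑ k ∈ Finset.range K,
            ∫ ω, (c.run P W K ξf ξg s₀ k ω).consensusError ∂Pr
          ≤ C * (c.C₁ P Flow ρ (c.rateTheta n K) δf δg s₀ / √(K : ℝ)
              + (n : ℝ) ^ (3 / 2 : ℝ) * (δf ^ 2 + δg ^ 2) / ((1 - ρ) ^ 2 * (K : ℝ))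
              + (n : ℝ) ^ (3 / 2 : ℝ) * (σf ^ 2 + σg ^ 2) / ((1 - ρ) ^ 2 * (K : ℝ))) ∧
        -- `C₁` is bounded independently of `n` and `1 - ρ`
        c.C₁ P Flow ρ (c.rateTheta n K) δf δg s₀
          ≤ C * (P.Phi c.γ Flow c.μ₀ s₀.mean + ‖SunDSBO.avg s₀.θ - P.prox c.γ s₀.mean‖ ^ 2
              + s₀.consensusError + δf ^ 2 + δg ^ 2) := by
  obtain ⟨k₀, hk₀⟩ := hc.exists_mu_mul_le
  -- The price of the first `k₀` iterations; it depends on the parameters only.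
  set A := (1 + c.growth) ^ k₀ with hAdef
  have hg := hc.growth_pos
  have hA0 : 0 < A := by positivity
  have hcl : 0 < c.cLam / 2 := half_pos hc.cLam_pos
  have hkd : 0 < c.kd / 4 := by linarith [hc.kd_pos]
  have r1 := hc.rateC_pos hA0 hcl
  have r2 := hc.rateC_pos hA0 hkd
  have r3 := hc.initC_pos
  refine ⟨c.rateC A (c.cLam / 2) + c.rateC A (c.kd / 4) + c.initC, by positivity, ?_⟩
  intro n K dx dy Ξf Ξg Ω _ _ _ Pr _ P W ρ δf δg σf σg Flow ξf ξg s₀ hn hK _ _ _ _ hA hS hstep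
  have hF := hA.smooth_F hn
  have hG := hA.smooth_G hn
  have hn' : (0 : ℝ) < n := by exact_mod_cast hn
  have hK' : (0 : ℝ) < K := by exact_mod_cast hK
  have hcθ := hc.cθ_pos
  have hl : 0 < c.rateTheta n K := by unfold SunDSBO.Params.rateTheta; positivity
  have hlg := hstep.mul_inv_γ_le hc hA.network.rho_lt_one
  have hp : 0 < 1 - ρ := by linarith [hA.network.rho_lt_one]
  have hkd0 := hc.kd_pos
  have ha : 0 < c.kd * c.rateTheta n K / (1 - ρ) := by positivity
  have hgrad : ∀ k z, gradient (P.Psi c.γ (c.mu k)) z = SunDSBO.gradPsi P c.γ (c.mu k) z :=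
    fun k z => (SunDSBO.hasGradientAt_Psi hc hF hG (hc.mu_pos k).le z).gradient
  have hX := SunDSBO.measurable_augIter (Pr := Pr) (c := c) hA hS (c.rateTheta n K) s₀
  have hint := SunDSBO.lyap_chain hc hA hS hn hl hlg s₀
  have hsum := SunDSBO.sum_integral_gradPsi_consensusError_le hc hA hS hn hl hlg s₀ hk₀ K
  have i1 := fun k => SunDSBO.integrable_gradPsi_sq hc hA hn (hc.mu_pos k).le ha.le (hX k) (hint k)
  have i2 := fun k => SunDSBO.integrable_consensusError hc hA hn (hc.mu_pos k).le ha (hX k) (hint k)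
  simp only [SunDSBO.augIter_fst] at hsum i1 i2
  simp only [hgrad]
  have hC := SunDSBO.C₁_nonneg hc hA hn hl.le s₀
  have S1 : 0 ≤ ∑ k ∈ Finset.range K, ∫ ω,
      ‖SunDSBO.gradPsi P c.γ (c.mu k) (c.run P W K ξf ξg s₀ k ω).mean‖ ^ 2 ∂Pr :=
    Finset.sum_nonneg fun k _ => integral_nonneg fun ω => sq_nonneg _
  have S2 : 0 ≤ ∑ k ∈ Finset.range K, ∫ ω, (c.run P W K ξf ξg s₀ k ω).consensusError ∂Pr :=
    Finset.sum_nonneg fun k _ => integral_nonneg fun ω => SunDSBO.State.consensusError_nonneg _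
  have w1 := mul_nonneg (mul_pos hcl hl).le S1
  have w2 := mul_nonneg (mul_pos hkd hl).le S2
  refine ⟨SunDSBO.isMinOn_prox hc hG, fun k z =>
    (SunDSBO.hasGradientAt_Psi hc hF hG (hc.mu_pos k).le z).differentiableAt, i1, i2, ?_, ?_, ?_⟩
  -- The summed decrease controls both sums together; dropping the nonnegative consensus part leaves
  -- the bound for the gradients.
  · refine (SunDSBO.average_le_of_weighted_sum_le hc hA hn hK s₀ hA0.le hcl
      (by linarith)).trans ?_
    exact mul_le_mul_of_nonneg_right (by linarith) (by positivity)
  · refine (SunDSBO.average_le_of_weighted_sum_le hc hA hn hK s₀ hA0.le hkd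
      (by linarith)).trans ?_
    -- The consensus error satisfies a bound of the same form as the gradients; the stated one is
    -- weaker, by `n ≤ n^(3/2)` and `√K ≤ √(nK)`.
    have hn1 : (1 : ℝ) ≤ n := by exact_mod_cast hn
    have e1 : (n : ℝ) ≤ (n : ℝ) ^ (3 / 2 : ℝ) := Real.self_le_rpow_of_one_le hn1 (by norm_num)
    have e2 : √(K : ℝ) ≤ √((n : ℝ) * (K : ℝ)) :=
      Real.sqrt_le_sqrt (le_mul_of_one_le_left hK'.le hn1)
    refine mul_le_mul (by linarith) ?_ (by positivity) (by positivity)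
    gcongr
  · refine (SunDSBO.C₁_le hc hA hn hl.le hlg s₀).trans ?_
    have hΦ := SunDSBO.Phi_nonneg hc hG hc.μ₀_pos.le hA.lower_bound s₀.mean
    have hΔ := s₀.consensusError_nonneg
    exact mul_le_mul_of_nonneg_right (by linarith) (by positivity)
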